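/- Let $q\in\mathbb C^\times$. Let $L$ be the field of rational functions over $\mathbb C$ in parameters $h_1,h_2,e_1,\dots,e_{11}$ subject to the single relation $$h_1^6h_2^3=e_1e_2e_3e_4e_5e_6\,e_7^2e_8^2e_9^2\,e_{10}^3e_{11}^3 ,$$ and let $\mathcal K$ be the skew field of fractions of the algebra of polynomials in $x,y$ over $L$, where $L$ is central and $yx=q\,xy$. Let $W(E_8^{(1)})=\langle s_0,\dots,s_8\rangle$ be the affine Weyl group whose Dynkin diagram is the chain $s_1-s_2-\cdots-s_8$ with $s_0$ joined to $s_3$. (1) There is exactly one action of $W(E_8^{(1)})$ on $\mathcal K$ by $\mathbb C$-algebra automorphisms with $$s_0:\ e_{10}\mapsto\tfrac{h_2}{e_{11}},\quad e_{11}\mapsto\tfrac{h_2}{e_{10}},\quad h_1\mapsto\tfrac{h_1h_2}{e_{10}e_{11}},\quad x\mapsto x\Bigl(1+\tfrac{h_2}{e_{10}}y\Bigr)(1+e_{11}y)^{-1},$$ $$s_3:\ e_1\mapsto\tfrac{h_1}{e_7},\quad e_7\mapsto\tfrac{h_1}{e_1},\quad h_2\mapsto\tfrac{h_1h_2}{e_1e_7},\quad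 y\mapsto\Bigl(1+\tfrac{e_7}{h_1}x\Bigr)\Bigl(1+\tfrac1{e_1}x\Bigr)^{-1}y,$$ with $s_1,s_2,s_4,s_5,s_6,s_7,s_8$ exchanging respectively $e_8\leftrightarrow e_9$, $e_7\leftrightarrow e_8$, $e_1\leftrightarrow e_2$, $e_2\leftrightarrow e_3$, $e_3\leftrightarrow e_4$, $e_4\leftrightarrow e_5$, $e_5\leftrightarrow e_6$, and all generators $h_i,e_i,x,y$ not listed being fixed. (2) For every $c\in\mathbb C$ there is exactly one polynomial $P=P(x,y)$ over $L$ (powers of $x$ written to the left of powers of $y$) with $P(0,0)=1$, with coefficient of $x^3y$ equal to $c$, and which has both of the forms $$P=\sum_{i=0}^{6}x^i\prod_{t=i}^{2}(1+q^te_{11}y)\prod_{t=3}^{i-1}\Bigl(1+q^t\tfrac{h_2}{e_{10}}y\Bigr)U_i(y)$$ and $$P=\prod_{k=1}^6\Bigl(1+\tfrac{1}{qe_k}x\Bigr)V_0(x)+V_1(x)\,y+\prod_{k=7}^9\Bigl(1+\tfrac{e_k}{h_1}x\Bigr)V_2(x)\,y^2+\prod_{k=7}^9\prod_{t=0}^1\Bigl(1+q^t\tfrac{e_k}{h_1}x\Bigr)V_3(x)\,y^3$$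 with polynomials $U_0,\dots,U_6$ of degrees at most $0,1,2,3,2,1,0$ and $V_0,V_1,V_2,V_3$ of degrees at most $0,6,3,0$ (empty products are $1$). Denote it by $P_{(c)}$. (3) For every $c\in\mathbb C$, the quotient $H=P_{(c)}(x,y)\,x^{-3}y^{-1}\in\mathcal K$ satisfies $w(H)=H$ for all $w\in W(E_8^{(1)})$. (4) $P_{(c)}=P_{(0)}+c\,x^3y$, and $P_{(c)}x^{-3}y^{-1}=P_{(0)}x^{-3}y^{-1}+c\,q^{-3}$. (5) One has $P_{(0)}(x,y)x^{-3}y^{-1}=x^{-3}P_{(0)}(x,q^{-3}y)y^{-1}$, and up to a change of variables and a normalization this is the quantum $E_8$ curve in its rectangular form. Precisely, fix a square root $q^{1/2}$ of $q$ and put $$Q=q^{1/2}x^{-1},\quad \mathsf P=q^{1/2}y,\quad (f_1,f_2,f_3)=h_1^{-1}(e_7,e_8,e_9),\quad (g_1,g_2)=\Bigl(\tfrac1{e_{11}},\tfrac{e_{10}}{h_2}\Bigr),\quad \eta_i=e_{11}e_i\ (1\le i\le 6).$$ Then $Q\mathsf P=q\,\mathsf PQ$ and $\widehat H=q\,x^{-3}P_{(0)}(x,q^{-3}y)y^{-1}$,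 where $$\widehat H=Q^{-3}\bigl(T_0(Q)\mathsf P^{-1}+T_1(Q)+T_2(Q)\mathsf P+T_3(Q)\mathsf P^2\bigr),$$ $$T_0(Q)=\prod_{i=1}^6\Bigl(Q+\frac{1}{q^{1/2}g_1\eta_i}\Bigr),\qquad T_3(Q)=\frac{1}{q^{15/2}g_1^{3}}\prod_{k=1}^3(Q+q^{1/2}f_k)(Q+q^{3/2}f_k),$$ $$T_1(Q)=\frac{1}{q^{7/2}g_1}\Bigl\{[3]Q^6+q^{1/2}[2]A_{-1}Q^5+q(\kappa A_1+A_{-2})Q^4+q\kappa(\kappa A_2+A_{-1})Q^2+q^{1/2}[2]\kappa^2A_1Q+[3]\kappa^2\Bigr\},$$ $$T_2(Q)=\frac{1}{q^{6}g_1^{2}}\prod_{k=1}^3(Q+q^{1/2}f_k)\Bigl\{[3]Q^3+q^{3/2}A_{-1}Q^2+q^{2}\kappa A_1Q+q^{3/2}[3]\kappa\Bigr\},$$ with $[2]=1+q$, $[3]=1+q+q^2$, $\kappa=f_1f_2f_3\,g_2/g_1$, $(a_1,\dots,a_9)=(g_1\eta_1,\dots,g_1\eta_6,f_1^{-1},f_2^{-1},f_3^{-1})$,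 $A_{\pm1}=\sum_i a_i^{\pm1}$ and $A_{\pm2}=\sum_{i<j}(a_ia_j)^{\pm1}$. -/

import Mathlib

open Polynomial
open scoped nonZeroDivisors

noncomputable section

/-- The ring `F[x]`, tagged with the parameter `q` of the endomorphism `x ↦ q x`. -/
def QBase (F : Type*) [Field F] (_q : Fˣ) : Type _ := F[X]

namespace QBase

variable {F : Type*} [Field F] (q : Fˣ)

instance : CommRing (QBase F q) := inferInstanceAs (CommRing F[X])

instance : IsDomain (QBase F q) := inferInstanceAs (IsDomain F[X])

instance {S : Type*} [CommSemiring S] [Algebra S F] : Algebra S (QBase F q) :=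
  inferInstanceAs (Algebra S F[X])

/-- The underlying commutative polynomial in `x`. -/
def toPoly : QBase F q ≃+* F[X] := RingEquiv.refl _

lemma comp_scale_zero (p : F[X]) : p.comp (C ((q : F) ^ 0) * X) = p := by
  simp

lemma comp_scale_add (m n : ℕ) (p : F[X]) : p.comp (C ((q : F) ^ (m + n)) * X) =
    (p.comp (C ((q : F) ^ n) * X)).comp (C ((q : F) ^ m) * X) := by
  rw [Polynomial.comp_assoc]
  congr 1
  simp only [Polynomial.mul_comp, Polynomial.C_comp, Polynomial.X_comp, pow_add, C_mul]
  ring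

lemma comp_scale_eq_zero (n : ℕ) (p : F[X]) (hp : p.comp (C ((q : F) ^ n) * X) = 0) : p = 0 := by
  have hq : (q : F) ^ n ≠ 0 := pow_ne_zero _ q.ne_zero
  have h2 : (p.comp (C ((q : F) ^ n) * X)).comp (C (((q : F) ^ n)⁻¹) * X) = p := by
    rw [Polynomial.comp_assoc]
    simp only [Polynomial.mul_comp, Polynomial.C_comp, Polynomial.X_comp]
    rw [← mul_assoc, ← C_mul, mul_inv_cancel₀ hq, C_1, one_mul, Polynomial.comp_X]
  rw [← h2, hp, Polynomial.zero_comp]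

/-- The `n`-th power `f(x) ↦ f(q ^ n x)` of the twisting endomorphism. -/
def scale (n : ℕ) : QBase F q →+* QBase F q :=
  Polynomial.compRingHom (C ((q : F) ^ n) * X)

lemma scale_zero (p : QBase F q) : scale q 0 p = p := comp_scale_zero q p

lemma scale_add (m n : ℕ) (p : QBase F q) : scale q (m + n) p = scale q m (scale q n p) :=
  comp_scale_add q m n p

/-- `n` acts on `F[x]` by `f(x) ↦ f(q ^ n x)`. -/
instance : MulSemiringAction (Multiplicative ℕ) (QBase F q) where
  smul n p := scale q n.toAdd p
  one_smul p := scale_zero q p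
  mul_smul m n p := scale_add q m.toAdd n.toAdd p
  smul_zero n := map_zero (scale q n.toAdd)
  smul_add n := map_add (scale q n.toAdd)
  smul_one n := map_one (scale q n.toAdd)
  smul_mul n := map_mul (scale q n.toAdd)

lemma smul_def (n : Multiplicative ℕ) (p : QBase F q) : n • p = scale q n.toAdd p := rfl

lemma scale_injective (n : ℕ) : Function.Injective (scale q n) :=
  (injective_iff_map_eq_zero _).mpr fun p hp => comp_scale_eq_zero q n p hp

instance {S : Type*} [CommSemiring S] [Algebra S F] :
    SMulCommClass (Multiplicative ℕ) S (QBase F q) where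
  smul_comm n s p := by
    change Polynomial.comp (s • (p : F[X])) _ = s • Polynomial.comp (p : F[X]) _
    exact Polynomial.smul_comp s p _

end QBase

/-- The quantum plane over `F`: polynomials `∑ f_j(x) y ^ j` with `F` central and `y x = q x y`
(in a skew polynomial ring `y f = φ(f) y`, here with `φ(f)(x) = f(q x)`). -/
abbrev QPlane (F : Type*) [Field F] (q : Fˣ) : Type _ := SkewPolynomial (QBase F q)

namespace QPlane

variable {F : Type*} [Field F] {q : Fˣ}

lemma coeff_mul (a b : QPlane F q) (n : ℕ) :
    SkewPolynomial.coeff (a * b) n = ∑ p ∈ Finset.HasAntidiagonal.antidiagonal n,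
      SkewPolynomial.coeff a p.1 * QBase.scale q p.1 (SkewPolynomial.coeff b p.2) := by
  classical
  have := SkewMonoidAlgebra.coeff_mul_antidiagonal_of_finset a b (Multiplicative.ofAdd n)
    ((Finset.HasAntidiagonal.antidiagonal n).map
      (Equiv.prodCongr Multiplicative.ofAdd Multiplicative.ofAdd).toEmbedding) (by
        rintro ⟨u, v⟩
        simp only [Finset.mem_map_equiv, Finset.HasAntidiagonal.mem_antidiagonal]
        rfl)
  rw [Finset.sum_map] at this
  exact this

/-- `a` has degree less than `n` in `y`. -/
def DegLT (a : QPlane F q) (n : ℕ) : Prop := ∀ m, n ≤ m → SkewPolynomial.coeff a m = 0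

lemma eq_zero_of_degLT_zero {a : QPlane F q} (h : DegLT a 0) : a = 0 :=
  SkewPolynomial.ext fun n => h n (Nat.zero_le n)

lemma exists_degLT (a : QPlane F q) : ∃ n, DegLT a n := by
  refine ⟨(SkewPolynomial.support a).sup id + 1, fun m hm => ?_⟩
  by_contra h
  have := Finset.le_sup (f := id) (SkewPolynomial.mem_support_iff.mpr h)
  simp only [id] at this
  omega

lemma exists_top {a : QPlane F q} (h : a ≠ 0) :
    ∃ n, SkewPolynomial.coeff a n ≠ 0 ∧ DegLT a (n + 1) := by
  classical
  have hex := exists_degLT a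
  obtain ⟨k, hk⟩ : ∃ k, Nat.find hex = k + 1 := by
    refine Nat.exists_eq_succ_of_ne_zero fun h0 => h ?_
    exact eq_zero_of_degLT_zero (h0 ▸ Nat.find_spec hex)
  refine ⟨k, fun h0 => Nat.find_min hex (m := k) (by omega) fun m hm => ?_,
    hk ▸ Nat.find_spec hex⟩
  rcases hm.eq_or_lt with rfl | hm
  · exact h0
  · exact (hk ▸ Nat.find_spec hex) m hm

lemma coeff_mul_top {a b : QPlane F q} {m n : ℕ} (ha : DegLT a (m + 1)) (hb : DegLT b (n + 1)) :
    SkewPolynomial.coeff (a * b) (m + n) =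
      SkewPolynomial.coeff a m * QBase.scale q m (SkewPolynomial.coeff b n) := by
  rw [coeff_mul, Finset.sum_eq_single (m, n)]
  · rintro ⟨i, j⟩ hij hne
    rw [Finset.HasAntidiagonal.mem_antidiagonal] at hij
    simp only at hij ⊢
    by_cases hi : m + 1 ≤ i
    · rw [ha i hi, zero_mul]
    · by_cases hj : n + 1 ≤ j
      · rw [hb j hj, map_zero, mul_zero]
      · exact absurd (Prod.ext (by simp only; omega) (by simp only; omega)) hne
  · intro h
    refine absurd ?_ h
    rw [Finset.HasAntidiagonal.mem_antidiagonal]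

lemma DegLT.mul {a b : QPlane F q} {m n : ℕ} (ha : DegLT a (m + 1)) (hb : DegLT b (n + 1)) :
    DegLT (a * b) (m + n + 1) := by
  intro k hk
  rw [coeff_mul]
  refine Finset.sum_eq_zero ?_
  rintro ⟨i, j⟩ hij
  rw [Finset.HasAntidiagonal.mem_antidiagonal] at hij
  simp only at hij ⊢
  by_cases hi : m + 1 ≤ i
  · rw [ha i hi, zero_mul]
  · rw [hb j (by omega), map_zero, mul_zero]

instance : NoZeroDivisors (QPlane F q) where
  eq_zero_or_eq_zero_of_mul_eq_zero {a b} hab := by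
    by_contra! h
    obtain ⟨m, hm, hm'⟩ := exists_top h.1
    obtain ⟨n, hn, hn'⟩ := exists_top h.2
    have := coeff_mul_top hm' hn'
    rw [hab, SkewPolynomial.coeff_zero] at this
    refine mul_ne_zero hm ?_ this.symm
    exact (map_ne_zero_iff _ (QBase.scale_injective q m)).mpr hn

lemma degLT_monomial (n : ℕ) (c : QBase F q) : DegLT (SkewPolynomial.monomial n c) (n + 1) := by
  intro m hm
  rw [SkewPolynomial.coeff_monomial, if_neg (by omega)]

/-- Pseudo-division. -/
lemma exists_pseudo_div {b : QPlane F q} {m : ℕ} (hm : SkewPolynomial.coeff b m ≠ 0)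
    (hb : DegLT b (m + 1)) (n : ℕ) : ∀ a : QPlane F q, DegLT a n →
      ∃ c u r : QPlane F q, c ≠ 0 ∧ DegLT r m ∧ c * a = u * b + r := by
  induction n with
  | zero =>
    intro a ha
    exact ⟨1, 0, 0, one_ne_zero, fun _ _ => rfl, by simp [eq_zero_of_degLT_zero ha]⟩
  | succ n ih =>
    intro a ha
    by_cases hnm : n + 1 ≤ m
    · exact ⟨1, 0, a, one_ne_zero, fun k hk => ha k (by omega), by simp⟩
    · obtain ⟨k, rfl⟩ : ∃ k, n = k + m := ⟨n - m, by omega⟩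
      have hc : QBase.scale q k (SkewPolynomial.coeff b m) ≠ 0 :=
        (map_ne_zero_iff _ (QBase.scale_injective q k)).mpr hm
      set c₀ : QPlane F q :=
        SkewPolynomial.monomial 0 (QBase.scale q k (SkewPolynomial.coeff b m)) with hc₀
      set u₀ : QPlane F q :=
        SkewPolynomial.monomial k (SkewPolynomial.coeff a (k + m)) with hu₀
      have h1 : SkewPolynomial.coeff (c₀ * a) (0 + (k + m)) = _ :=
        coeff_mul_top (degLT_monomial 0 _) ha
      have h2 : SkewPolynomial.coeff (u₀ * b) (k + m) = _ :=
        coeff_mul_top (degLT_monomial k _) hb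
      have h3 : DegLT (c₀ * a) (0 + (k + m) + 1) := (degLT_monomial 0 _).mul ha
      have h4 : DegLT (u₀ * b) (k + m + 1) := (degLT_monomial k _).mul hb
      rw [zero_add] at h1 h3
      obtain ⟨c, u, r, hc', hr, hcur⟩ := ih (c₀ * a - u₀ * b) (by
        intro j hj
        rw [SkewPolynomial.coeff_sub]
        rcases hj.eq_or_lt with rfl | hj
        · rw [h1, h2, SkewPolynomial.coeff_monomial, SkewPolynomial.coeff_monomial, if_pos rfl,
            if_pos rfl, QBase.scale_zero, mul_comm, sub_self]
        · rw [h3 j hj, h4 j hj, sub_zero])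
      refine ⟨c * c₀, c * u₀ + u, r, mul_ne_zero hc' ?_, hr, ?_⟩
      · rw [hc₀, Ne, SkewPolynomial.monomial_eq_zero_iff]
        exact hc
      · rw [mul_sub] at hcur
        rw [mul_assoc, add_mul, mul_assoc, add_assoc, ← hcur]
        abel

/-- Left Ore condition. -/
lemma exists_left_multiple (n : ℕ) : ∀ b : QPlane F q, b ≠ 0 → DegLT b n → ∀ a : QPlane F q,
    ∃ s t : QPlane F q, s ≠ 0 ∧ s * a = t * b := by
  induction n with
  | zero => exact fun b hb h => absurd (eq_zero_of_degLT_zero h) hb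
  | succ n ih =>
    intro b hb hbn a
    obtain ⟨m, hm, hm'⟩ := exists_top hb
    have hmn : m ≤ n := by
      by_contra h
      exact hm (hbn m (by omega))
    obtain ⟨N, hN⟩ := exists_degLT a
    obtain ⟨c, u, r, hc, hr, h⟩ := exists_pseudo_div hm hm' N a hN
    by_cases hr0 : r = 0
    · exact ⟨c, u, hc, by rw [h, hr0, add_zero]⟩
    · obtain ⟨s, t, hs, hst⟩ := ih r hr0 (fun k hk => hr k (by omega)) b
      have ht : t ≠ 0 := by
        rintro rfl
        rw [zero_mul] at hst
        exact mul_ne_zero hs hb hst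
      exact ⟨t * c, t * u + s, mul_ne_zero ht hc, by
        rw [mul_assoc, h, mul_add, add_mul, hst, mul_assoc]⟩

lemma exists_ore (a : QPlane F q) (b : (QPlane F q)⁰) :
    ∃ (t : QPlane F q) (s : (QPlane F q)⁰), (s : QPlane F q) * a = t * (b : QPlane F q) := by
  obtain ⟨n, hn⟩ := exists_degLT (b : QPlane F q)
  obtain ⟨s, t, hs, hst⟩ := exists_left_multiple n (b : QPlane F q)
    (nonZeroDivisors.ne_zero b.2) hn a
  exact ⟨t, ⟨s, mem_nonZeroDivisors_of_ne_zero hs⟩, hst⟩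

instance instOreSet : OreLocalization.OreSet (QPlane F q)⁰ :=
  (OreLocalization.nonempty_oreSet_iff_of_noZeroDivisors.mpr exists_ore).some

end QPlane

/-- The skew field `F(x, y)` with `y x = q x y`: the (left) Ore field of fractions of the quantum
plane. -/
abbrev QField (F : Type*) [Field F] (q : Fˣ) : Type _ := OreLocalization (QPlane F q)⁰ (QPlane F q)

namespace QPlane

variable {F : Type*} [Field F] {q : Fˣ}

/-- The variable `x`. -/
def x : QPlane F q := SkewPolynomial.C ((QBase.toPoly q).symm X)

/-- The variable `y`. -/
def y : QPlane F q := SkewPolynomial.X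

lemma y_mul_x : (y * x : QPlane F q) = (q : F) • (x * y) := by
  have h1 : (y * x : QPlane F q) = SkewPolynomial.monomial 1
      (QBase.scale q 1 ((QBase.toPoly q).symm X)) := by
    rw [x, y, SkewPolynomial.X, ← SkewPolynomial.monomial_zero_left,
      SkewPolynomial.monomial_mul_monomial, one_mul, add_zero]
    rfl
  have h2 : (x * y : QPlane F q) = SkewPolynomial.monomial 1 ((QBase.toPoly q).symm X) := by
    rw [x, y, SkewPolynomial.C_mul_X_eq_monomial]
  have h3 : QBase.scale q 1 ((QBase.toPoly q).symm X) = (q : F) • (QBase.toPoly q).symm X := by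
    change (X : F[X]).comp (C ((q : F) ^ 1) * X) = (q : F) • (X : F[X])
    rw [X_comp, pow_one, smul_eq_C_mul]
  rw [h1, h2, h3, SkewPolynomial.monomial_def, SkewPolynomial.monomial_def,
    SkewMonoidAlgebra.smul_single]

/-- The coefficient of `x ^ i y ^ j`. -/
def xyCoeff (P : QPlane F q) (i j : ℕ) : F :=
  (QBase.toPoly q (SkewPolynomial.coeff P j)).coeff i

/-- The value `∑ f_j(u) v ^ j` of `P = ∑ f_j(x) y ^ j` at `x = u`, `y = v`
(powers of `u` to the left of powers of `v`). -/
def evalAt {K : Type*} [Ring K] [Algebra F K] (P : QPlane F q) (u v : K) : K :=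
  SkewPolynomial.sum P fun j f => aeval u (QBase.toPoly q f) * v ^ j

end QPlane

namespace QField

variable {F : Type*} [Field F] {q : Fˣ}

/-- The inclusion of the quantum plane in its skew field of fractions. -/
def incl : QPlane F q →+* QField F q := OreLocalization.numeratorRingHom

/-- The variable `x`. -/
def x : QField F q := incl QPlane.x

/-- The variable `y`. -/
def y : QField F q := incl QPlane.y

end QField

namespace QuantumE8

open QField (incl x y)

/-- The entries of the Coxeter matrix of type `E₈⁽¹⁾`: the diagram is the chain
`1 - 2 - 3 - 4 - 5 - 6 - 7 - 8` with one more node `0` joined to `3`. -/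
def coxeterEntry (i j : Fin 9) : ℕ :=
  if i = j then 1
  else if (i, j) ∈ ([(0, 3), (1, 2), (2, 3), (3, 4), (4, 5), (5, 6), (6, 7), (7, 8)] :
      List (Fin 9 × Fin 9)) then 3
  else if (j, i) ∈ ([(0, 3), (1, 2), (2, 3), (3, 4), (4, 5), (5, 6), (6, 7), (7, 8)] :
      List (Fin 9 × Fin 9)) then 3
  else 2

lemma coxeterEntry_symm : ∀ i j : Fin 9, coxeterEntry j i = coxeterEntry i j := by decide

lemma coxeterEntry_diag : ∀ i : Fin 9, coxeterEntry i i = 1 := by decide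

lemma coxeterEntry_off : ∀ i j : Fin 9, i ≠ j → coxeterEntry i j ≠ 1 := by decide

/-- The Coxeter matrix of type `E₈⁽¹⁾`. -/
def coxeterMatrix : CoxeterMatrix (Fin 9) where
  M := coxeterEntry
  isSymm := Matrix.IsSymm.ext coxeterEntry_symm
  diagonal := coxeterEntry_diag
  off_diagonal := coxeterEntry_off

/-- The affine Weyl group `W(E₈⁽¹⁾)`. -/
abbrev W : Type := coxeterMatrix.Group

/-- The field of rational functions over `ℂ` on the torus of the parameters
`h_1, h_2, e_1, …, e_11` subject to
`h_1^6 h_2^3 = e_1 ⋯ e_6 (e_7 e_8 e_9)^2 (e_10 e_11)^3`.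
The constraint is solved for `e_1`, so this is the rational function field in
`h_1, h_2` (variables `inl 0, inl 1`) and `e_2, …, e_11` (variables `inr 0, …, inr 9`). -/
abbrev Params : Type := FractionRing (MvPolynomial (Fin 2 ⊕ Fin 10) ℂ)

/-- `h 0 = h_1` and `h 1 = h_2`. -/
def h (i : Fin 2) : Params := algebraMap (MvPolynomial (Fin 2 ⊕ Fin 10) ℂ) Params (MvPolynomial.X (Sum.inl i))

/-- The parameters `e_2, …, e_11`. -/
def eFree (i : Fin 10) : Params := algebraMap (MvPolynomial (Fin 2 ⊕ Fin 10) ℂ) Params (MvPolynomial.X (Sum.inr i))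

/-- The parameters `e_1, …, e_11`, with the index shifted by one: `e i` is `e_(i+1)`. -/
def e : Fin 11 → Params :=
  Fin.cons
    (h 0 ^ 6 * h 1 ^ 3 / ((eFree 0 * eFree 1 * eFree 2 * eFree 3 * eFree 4) *
      (eFree 5 * eFree 6 * eFree 7) ^ 2 * (eFree 8 * eFree 9) ^ 3))
    eFree

lemma eFree_ne_zero (i : Fin 10) : eFree i ≠ 0 :=
  (map_ne_zero_iff _ (IsFractionRing.injective (MvPolynomial (Fin 2 ⊕ Fin 10) ℂ) Params)).mpr
    (MvPolynomial.X_ne_zero _)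

lemma parameter_constraint :
    h 0 ^ 6 * h 1 ^ 3 = (e 0 * e 1 * e 2 * e 3 * e 4 * e 5) * (e 6 * e 7 * e 8) ^ 2 *
      (e 9 * e 10) ^ 3 := by
  have hz := eFree_ne_zero
  change _ = (h 0 ^ 6 * h 1 ^ 3 / ((eFree 0 * eFree 1 * eFree 2 * eFree 3 * eFree 4) *
    (eFree 5 * eFree 6 * eFree 7) ^ 2 * (eFree 8 * eFree 9) ^ 3) * eFree 0 * eFree 1 * eFree 2 *
    eFree 3 * eFree 4) * (eFree 5 * eFree 6 * eFree 7) ^ 2 * (eFree 8 * eFree 9) ^ 3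
  have h0 := hz 0
  have h1 := hz 1
  have h2 := hz 2
  have h3 := hz 3
  have h4 := hz 4
  have h5 := hz 5
  have h6 := hz 6
  have h7 := hz 7
  have h8 := hz 8
  have h9 := hz 9
  field_simp

/-- The number `q`, as an element of the parameter field. -/
abbrev qP (q : ℂˣ) : Paramsˣ := Units.map (algebraMap ℂ Params).toMonoidHom q

/-- The skew field `ℂ(h_i, e_i)(x, y)`, with `y x = q x y`, over the constrained parameters. -/
abbrev K (q : ℂˣ) : Type := QField Params (qP q)

/-- The quantum polynomials in `x, y` over the constrained parameters. -/
abbrev Plane (q : ℂˣ) : Type := QPlane Params (qP q)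

/-- The image of `h_1, h_2` under the simple reflection `s_i`. -/
def sH (i : Fin 9) (k : Fin 2) : Params :=
  if i = 0 ∧ k = 0 then h 0 * h 1 / (e 9 * e 10)
  else if i = 3 ∧ k = 1 then h 0 * h 1 / (e 0 * e 6)
  else h k

/-- The image of `e_(k+1)` under the simple reflection `s_i`. -/
def sE : Fin 9 → Fin 11 → Params
  | 0, k => if k = 9 then h 1 / e 10 else if k = 10 then h 1 / e 9 else e k
  | 1, k => e (Equiv.swap 7 8 k)
  | 2, k => e (Equiv.swap 6 7 k)
  | 3, k => if k = 0 then h 0 / e 6 else if k = 6 then h 0 / e 0 else e k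
  | 4, k => e (Equiv.swap 0 1 k)
  | 5, k => e (Equiv.swap 1 2 k)
  | 6, k => e (Equiv.swap 2 3 k)
  | 7, k => e (Equiv.swap 3 4 k)
  | 8, k => e (Equiv.swap 4 5 k)

/-- The image of `x` under the simple reflection `s_i`:
`s_0(x) = x (1 + (h_2 / e_10) y) (1 + e_11 y)⁻¹`. -/
def sX (q : ℂˣ) (i : Fin 9) : K q :=
  if i = 0 then x * (1 + (h 1 / e 9) • y) * (1 + e 10 • y)⁻¹ else x

/-- The image of `y` under the simple reflection `s_i`:
`s_3(y) = (1 + (e_7 / h_1) x) (1 + e_1⁻¹ x)⁻¹ y`. -/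
def sY (q : ℂˣ) (i : Fin 9) : K q :=
  if i = 3 then (1 + (e 6 / h 0) • x) * (1 + (e 0)⁻¹ • x)⁻¹ * y else y

/-- `ρ` is the quantum action of `W(E₈⁽¹⁾)` by `ℂ`-algebra automorphisms: the simple reflections
act on the generators `h_i, e_i, x, y` of the skew field by the formulas above. -/
structure IsQuantumAction (q : ℂˣ) (ρ : W →* (K q ≃ₐ[ℂ] K q)) : Prop where
  map_h (i : Fin 9) (k : Fin 2) :
    ρ (coxeterMatrix.simple i) (algebraMap Params (K q) (h k)) = algebraMap Params (K q) (sH i k)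
  map_e (i : Fin 9) (k : Fin 11) :
    ρ (coxeterMatrix.simple i) (algebraMap Params (K q) (e k)) = algebraMap Params (K q) (sE i k)
  map_x (i : Fin 9) : ρ (coxeterMatrix.simple i) x = sX q i
  map_y (i : Fin 9) : ρ (coxeterMatrix.simple i) y = sY q i

/-- The factorization conditions `(x)` and `(y)` for the bidegree `(6, 3)` and the multiplicities
`(1, 1, 1, 1, 1, 1, 2, 2, 2, 3, 3)`. Natural number subtraction is truncated on purpose:
`n - m` stands for `max (n - m) 0`. -/
structure SatisfiesE8Conditions (q : ℂˣ) (P : Plane q) : Prop where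
  x_form : ∃ U : ℕ → Params[X], (∀ i, (U i).natDegree ≤ 3 - (3 - i) - (i - 3)) ∧
    P = ∑ i ∈ Finset.range 7, QPlane.x ^ i * aeval (QPlane.y : Plane q)
      ((∏ t ∈ Finset.Ico i 3, (1 + C ((qP q : Params) ^ t * e 10) * X)) *
        (∏ t ∈ Finset.Ico 3 i, (1 + C ((qP q : Params) ^ t * (h 1 / e 9)) * X)) * U i)
  y_form : ∃ V : ℕ → Params[X], (∀ i, (V i).natDegree ≤ 6 - 6 * (1 - i) - 3 * (i - 1)) ∧
    P = ∑ i ∈ Finset.range 4, aeval (QPlane.x : Plane q)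
      ((if i = 0 then
          ∏ k ∈ ({0, 1, 2, 3, 4, 5} : Finset (Fin 11)), (1 + C ((qP q : Params)⁻¹ * (e k)⁻¹) * X)
        else 1) *
        (∏ k ∈ ({6, 7, 8} : Finset (Fin 11)), ∏ t ∈ Finset.range (i - 1),
          (1 + C ((qP q : Params) ^ t * (e k / h 0)) * X)) * V i) * QPlane.y ^ i

/-- `P` satisfies the conditions, `P(0, 0) = 1`, and the coefficient of `x ^ 3 y` is the complex
number `c`. -/
structure IsE8Polynomial (q : ℂˣ) (c : ℂ) (P : Plane q) : Prop where
  conditions : SatisfiesE8Conditions q P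
  normalized : QPlane.xyCoeff P 0 0 = 1
  coeff_x3_y : QPlane.xyCoeff P 3 1 = algebraMap ℂ Params c

/-- The quotient `H = P(x, y) x⁻³ y⁻¹`. -/
def curve (q : ℂˣ) (P : Plane q) : K q := incl P * (x ^ 3)⁻¹ * y⁻¹

/-- The quantum `E₈` curve in its rectangular form, in variables `Q, P` with `Q P = q P Q` and
parameters `f_1, f_2, f_3`, `g_1, g_2`, `h_1, …, h_6` (indices shifted by one); `r = q ^ (1 / 2)`.
It is `Q⁻³ (T₀(Q) P⁻¹ + T₁(Q) + T₂(Q) P + T₃(Q) P ^ 2)`, normalized so that the coefficient of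
`Q ^ 3 P⁻¹` is `1`. -/
def rectangularCurve {F D : Type*} [Field F] [DivisionRing D] [Algebra F D] (r : F)
    (f : Fin 3 → F) (g : Fin 2 → F) (h : Fin 6 → F) (Q P : D) : D :=
  let q : F := r ^ 2
  let a : Fin 9 → F := Fin.append (fun i : Fin 6 => g 0 * h i) (fun k : Fin 3 => (f k)⁻¹)
  let κ : F := f 0 * f 1 * f 2 * g 1 / g 0
  let A₁ : F := ∑ i, a i
  let B₁ : F := ∑ i, (a i)⁻¹
  let A₂ : F := ∑ i, ∑ j ∈ Finset.Ioi i, a i * a j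
  let B₂ : F := ∑ i, ∑ j ∈ Finset.Ioi i, (a i * a j)⁻¹
  let two : F := 1 + q
  let three : F := 1 + q + q ^ 2
  let T₀ : F[X] := ∏ i, (X + C (r * g 0 * h i)⁻¹)
  let T₁ : F[X] := C (r ^ 7 * g 0)⁻¹ *
    (C three * X ^ 6 + C (r * two * B₁) * X ^ 5 + C (q * (κ * A₁ + B₂)) * X ^ 4 +
      C (q * κ * (κ * A₂ + B₁)) * X ^ 2 + C (r * two * κ ^ 2 * A₁) * X + C (three * κ ^ 2))
  let T₂ : F[X] := C (r ^ 12 * g 0 ^ 2)⁻¹ * (∏ k, (X + C (r * f k))) *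
    (C three * X ^ 3 + C (r ^ 3 * B₁) * X ^ 2 + C (r ^ 4 * κ * A₁) * X + C (r ^ 3 * three * κ))
  let T₃ : F[X] := C (r ^ 15 * g 0 ^ 3)⁻¹ * ∏ k, ((X + C (r * f k)) * (X + C (r ^ 3 * f k)))
  (Q ^ 3)⁻¹ * (aeval Q T₀ * P⁻¹ + aeval Q T₁ + aeval Q T₂ * P + aeval Q T₃ * P ^ 2)

/-- `(f_1, f_2, f_3) = h_1⁻¹ (e_7, e_8, e_9)`. -/
def rectF : Fin 3 → Params := ![e 6 / h 0, e 7 / h 0, e 8 / h 0]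

/-- `(g_1, g_2) = (1 / e_11, e_10 / h_2)`. -/
def rectG : Fin 2 → Params := ![1 / e 10, e 9 / h 1]

/-- The parameters `e_11 (e_1, …, e_6)` of the rectangular form. -/
def rectH : Fin 6 → Params :=
  ![e 10 * e 0, e 10 * e 1, e 10 * e 2, e 10 * e 3, e 10 * e 4, e 10 * e 5]

/-- `Q = q ^ (1 / 2) x⁻¹`, where `r` is a square root of `q`. -/
def rectQ (q : ℂˣ) (r : ℂ) : K q := algebraMap ℂ Params r • (x : K q)⁻¹

/-- `P = q ^ (1 / 2) y`, where `r` is a square root of `q`. -/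
def rectP (q : ℂˣ) (r : ℂ) : K q := algebraMap ℂ Params r • (y : K q)

/-- `x⁻³ P(x, q⁻³ y) y⁻¹`, the other way of writing the quotient. -/
def rescaledCurve (q : ℂˣ) (P : Plane q) : K q :=
  (x ^ 3)⁻¹ * QPlane.evalAt P (x : K q) (((qP q : Params) ^ 3)⁻¹ • (y : K q)) * y⁻¹

end QuantumE8

end

/-! The action rests on two universal properties. A semilinear homomorphism out of the quantum plane
is a choice of images u, v of x, y with vu = q uv (`QPlane.subst`), and it extends to the skew field
of fractions as soon as it is injective (`QField.lift`). On the parameters each s_i multiplies every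
generator by a power of a single monomial, the simple root. Preservation of the constraint and the
Coxeter relations there are then read off from the Cartan matrix (`sGen_eq`, `paramHom_braid`). Only
s_0 moves x and only s_3 moves y; the one substantial relation, between these two, is a rational
identity in a division ring (`braid_identity`, `braid_identity'`).

The polynomial P is a 7 × 4 grid of coefficients in which each row and each column is a prescribed
product of linear factors times a cofactor of small degree. Elimination from the boundary inwards
shows that a solution is determined by its coefficients at 1 and at x³y
(`SatisfiesE8Conditions.eq_zero`). Existence comes from explicit cofactors; their rows and columns
agree because the constraint determines the product of e_1, …, e_6 (`grid_eq`). The monomial x³y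
lies in the one row and the one column without prescribed factors, so its coefficient is free, and
it adds only the constant c q⁻³ to H.

Invariance is proved by reading the grid in the direction that suits the reflection. For i ≠ 0 the
variable x is fixed, and H is a sum of terms q⁻³ʲ x⁻³ f_j(x) yʲ⁻¹ over the columns. The column
cofactors are built from κ, e_11 and symmetric functions of nine quantities permuted by s_1, …, s_8,
so they do not change; s_3 also alters the linear factors attached to e_1 and e_7, and the change of
yʲ⁻¹ absorbs this (`reflHom_three_curve_basePoly`). The reflection s_0 fixes y, and the rows are
used: the powers of s_0(x) absorb the exchange of e_11 and h_2/e_10 (`low_row_congr`,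
`high_row_congr`). The rectangular form is the column expansion again, with every column polynomial
reversed by Q = q^(1/2) x⁻¹. -/

open Polynomial
open scoped nonZeroDivisors

noncomputable section

/-! ### Universal properties of the quantum plane and of its skew field -/

namespace QBase

variable {F : Type*} [Field F] {q : Fˣ}

lemma scale_C (n : ℕ) (c : F) : scale q n ((toPoly q).symm (C c)) = (toPoly q).symm (C c) :=
  C_comp

lemma scale_X (n : ℕ) :
    scale q n ((toPoly q).symm X) = (toPoly q).symm (C ((q : F) ^ n) * X) :=
  X_comp

/-- Induction on elements of `F[x]`. -/
lemma induction {motive : QBase F q → Prop} (hC : ∀ c, motive ((toPoly q).symm (C c)))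
    (hX : motive ((toPoly q).symm X)) (hadd : ∀ a b, motive a → motive b → motive (a + b))
    (hmul : ∀ a b, motive a → motive b → motive (a * b)) (p : QBase F q) : motive p := by
  change motive ((toPoly q).symm (toPoly q p))
  induction toPoly q p using Polynomial.induction_on' with
  | add p r hp hr => rw [map_add]; exact hadd _ _ hp hr
  | monomial n c =>
    rw [← C_mul_X_pow_eq_monomial]
    induction n with
    | zero => simpa using hC c
    | succ n ih => rw [pow_succ, ← mul_assoc, map_mul]; exact hmul _ _ ih hX

end QBase

namespace QPlane

variable {F : Type*} [Field F] {q : Fˣ}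

lemma algebraMap_eq (c : F) :
    algebraMap F (QPlane F q) c = SkewPolynomial.C ((QBase.toPoly q).symm (C c)) := rfl

section Lift

variable {R : Type*} [Ring R] (φ : QBase F q →+* R) (Y : R)
  (h : ∀ f, φ (QBase.scale q 1 f) * Y = Y * φ f)

include h in
lemma lift_comm (n : ℕ) (f : QBase F q) : φ (QBase.scale q n f) * Y ^ n = Y ^ n * φ f := by
  induction n generalizing f with
  | zero => simp [QBase.scale_zero]
  | succ n ih => rw [QBase.scale_add, pow_succ, ← mul_assoc, ih, mul_assoc, h, mul_assoc]

/-- The universal property of the quantum plane. -/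
def lift : QPlane F q →+* R :=
  SkewMonoidAlgebra.liftNCRingHom φ (powersHom R Y) fun {f n} => lift_comm φ Y h n.toAdd f

lemma lift_monomial (n : ℕ) (f : QBase F q) :
    lift φ Y h (SkewPolynomial.monomial n f) = φ f * Y ^ n :=
  SkewMonoidAlgebra.liftNC_single _ _ _ _

lemma lift_C (f : QBase F q) : lift φ Y h (SkewPolynomial.C f) = φ f := by
  rw [← SkewPolynomial.monomial_zero_left, lift_monomial, pow_zero, mul_one]

lemma lift_y : lift φ Y h y = Y := by
  rw [y, SkewPolynomial.X, lift_monomial, map_one, one_mul, pow_one]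

end Lift

lemma monomial_eq (n : ℕ) (f : QBase F q) :
    SkewPolynomial.monomial n f = (SkewPolynomial.C f * y ^ n : QPlane F q) := by
  rw [y, SkewPolynomial.C_mul_X_pow_eq_monomial]

lemma eq_sum_of_degLT {a : QPlane F q} {n : ℕ} (h : DegLT a n) :
    a = ∑ j ∈ Finset.range n, SkewPolynomial.monomial j (SkewPolynomial.coeff a j) := by
  conv_lhs => rw [← SkewPolynomial.sum_monomial a]
  refine SkewPolynomial.sum_eq_of_subset _ (fun i => SkewPolynomial.monomial_zero_right i) ?_
  intro j hj
  rw [SkewPolynomial.mem_support_iff] at hj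
  by_contra hn
  exact hj (h j (by simpa using hn))

lemma ringHom_ext {R : Type*} [Semiring R] {f g : QPlane F q →+* R}
    (hc : ∀ c : F, f (algebraMap F _ c) = g (algebraMap F _ c)) (hx : f x = g x) (hy : f y = g y) :
    f = g := by
  have h0 : ∀ p : QBase F q, f (SkewPolynomial.C p) = g (SkewPolynomial.C p) := by
    refine QBase.induction hc hx (fun a b ha hb => ?_) fun a b ha hb => ?_
    · rw [SkewPolynomial.C_add, map_add, map_add, ha, hb]
    · rw [SkewPolynomial.C_mul, map_mul, map_mul, ha, hb]
  ext a
  obtain ⟨n, hn⟩ := exists_degLT a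
  rw [eq_sum_of_degLT hn, map_sum, map_sum]
  refine Finset.sum_congr rfl fun j _ => ?_
  rw [monomial_eq, map_mul, map_mul, map_pow, map_pow, h0, hy]

section Subst

variable {R : Type*} [Ring R] [Algebra F R] (σ : F →+* F) (hσ : σ q = q) (u v : R)
  (h : v * u = (q : F) • (u * v))

/-- The `σ`-semilinear substitution `f(x) ↦ (σ f)(u)`. -/
def baseSubst : QBase F q →+* R :=
  (eval₂RingHom' ((algebraMap F R).comp σ) u fun a => Algebra.commutes (σ a) u).comp
    (QBase.toPoly q).toRingHom

lemma baseSubst_C (c : F) :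
    baseSubst (q := q) σ u ((QBase.toPoly q).symm (C c)) = algebraMap F R (σ c) :=
  eval₂_C _ _

lemma baseSubst_X : baseSubst (q := q) σ u ((QBase.toPoly q).symm X) = u := eval₂_X _ _

lemma baseSubst_apply (f : QBase F q) :
    baseSubst σ u f = aeval u ((QBase.toPoly q f).map σ) := by
  rw [aeval_def, eval₂_map]
  rfl

-- Both sides respect sums and products in `f`, so only constants and the variable matter. At the
-- variable the claim is the relation `h`, because σ fixes q.
include hσ h in
lemma baseSubst_comm (f : QBase F q) :
    baseSubst σ u (QBase.scale q 1 f) * v = v * baseSubst σ u f := by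
  induction f using QBase.induction with
  | hC c => rw [QBase.scale_C, baseSubst_C, Algebra.commutes]
  | hX =>
    rw [QBase.scale_X, map_mul, map_mul, baseSubst_C, baseSubst_X, pow_one, hσ, h,
      Algebra.smul_def, mul_assoc]
  | hadd a b ha hb => rw [map_add, map_add, map_add, add_mul, mul_add, ha, hb]
  | hmul a b ha hb => rw [map_mul, map_mul, map_mul, mul_assoc, hb, ← mul_assoc, ha, mul_assoc]

/-- The `σ`-semilinear substitution `x ↦ u`, `y ↦ v`. -/
def subst : QPlane F q →+* R := lift (baseSubst σ u) v (baseSubst_comm σ hσ u v h)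

@[simp] lemma subst_algebraMap (c : F) :
    subst σ hσ u v h (algebraMap F _ c) = algebraMap F R (σ c) := by
  rw [algebraMap_eq, subst, lift_C, baseSubst_C]

@[simp] lemma subst_x : subst σ hσ u v h x = u := by
  rw [x, subst, lift_C, baseSubst_X]

@[simp] lemma subst_y : subst σ hσ u v h y = v := lift_y _ _ _

lemma subst_monomial (n : ℕ) (f : QBase F q) :
    subst σ hσ u v h (SkewPolynomial.monomial n f) =
      aeval u ((QBase.toPoly q f).map σ) * v ^ n := by
  rw [subst, lift_monomial, baseSubst_apply]

end Subst

end QPlane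

namespace QField

variable {F : Type*} [Field F] {q : Fˣ}

lemma incl_injective : Function.Injective (incl : QPlane F q →+* QField F q) :=
  OreLocalization.numeratorHom_inj inf_le_left

lemma algebraMap_eq (c : F) : algebraMap F (QField F q) c = incl (algebraMap F _ c) := rfl

lemma y_mul_x : (y * x : QField F q) = (q : F) • (x * y) := by
  rw [x, y, ← map_mul, QPlane.y_mul_x, Algebra.smul_def, Algebra.smul_def, map_mul, map_mul]
  rfl

lemma x_ne_zero : (x : QField F q) ≠ 0 := by
  rw [x, Ne, map_eq_zero_iff _ incl_injective, QPlane.x, SkewPolynomial.C_eq_zero]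
  exact (map_ne_zero_iff _ (QBase.toPoly q).symm.injective).mpr X_ne_zero

lemma y_ne_zero : (y : QField F q) ≠ 0 := by
  rw [y, Ne, map_eq_zero_iff _ incl_injective, QPlane.y, SkewPolynomial.X,
    SkewPolynomial.monomial_eq_zero_iff]
  exact one_ne_zero

/-- The universal property of the skew field of fractions. -/
def lift {D : Type*} [DivisionRing D] (f : QPlane F q →+* D) (hf : Function.Injective f) :
    QField F q →+* D :=
  OreLocalization.universalHom f
    (Units.liftRight ((f : QPlane F q →* D).comp (Submonoid.subtype _))
      (fun s => Units.mk0 (f s) ((map_ne_zero_iff f hf).mpr (nonZeroDivisors.ne_zero s.2)))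
      fun _ => rfl) fun _ => rfl

lemma lift_incl {D : Type*} [DivisionRing D] (f : QPlane F q →+* D) (hf : Function.Injective f)
    (p : QPlane F q) : lift f hf (incl p) = f p :=
  OreLocalization.universalHom_commutes _ _ _

lemma exists_incl (z : QField F q) : ∃ s p : QPlane F q, s ≠ 0 ∧ z = (incl s)⁻¹ * incl p := by
  induction z using OreLocalization.ind with | _ r s
  refine ⟨s, r, nonZeroDivisors.ne_zero s.2, ?_⟩
  have hs : (incl (s : QPlane F q) : QField F q) ≠ 0 :=
    (map_ne_zero_iff _ incl_injective).mpr (nonZeroDivisors.ne_zero s.2)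
  rw [eq_inv_mul_iff_mul_eq₀ hs]
  change OreLocalization.oreDiv (s : QPlane F q) 1 * OreLocalization.oreDiv r s = OreLocalization.oreDiv r 1
  exact OreLocalization.mul_cancel

lemma ringHom_ext {D : Type*} [DivisionRing D] {f g : QField F q →+* D}
    (hc : ∀ c : F, f (algebraMap F _ c) = g (algebraMap F _ c)) (hx : f x = g x) (hy : f y = g y) :
    f = g := by
  have h : f.comp incl = g.comp incl := QPlane.ringHom_ext hc hx hy
  ext z
  obtain ⟨s, p, -, rfl⟩ := exists_incl z
  rw [map_mul, map_mul, map_inv₀, map_inv₀]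
  have hs : f (incl s) = g (incl s) := congrArg (fun k => k s) h
  have hp : f (incl p) = g (incl p) := congrArg (fun k => k p) h
  rw [hs, hp]

end QField

/-! ### Moving linear factors past q-commuting elements -/

section QCommuting

variable {F D : Type*} [Field F] [DivisionRing D] [Algebra F D]

lemma commute_one_add_smul (a b : F) (z : D) : Commute (1 + a • z) (1 + b • z) :=
  (Commute.one_left _).add_left
    (((Commute.one_right _).add_right ((Commute.refl z).smul_right b)).smul_left a)

lemma commute_one_add_smul_inv (a b : F) (z : D) : Commute (1 + a • z) (1 + b • z)⁻¹ :=
  (commute_one_add_smul a b z).inv_right₀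

variable {q : F} {u v : D}

lemma mul_one_add_smul (h : v * u = q • (u * v)) (a : F) :
    v * (1 + a • u) = (1 + (q * a) • u) * v := by
  rw [mul_add, add_mul, mul_one, one_mul, mul_smul_comm, h, smul_smul, smul_mul_assoc, mul_comm a]

lemma pow_mul_one_add_smul (h : v * u = q • (u * v)) (a : F) (n : ℕ) :
    v ^ n * (1 + a • u) = (1 + (q ^ n * a) • u) * v ^ n := by
  induction n generalizing a with
  | zero => simp
  | succ n ih =>
    rw [pow_succ, mul_assoc, mul_one_add_smul h, ← mul_assoc, ih, mul_assoc, ← pow_succ, ← mul_assoc,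
      ← pow_succ]

lemma mul_inv_of_mul_eq {a b c : D} (ha : a ≠ 0) (hb : b ≠ 0) (h : c * a = b * c) :
    c * a⁻¹ = b⁻¹ * c := by
  rw [eq_inv_mul_iff_mul_eq₀ hb, ← mul_assoc, ← h, mul_assoc, mul_inv_cancel₀ ha, mul_one]

end QCommuting

/-! ### The anti-automorphism exchanging the two variables -/

namespace QPlane

variable {F : Type*} [Field F] {q : Fˣ}

lemma coeff_sum {ι : Type*} (s : Finset ι) (f : ι → QPlane F q) (n : ℕ) :
    SkewPolynomial.coeff (∑ i ∈ s, f i) n = ∑ i ∈ s, SkewPolynomial.coeff (f i) n := by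
  classical
  induction s using Finset.induction_on with
  | empty => simp
  | insert a s ha ih => rw [Finset.sum_insert ha, Finset.sum_insert ha, SkewPolynomial.coeff_add, ih]

/-- The anti-automorphism of the quantum plane that exchanges `x` and `y`. -/
def swap : QPlane F q →+* (QPlane F q)ᵐᵒᵖ :=
  subst (RingHom.id F) rfl (MulOpposite.op y) (MulOpposite.op x) <| by
    rw [← MulOpposite.op_mul, ← MulOpposite.op_mul, y_mul_x, MulOpposite.op_smul]

/-- Being an involution can be tested on constants, x and y. It gives the injectivity needed to pass
to the skew field. -/
lemma unop_swap_unop_swap (p : QPlane F q) :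
    MulOpposite.unop (swap (MulOpposite.unop (swap p))) = p := by
  have : ((RingEquiv.opOp (QPlane F q)).symm.toRingHom.comp
      (RingHom.op (swap (F := F) (q := q)))).comp swap = RingHom.id _ := by
    refine ringHom_ext (fun c => ?_) ?_ ?_
    · change MulOpposite.unop (swap (MulOpposite.unop (swap _))) = _
      rw [swap, subst_algebraMap, RingHom.id_apply, MulOpposite.algebraMap_apply,
        MulOpposite.unop_op, subst_algebraMap]
      rfl
    · change MulOpposite.unop (swap (MulOpposite.unop (swap _))) = _
      simp [swap]
    · change MulOpposite.unop (swap (MulOpposite.unop (swap _))) = _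
      simp [swap]
  exact congrArg (fun k => k p) this

lemma swap_injective : Function.Injective (swap : QPlane F q →+* _) := fun a b hab => by
  rw [← unop_swap_unop_swap a, hab, unop_swap_unop_swap]

end QPlane

namespace QField

variable {F : Type*} [Field F] {q : Fˣ}

lemma aeval_x (f : F[X]) :
    aeval (x : QField F q) f = incl (SkewPolynomial.C ((QBase.toPoly q).symm f)) := by
  have := QPlane.subst_monomial (RingHom.id F) (by simp) (x : QField F q) y y_mul_x 0
    ((QBase.toPoly q).symm f)
  rw [SkewPolynomial.monomial_zero_left, pow_zero, mul_one, map_id, RingEquiv.apply_symm_apply]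
    at this
  rw [← this]
  congr 1
  refine QPlane.ringHom_ext (fun c => ?_) ?_ ?_
  · rw [QPlane.subst_algebraMap]
    rfl
  · rw [QPlane.subst_x]
    rfl
  · rw [QPlane.subst_y]
    rfl

lemma aeval_x_ne_zero {f : F[X]} (hf : f ≠ 0) : aeval (x : QField F q) f ≠ 0 := by
  rw [aeval_x, Ne, map_eq_zero_iff _ incl_injective, SkewPolynomial.C_eq_zero]
  exact (map_ne_zero_iff _ (QBase.toPoly q).symm.injective).mpr hf

lemma one_add_C_mul_X_ne_zero (b : F) : (1 + C b * X : F[X]) ≠ 0 := fun h => by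
  simpa using congrArg (fun p : F[X] => p.coeff 0) h

lemma aeval_one_add (b : F) (z : QField F q) : aeval z (1 + C b * X : F[X]) = 1 + b • z := by
  simp [Algebra.smul_def]

lemma one_add_smul_x_ne_zero (b : F) : (1 + b • x : QField F q) ≠ 0 := by
  rw [← aeval_one_add]
  exact aeval_x_ne_zero (one_add_C_mul_X_ne_zero b)

/-! ### Twisted endomorphisms of the skew field -/

section Twist

variable (σ : F →+* F) (hσ : σ q = q) (a b : F)

/-- The element `(1 + a x) (1 + b x)⁻¹ y`. -/
def twistY (q : Fˣ) (a b : F) : QField F q := (1 + a • x) * (1 + b • x)⁻¹ * y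

lemma twistY_mul_x : (twistY q a b * x : QField F q) = (q : F) • (x * twistY q a b) := by
  have h1 : ∀ c : F, Commute (x : QField F q) (1 + c • x) := fun c =>
    (Commute.one_right _).add_right ((Commute.refl x).smul_right c)
  have h2 : Commute (x : QField F q) ((1 + a • x) * (1 + b • x)⁻¹) :=
    (h1 a).mul_right (h1 b).inv_right₀
  rw [twistY, mul_assoc, y_mul_x, mul_smul_comm, ← mul_assoc, ← h2.eq, mul_assoc]

/-- Since yⁿ (1 + b x)⁻¹ = (1 + qⁿ b x)⁻¹ yⁿ, all denominators can be collected on the left: the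
n-th power of the twisted variable is a nonzero rational function of x times yⁿ. -/
lemma exists_twistY_pow (n : ℕ) : ∃ d p : F[X], d ≠ 0 ∧ p ≠ 0 ∧
    aeval (x : QField F q) d * twistY q a b ^ n = aeval x p * y ^ n := by
  induction n with
  | zero => exact ⟨1, 1, one_ne_zero, one_ne_zero, by simp⟩
  | succ n ih =>
    obtain ⟨d, p, hd, hp, h⟩ := ih
    have hy := fun c : F => pow_mul_one_add_smul (y_mul_x (q := q)) c n
    refine ⟨(1 + C ((q : F) ^ n * b) * X) * d, p * (1 + C ((q : F) ^ n * a) * X),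
      mul_ne_zero (one_add_C_mul_X_ne_zero _) hd, mul_ne_zero hp (one_add_C_mul_X_ne_zero _), ?_⟩
    have hy' := mul_inv_of_mul_eq (one_add_smul_x_ne_zero b) (one_add_smul_x_ne_zero _) (hy b)
    have hc : Commute (aeval (x : QField F q) p) (1 + ((q : F) ^ n * b) • x) := by
      rw [← aeval_one_add]
      exact (Commute.all p _).map (aeval (x : QField F q))
    have hc' := commute_one_add_smul ((q : F) ^ n * a) ((q : F) ^ n * b) (x : QField F q)
    rw [map_mul (aeval x), map_mul (aeval x), aeval_one_add, aeval_one_add, pow_succ, mul_assoc, ← mul_assoc (aeval x d),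
      h, twistY, pow_succ]
    calc _ = ((1 + ((q : F) ^ n * b) • x) * aeval x p) * (y ^ n * (1 + a • x)) *
        (1 + b • x)⁻¹ * y := by simp only [mul_assoc]
      _ = aeval x p * ((1 + ((q : F) ^ n * b) • x) * (1 + ((q : F) ^ n * a) • x)) *
        (y ^ n * (1 + b • x)⁻¹) * y := by rw [hy, ← hc.eq]; simp only [mul_assoc]
      _ = aeval x p * (1 + ((q : F) ^ n * a) • x) * ((1 + ((q : F) ^ n * b) • x) *
        (1 + ((q : F) ^ n * b) • x)⁻¹) * (y ^ n * y) := by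
          rw [hy', ← hc'.eq]; simp only [mul_assoc]
      _ = _ := by rw [mul_inv_cancel₀ (one_add_smul_x_ne_zero _), mul_one]

/-- The substitution multiplies the coefficient of yʲ by a nonzero rational function of x, after
applying σ, and does not mix different powers of y. Clearing denominators brings the vanishing back
to the quantum plane, where coefficients can be compared. -/
lemma subst_twistY_injective :
    Function.Injective (QPlane.subst σ hσ x (twistY q a b) (twistY_mul_x a b)) := by
  classical
  rw [injective_iff_map_eq_zero]
  intro P hP
  choose d p hd hp h using exists_twistY_pow (q := q) a b
  obtain ⟨N, hN⟩ := QPlane.exists_degLT P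
  set f : ℕ → F[X] := fun j => QBase.toPoly q (SkewPolynomial.coeff P j) with hf
  -- The common left denominator is the product of all `d i`. In the j-th term the factor `d j`
  -- turns the twisted power into `p j` times yʲ, and the remaining factors survive.
  have key : incl (∑ j ∈ Finset.range N, SkewPolynomial.monomial j ((QBase.toPoly q).symm
      ((f j).map σ * ((∏ i ∈ (Finset.range N).erase j, d i) * p j)))) = (0 : QField F q) := by
    have h1 := congrArg (fun z => aeval (x : QField F q) (∏ i ∈ Finset.range N, d i) * z) hP
    rw [mul_zero, QPlane.eq_sum_of_degLT hN, map_sum, Finset.mul_sum] at h1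
    rw [← h1, map_sum]
    refine Finset.sum_congr rfl fun j hj => ?_
    have hc : aeval (x : QField F q) (d j) * aeval x ((f j).map σ) =
      aeval x ((f j).map σ) * aeval x (d j) := by rw [← map_mul, mul_comm, map_mul]
    have hj' : aeval (x : QField F q) (∏ i ∈ Finset.range N, d i) =
        aeval x (∏ i ∈ (Finset.range N).erase j, d i) * aeval x (d j) := by
      rw [← map_mul, Finset.prod_erase_mul _ _ hj]
    have hc' : aeval (x : QField F q) (∏ i ∈ (Finset.range N).erase j, d i) *
        aeval x ((f j).map σ) = aeval x ((f j).map σ) *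
        aeval x (∏ i ∈ (Finset.range N).erase j, d i) := by rw [← map_mul, mul_comm, map_mul]
    rw [QPlane.subst_monomial, QPlane.monomial_eq, map_mul, map_pow, ← aeval_x, hj', map_mul,
      map_mul, mul_assoc, mul_assoc, mul_assoc]
    have hy : (incl QPlane.y : QField F q) = y := rfl
    rw [hy, ← h, ← mul_assoc (aeval x (d j)), hc]
    simp only [← mul_assoc]
    rw [hc']
  rw [map_eq_zero_iff _ incl_injective] at key
  refine SkewPolynomial.ext fun j => ?_
  by_cases hj : N ≤ j
  · exact hN j hj
  · have h2 := congrArg (fun Q => SkewPolynomial.coeff Q j) key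
    rw [SkewPolynomial.coeff_zero] at h2
    have h3 : SkewPolynomial.coeff (∑ j ∈ Finset.range N, SkewPolynomial.monomial j
        ((QBase.toPoly q).symm ((f j).map σ * ((∏ i ∈ (Finset.range N).erase j, d i) * p j))) :
          QPlane F q) j = (QBase.toPoly q).symm
        ((f j).map σ * ((∏ i ∈ (Finset.range N).erase j, d i) * p j)) := by
      rw [QPlane.coeff_sum, Finset.sum_eq_single j]
      · rw [SkewPolynomial.coeff_monomial, if_pos rfl]
      · intro i _ hij
        rw [SkewPolynomial.coeff_monomial, if_neg hij]
      · exact fun hn => absurd (Finset.mem_range.mpr (not_le.mp hj)) hn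
    rw [h3, map_eq_zero_iff _ (QBase.toPoly q).symm.injective] at h2
    have h4 := (mul_eq_zero.mp h2).resolve_right
      (mul_ne_zero (Finset.prod_ne_zero_iff.mpr fun i _ => hd i) (hp j))
    rwa [Polynomial.map_eq_zero_iff σ.injective, map_eq_zero_iff _ (QBase.toPoly q).injective] at h4

end Twist

lemma op_incl_swap_injective :
    Function.Injective ((RingHom.op (incl (F := F) (q := q))).comp QPlane.swap) := fun _ _ hab =>
  QPlane.swap_injective (MulOpposite.unop_injective (incl_injective (MulOpposite.op_injective hab)))

/-- The anti-automorphism of the skew field that exchanges `x` and `y`. -/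
def swap : QField F q →+* (QField F q)ᵐᵒᵖ :=
  lift ((RingHom.op incl).comp QPlane.swap) op_incl_swap_injective

lemma swap_algebraMap (c : F) :
    swap (algebraMap F (QField F q) c) = MulOpposite.op (algebraMap F _ c) := by
  rw [algebraMap_eq, swap, lift_incl, RingHom.comp_apply, QPlane.swap, QPlane.subst_algebraMap]
  rfl

lemma swap_x : swap (x : QField F q) = MulOpposite.op y := by
  rw [x, swap, lift_incl, RingHom.comp_apply, QPlane.swap, QPlane.subst_x]
  rfl

lemma swap_y : swap (y : QField F q) = MulOpposite.op x := by
  rw [y, swap, lift_incl, RingHom.comp_apply, QPlane.swap, QPlane.subst_y]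
  rfl

/-- The `σ`-semilinear endomorphism `x ↦ x`, `y ↦ (1 + a x) (1 + b x)⁻¹ y`. -/
def twist (σ : F →+* F) (hσ : σ q = q) (a b : F) : QField F q →+* QField F q :=
  lift _ (subst_twistY_injective σ hσ a b)

section

variable (σ : F →+* F) (hσ : σ q = q) (a b : F)

lemma twist_algebraMap (c : F) :
    twist σ hσ a b (algebraMap F _ c) = algebraMap F _ (σ c) := by
  rw [algebraMap_eq, twist, lift_incl, QPlane.subst_algebraMap]

lemma twist_x : twist σ hσ a b x = x := by
  rw [x, twist, lift_incl, QPlane.subst_x]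
  rfl

lemma twist_y : twist σ hσ a b y = (1 + a • x) * (1 + b • x)⁻¹ * y := by
  rw [y, twist, lift_incl, QPlane.subst_y]
  rfl

/-- The `σ`-semilinear endomorphism `x ↦ x (1 + a y) (1 + b y)⁻¹`, `y ↦ y`. -/
def twist' : QField F q →+* QField F q :=
  ((RingEquiv.opOp (QField F q)).symm.toRingHom.comp (RingHom.op swap)).comp
    ((RingHom.op (twist σ hσ a b)).comp swap)

lemma twist'_apply (z : QField F q) : twist' σ hσ a b z =
    MulOpposite.unop (swap (twist σ hσ a b (MulOpposite.unop (swap z)))) := rfl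

lemma twist'_algebraMap (c : F) :
    twist' σ hσ a b (algebraMap F _ c) = algebraMap F _ (σ c) := by
  rw [twist'_apply, swap_algebraMap, MulOpposite.unop_op, twist_algebraMap, swap_algebraMap,
    MulOpposite.unop_op]

lemma twist'_y : twist' σ hσ a b y = y := by
  rw [twist'_apply, swap_y, MulOpposite.unop_op, twist_x, swap_x, MulOpposite.unop_op]

lemma unop_swap_one_add (c : F) :
    MulOpposite.unop (swap (1 + c • x : QField F q)) = 1 + c • y := by
  rw [RingHom.map_add, RingHom.map_one, Algebra.smul_def, RingHom.map_mul, swap_algebraMap, swap_x,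
    Algebra.smul_def, ← MulOpposite.op_mul, MulOpposite.unop_add, MulOpposite.unop_op,
    Algebra.commutes, MulOpposite.unop_one]

lemma twist'_x : twist' σ hσ a b x = x * (1 + a • y) * (1 + b • y)⁻¹ := by
  rw [twist'_apply, swap_x, MulOpposite.unop_op, twist_y, RingHom.map_mul, RingHom.map_mul, map_inv₀, swap_y,
    MulOpposite.unop_mul, MulOpposite.unop_mul, MulOpposite.unop_op, MulOpposite.unop_inv,
    unop_swap_one_add, unop_swap_one_add, ← (commute_one_add_smul_inv a b _).eq, mul_assoc]

lemma one_add_smul_y_ne_zero : (1 + b • y : QField F q) ≠ 0 := by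
  rw [← unop_swap_one_add, Ne, MulOpposite.unop_eq_zero_iff, map_eq_zero]
  exact one_add_smul_x_ne_zero b

end

end QField

/-! ### The action of the reflections on the parameters -/

namespace QuantumE8

open QField (incl x y)

/-- The parameters `h_1, h_2, e_1, …, e_11`. -/
def gen : Fin 2 ⊕ Fin 11 → Params := Sum.elim h e

/-- The images of the parameters under `s_i`. -/
def sGen (i : Fin 9) : Fin 2 ⊕ Fin 11 → Params := Sum.elim (sH i) (sE i)

lemma h_ne_zero (i : Fin 2) : h i ≠ 0 :=
  (map_ne_zero_iff _ (IsFractionRing.injective (MvPolynomial (Fin 2 ⊕ Fin 10) ℂ) Params)).mpr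
    (MvPolynomial.X_ne_zero _)

lemma e_ne_zero (i : Fin 11) : e i ≠ 0 := by
  cases i using Fin.cases with
  | succ i => exact eFree_ne_zero i
  | zero =>
    intro h0
    have := parameter_constraint
    rw [h0] at this
    simp [h_ne_zero] at this

lemma gen_ne_zero (k : Fin 2 ⊕ Fin 11) : gen k ≠ 0 := by
  cases k with
  | inl k => exact h_ne_zero k
  | inr k => exact e_ne_zero k

/-- The exponents of the simple roots, as monomials in the parameters. -/
def rootExp : Fin 9 → Fin 2 ⊕ Fin 11 → ℤ
  | 0 => Sum.elim ![0, 1] ![0, 0, 0, 0, 0, 0, 0, 0, 0, -1, -1]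
  | 1 => Sum.elim ![0, 0] ![0, 0, 0, 0, 0, 0, 0, 1, -1, 0, 0]
  | 2 => Sum.elim ![0, 0] ![0, 0, 0, 0, 0, 0, 1, -1, 0, 0, 0]
  | 3 => Sum.elim ![1, 0] ![-1, 0, 0, 0, 0, 0, -1, 0, 0, 0, 0]
  | 4 => Sum.elim ![0, 0] ![1, -1, 0, 0, 0, 0, 0, 0, 0, 0, 0]
  | 5 => Sum.elim ![0, 0] ![0, 1, -1, 0, 0, 0, 0, 0, 0, 0, 0]
  | 6 => Sum.elim ![0, 0] ![0, 0, 1, -1, 0, 0, 0, 0, 0, 0, 0]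
  | 7 => Sum.elim ![0, 0] ![0, 0, 0, 1, -1, 0, 0, 0, 0, 0, 0]
  | 8 => Sum.elim ![0, 0] ![0, 0, 0, 0, 1, -1, 0, 0, 0, 0, 0]

/-- The values of the simple coroots on the parameters. -/
def corootVal : Fin 9 → Fin 2 ⊕ Fin 11 → ℤ
  | 0 => Sum.elim ![1, 0] ![0, 0, 0, 0, 0, 0, 0, 0, 0, 1, 1]
  | 1 => Sum.elim ![0, 0] ![0, 0, 0, 0, 0, 0, 0, -1, 1, 0, 0]
  | 2 => Sum.elim ![0, 0] ![0, 0, 0, 0, 0, 0, -1, 1, 0, 0, 0]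
  | 3 => Sum.elim ![0, 1] ![1, 0, 0, 0, 0, 0, 1, 0, 0, 0, 0]
  | 4 => Sum.elim ![0, 0] ![-1, 1, 0, 0, 0, 0, 0, 0, 0, 0, 0]
  | 5 => Sum.elim ![0, 0] ![0, -1, 1, 0, 0, 0, 0, 0, 0, 0, 0]
  | 6 => Sum.elim ![0, 0] ![0, 0, -1, 1, 0, 0, 0, 0, 0, 0, 0]
  | 7 => Sum.elim ![0, 0] ![0, 0, 0, -1, 1, 0, 0, 0, 0, 0, 0]
  | 8 => Sum.elim ![0, 0] ![0, 0, 0, 0, -1, 1, 0, 0, 0, 0, 0]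

/-- The exponents of the relation between the parameters. -/
def relExp : Fin 2 ⊕ Fin 11 → ℤ :=
  Sum.elim ![6, 3] ![-1, -1, -1, -1, -1, -1, -2, -2, -2, -3, -3]

/-- `corootVal` is the exponent by which a reflection multiplies a parameter by its root, so these
pairings are the negatives of the entries of the Cartan matrix. -/
lemma pairing_self : ∀ i : Fin 9, ∑ k, corootVal i k * rootExp i k = -2 := by decide

lemma pairing_of_three : ∀ i j : Fin 9, coxeterEntry i j = 3 →
    ∑ k, corootVal i k * rootExp j k = 1 := by decide

lemma pairing_of_two : ∀ i j : Fin 9, coxeterEntry i j = 2 →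
    ∑ k, corootVal i k * rootExp j k = 0 := by decide

/-- Orthogonality of the constraint to every coroot is what makes each reflection preserve it. -/
lemma pairing_relExp : ∀ i : Fin 9, ∑ k, corootVal i k * relExp k = 0 := by decide

/-- The simple roots, as monomials in the parameters. -/
def root (i : Fin 9) : Params := ∏ k, gen k ^ rootExp i k

lemma root_ne_zero (i : Fin 9) : root i ≠ 0 :=
  Finset.prod_ne_zero_iff.mpr fun k _ => zpow_ne_zero _ (gen_ne_zero k)

lemma prod_gen_relExp : ∏ k, gen k ^ relExp k = 1 := by
  have hh := h_ne_zero
  have he := e_ne_zero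
  have hc := parameter_constraint
  have h6 := hh 0
  have h3 := hh 1
  simp [Fintype.prod_sum_type, gen, relExp, Fin.prod_univ_succ]
  have e0 := he 0
  have e1 := he 1
  have e2 := he 2
  have e3 := he 3
  have e4 := he 4
  have e5 := he 5
  have e6 := he 6
  have e7 := he 7
  have e8 := he 8
  have e9 := he 9
  have e10 := he 10
  field_simp
  linear_combination hc

/-- This puts the nine case-by-case formulas into the shape of reflections of a lattice of
exponents; the relations among them then need only the pairings above. -/
lemma sGen_eq (i : Fin 9) (k : Fin 2 ⊕ Fin 11) : sGen i k = gen k * root i ^ corootVal i k := by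
  have hh := h_ne_zero
  have he := e_ne_zero
  have e0 := he 0
  have e1 := he 1
  have e2 := he 2
  have e3 := he 3
  have e4 := he 4
  have e5 := he 5
  have e6 := he 6
  have e7 := he 7
  have e8 := he 8
  have e9 := he 9
  have e10 := he 10
  rcases k with k | k
  · fin_cases i <;> fin_cases k <;>
      simp [sGen, sH, gen, root, rootExp, corootVal, Fintype.prod_sum_type,
        Fin.prod_univ_succ] <;> field_simp
  · fin_cases i <;> fin_cases k <;>
      simp [sGen, sE, gen, root, rootExp, corootVal, Fintype.prod_sum_type,
        Fin.prod_univ_succ, Equiv.swap_apply_def] <;> field_simp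

lemma prod_gen_mul_root (i : Fin 9) (c : Fin 2 ⊕ Fin 11 → ℤ) :
    ∏ k, (gen k * root i ^ corootVal i k) ^ c k =
      (∏ k, gen k ^ c k) * root i ^ ∑ k, corootVal i k * c k := by
  have hz : ∀ s : Finset (Fin 2 ⊕ Fin 11), ∏ k ∈ s, root i ^ (corootVal i k * c k) =
      root i ^ ∑ k ∈ s, corootVal i k * c k := by
    intro s
    induction s using Finset.induction_on with
    | empty => simp
    | insert a s ha ih =>
      rw [Finset.prod_insert ha, Finset.sum_insert ha, ih, zpow_add₀ (root_ne_zero i)]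
  rw [← hz, ← Finset.prod_mul_distrib]
  exact Finset.prod_congr rfl fun k _ => by rw [mul_zpow, zpow_mul]

section ParamHom

variable {R : Type*} [DivisionRing R]

/-- Ring homomorphisms from the parameter field are determined by their values on constants and
on the parameters. -/
lemma params_ringHom_ext {f g : Params →+* R}
    (hc : ∀ c : ℂ, f (algebraMap ℂ _ c) = g (algebraMap ℂ _ c)) (hh : ∀ k, f (h k) = g (h k))
    (he : ∀ k, f (e k) = g (e k)) : f = g := by
  have h0 : ∀ p : MvPolynomial (Fin 2 ⊕ Fin 10) ℂ,
      f (algebraMap _ Params p) = g (algebraMap _ Params p) := by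
    intro p
    induction p using MvPolynomial.induction_on with
    | C a => exact hc a
    | add p q hp hq => rw [map_add, map_add, map_add, hp, hq]
    | mul_X p n hp =>
      rw [map_mul, map_mul, map_mul, hp]
      congr 1
      cases n with
      | inl k => exact hh k
      | inr k => exact he k.succ
  ext z
  obtain ⟨a, b, hb, rfl⟩ := IsFractionRing.div_surjective (A := MvPolynomial (Fin 2 ⊕ Fin 10) ℂ) z
  rw [map_div₀, map_div₀, h0, h0]

end ParamHom

/-- The images of the free parameters under `s_i`. -/
def sFree (i : Fin 9) : Fin 2 ⊕ Fin 10 → Params := Sum.elim (sH i) fun k => sE i k.succ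

lemma isAlgebraic_params_of_gen {A : Subalgebra ℂ Params} (hg : ∀ k, IsAlgebraic A (gen k)) :
    Algebra.IsAlgebraic A Params := by
  have h0 : ∀ p : MvPolynomial (Fin 2 ⊕ Fin 10) ℂ, IsAlgebraic A (algebraMap _ Params p) := by
    intro p
    induction p using MvPolynomial.induction_on with
    | C a => exact isAlgebraic_algebraMap (R := A) (A := Params) (algebraMap ℂ A a)
    | add p q hp hq => rw [map_add]; exact hp.add hq
    | mul_X p n hp =>
      rw [map_mul]
      refine hp.mul ?_
      cases n with
      | inl k => exact hg (Sum.inl k)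
      | inr k => exact hg (Sum.inr k.succ)
  refine ⟨fun z => ?_⟩
  obtain ⟨a, b, hb, rfl⟩ := IsFractionRing.div_surjective (A := MvPolynomial (Fin 2 ⊕ Fin 10) ℂ) z
  rw [div_eq_mul_inv]
  exact (h0 a).mul (h0 b).inv

lemma isAlgebraic_zpow {A : Subalgebra ℂ Params} {z : Params} (hz : IsAlgebraic A z) (n : ℤ) :
    IsAlgebraic A (z ^ n) := by
  cases n with
  | ofNat n => rw [Int.ofNat_eq_natCast, zpow_natCast]; exact hz.pow n
  | negSucc n => rw [zpow_negSucc]; exact (hz.pow _).inv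

lemma isAlgebraic_prod {A : Subalgebra ℂ Params} {ι : Type*} (s : Finset ι) {f : ι → Params}
    (hf : ∀ k ∈ s, IsAlgebraic A (f k)) : IsAlgebraic A (∏ k ∈ s, f k) :=
  Finset.prod_induction _ (IsAlgebraic A) (fun _ _ => IsAlgebraic.mul) isAlgebraic_one hf

/-- The exponent of e_1 in the constraint is -1, so the constraint can be solved for e_1 as a
monomial in the other parameters. -/
lemma gen_e_zero_eq {u : Fin 2 ⊕ Fin 11 → Params} (h0 : u (Sum.inr 0) ≠ 0)
    (hu : ∏ k, u k ^ relExp k = 1) :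
    u (Sum.inr 0) = (∏ k, u (Sum.inl k) ^ relExp (Sum.inl k)) *
      ∏ k : Fin 10, u (Sum.inr k.succ) ^ relExp (Sum.inr k.succ) := by
  rw [Fintype.prod_sum_type, Fin.prod_univ_succ (n := 10), mul_left_comm] at hu
  have h1 : relExp (Sum.inr 0) = -1 := rfl
  rw [h1, zpow_neg_one, inv_mul_eq_one₀ h0] at hu
  exact hu

lemma prod_sGen_relExp (i : Fin 9) : ∏ k, sGen i k ^ relExp k = 1 := by
  simp_rw [sGen_eq]
  rw [prod_gen_mul_root, prod_gen_relExp, pairing_relExp, zpow_zero, one_mul]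

lemma sGen_ne_zero (i : Fin 9) (k : Fin 2 ⊕ Fin 11) : sGen i k ≠ 0 := by
  rw [sGen_eq]
  exact mul_ne_zero (gen_ne_zero k) (zpow_ne_zero _ (root_ne_zero i))

/-- A transcendence degree count. The images of the twelve free parameters generate an algebra over
which the whole field is algebraic, and the transcendence degree is at least twelve, so they cannot
be dependent. Independence is what lets the substitution extend to fractions. -/
lemma algebraicIndependent_sFree (i : Fin 9) : AlgebraicIndependent ℂ (sFree i) := by
  set A := Algebra.adjoin ℂ (Set.range (sFree i)) with hA
  have h1 : ∀ k, IsAlgebraic A (sFree i k) := fun k =>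
    isAlgebraic_algebraMap (R := A) (A := Params) ⟨_, Algebra.subset_adjoin ⟨k, rfl⟩⟩
  have h2 : ∀ k, IsAlgebraic A (sGen i k) := by
    intro k
    match k with
    | Sum.inl k => exact h1 (Sum.inl k)
    | Sum.inr k =>
      cases k using Fin.cases with
      | succ k => exact h1 (Sum.inr k)
      | zero =>
        rw [gen_e_zero_eq (sGen_ne_zero i _) (prod_sGen_relExp i)]
        exact (isAlgebraic_prod _ fun k _ => isAlgebraic_zpow (h1 (Sum.inl k)) _).mul
          (isAlgebraic_prod _ fun k _ => isAlgebraic_zpow (h1 (Sum.inr k)) _)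
  have h3 : IsAlgebraic A (root i) := by
    -- The reflection inverts its own root (exponent 1 - 2), so the root is recovered from the
    -- images, and then so are the original parameters.
    have h4 : ∏ k, sGen i k ^ rootExp i k = (root i)⁻¹ := by
      simp_rw [sGen_eq]
      rw [prod_gen_mul_root, pairing_self]
      change root i * _ = _
      have := root_ne_zero i
      field_simp
    rw [← inv_inv (root i), ← h4]
    exact (isAlgebraic_prod _ fun k _ => isAlgebraic_zpow (h2 k) _).inv
  have : Algebra.IsAlgebraic A Params := by
    refine isAlgebraic_params_of_gen fun k => ?_
    have h5 : gen k = sGen i k * root i ^ (-corootVal i k) := by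
      rw [sGen_eq, mul_assoc, ← zpow_add₀ (root_ne_zero i), add_neg_cancel, zpow_zero, mul_one]
    rw [h5]
    exact (h2 k).mul (isAlgebraic_zpow h3 _)
  have hX : AlgebraicIndependent ℂ
      fun k => algebraMap (MvPolynomial (Fin 2 ⊕ Fin 10) ℂ) Params (MvPolynomial.X k) := by
    have := (MvPolynomial.algebraicIndependent_X (Fin 2 ⊕ Fin 10) ℂ).map'
      (f := IsScalarTower.toAlgHom ℂ (MvPolynomial (Fin 2 ⊕ Fin 10) ℂ) Params)
      (IsFractionRing.injective _ _)
    exact this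
  exact (Algebra.IsAlgebraic.isTranscendenceBasis_of_le_trdeg_of_finite ℂ (sFree i)
    hX.cardinalMk_le_trdeg).1

/-- The action of `s_i` on the parameter field. -/
def paramHom (i : Fin 9) : Params →ₐ[ℂ] Params :=
  IsFractionRing.liftAlgHom (A := MvPolynomial (Fin 2 ⊕ Fin 10) ℂ) (K := Params) (L := Params)
    (g := MvPolynomial.aeval (sFree i)) (algebraicIndependent_sFree i)

lemma paramHom_free (i : Fin 9) (k : Fin 2 ⊕ Fin 10) :
    paramHom i (algebraMap (MvPolynomial (Fin 2 ⊕ Fin 10) ℂ) Params (MvPolynomial.X k)) =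
      sFree i k := by
  refine (IsLocalization.lift_eq _ _).trans ?_
  exact MvPolynomial.aeval_X _ _

/-- Only e_1 needs an argument: it is not a free variable, but it and its prescribed image are given
by the same monomial in the other parameters and in their images. -/
lemma paramHom_gen (i : Fin 9) (k : Fin 2 ⊕ Fin 11) : paramHom i (gen k) = sGen i k := by
  match k with
  | Sum.inl k => exact paramHom_free i (Sum.inl k)
  | Sum.inr k =>
    cases k using Fin.cases with
    | succ k => exact paramHom_free i (Sum.inr k)
    | zero =>
      rw [gen_e_zero_eq (sGen_ne_zero i _) (prod_sGen_relExp i),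
        gen_e_zero_eq (gen_ne_zero _) prod_gen_relExp, map_mul, map_prod, map_prod]
      simp_rw [map_zpow₀]
      exact congrArg₂ _ (Finset.prod_congr rfl fun k _ => by
        rw [show paramHom i (gen (Sum.inl k)) = sGen i (Sum.inl k) from paramHom_free i (Sum.inl k)])
        (Finset.prod_congr rfl fun k _ => by
        rw [show paramHom i (gen (Sum.inr k.succ)) = sGen i (Sum.inr k.succ) from
          paramHom_free i (Sum.inr k)])

lemma paramHom_h (i : Fin 9) (k : Fin 2) : paramHom i (h k) = sH i k := paramHom_gen i (Sum.inl k)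

lemma paramHom_e (i : Fin 9) (k : Fin 11) : paramHom i (e k) = sE i k := paramHom_gen i (Sum.inr k)

lemma paramHom_gen' (i : Fin 9) (k : Fin 2 ⊕ Fin 11) :
    paramHom i (gen k) = gen k * root i ^ corootVal i k := by
  rw [paramHom_gen, sGen_eq]

lemma paramHom_root (i j : Fin 9) :
    paramHom i (root j) = root j * root i ^ ∑ k, corootVal i k * rootExp j k := by
  rw [root, map_prod]
  simp_rw [map_zpow₀, paramHom_gen']
  rw [prod_gen_mul_root]

lemma paramHom_paramHom_self (i : Fin 9) (k : Fin 2 ⊕ Fin 11) :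
    paramHom i (paramHom i (gen k)) = gen k := by
  have h0 := root_ne_zero i
  have h1 : paramHom i (root i) = (root i)⁻¹ := by
    rw [paramHom_root, pairing_self]
    field_simp
  simp only [paramHom_gen', map_mul, map_zpow₀, h1, inv_zpow]
  field_simp

lemma paramHom_comm {i j : Fin 9} (hij : coxeterEntry i j = 2) (k : Fin 2 ⊕ Fin 11) :
    paramHom i (paramHom j (gen k)) = paramHom j (paramHom i (gen k)) := by
  have hji : coxeterEntry j i = 2 := by rw [coxeterEntry_symm, hij]
  rw [paramHom_gen', paramHom_gen', map_mul, map_mul, map_zpow₀, map_zpow₀, paramHom_gen',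
    paramHom_gen', paramHom_root, paramHom_root, pairing_of_two i j hij, pairing_of_two j i hji,
    zpow_zero, mul_one, zpow_zero, mul_one, mul_right_comm]

lemma paramHom_braid {i j : Fin 9} (hij : coxeterEntry i j = 3) (k : Fin 2 ⊕ Fin 11) :
    paramHom i (paramHom j (paramHom i (gen k))) =
      paramHom j (paramHom i (paramHom j (gen k))) := by
  have hji : coxeterEntry j i = 3 := by rw [coxeterEntry_symm, hij]
  have hi := root_ne_zero i
  have hj := root_ne_zero j
  have h1 : paramHom i (root i) = (root i)⁻¹ := by
    rw [paramHom_root, pairing_self]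
    field_simp
  have h2 : paramHom j (root j) = (root j)⁻¹ := by
    rw [paramHom_root, pairing_self]
    field_simp
  have h3 : paramHom i (root j) = root j * root i := by
    rw [paramHom_root, pairing_of_three i j hij, zpow_one]
  have h4 : paramHom j (root i) = root i * root j := by
    rw [paramHom_root, pairing_of_three j i hji, zpow_one]
  simp only [paramHom_gen', map_mul, map_zpow₀, h1, h2, h3, h4]
  simp only [mul_zpow, inv_zpow]
  field_simp

end QuantumE8

/-! ### The braid identity in a division ring -/

section Braid

variable {F D : Type*} [Field F] [DivisionRing D] [Algebra F D] {q : F} {u v : D}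

lemma commute_self_one_add_smul (a : F) (z : D) : Commute z (1 + a • z) :=
  (Commute.one_right _).add_right ((Commute.refl z).smul_right a)

lemma mul_inv_mul_inv_cancel {a b c : D} (hc : c ≠ 0) : a * c * (b * c)⁻¹ = a * b⁻¹ := by
  rw [mul_inv_rev, mul_assoc, ← mul_assoc c, mul_inv_cancel₀ hc, one_mul]

/-- The braid relation for two neighbouring birational maps of the quantum plane. -/
lemma braid_identity (a b g w : F) (ha : a ≠ 0) (hg : g ≠ 0)
    {X X' Y : D} (hY : Y = (1 + a • u) * (1 + b • u)⁻¹ * v)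
    (hX : X = u * (1 + g • v) * (1 + w • v)⁻¹)
    (hX' : X' = u * (1 + (g * b / a) • Y) * (1 + w • Y)⁻¹)
    (h1 : 1 + w • v ≠ 0) (h2 : 1 + b • u ≠ 0) (h3 : 1 + a • u ≠ 0) (h4 : 1 + w • Y ≠ 0) :
    (1 + (a * w / g) • X) * (1 + b • X)⁻¹ * v = (1 + (a * w / g) • X') * (1 + a • X')⁻¹ * Y := by
  have hXv : ∀ c : F, (1 + c • X) * (1 + w • v) = 1 + w • v + c • (u * (1 + g • v)) := by
    intro c
    rw [add_mul, one_mul, smul_mul_assoc, hX, inv_mul_cancel_right₀ h1]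
  have hXY : ∀ c : F, (1 + c • X') * (1 + w • Y) =
      1 + w • Y + c • (u * (1 + (g * b / a) • Y)) := by
    intro c
    rw [add_mul, one_mul, smul_mul_assoc, hX', inv_mul_cancel_right₀ h4]
  have hbY : (1 + b • u) * Y = (1 + a • u) * v := by
    rw [hY, (commute_one_add_smul_inv a b u).eq, mul_assoc, mul_inv_cancel_left₀ h2]
  -- The two numerators agree once the denominators of X and X' are cleared: by `hbY` both equal 1 +
  -- (aw/g) u + w v + wa uv.
  have hN : (1 + (a * w / g) • X) * (1 + w • v) = (1 + (a * w / g) • X') * (1 + w • Y) := by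
    rw [hXv, hXY]
    have h5 : w • Y + (w * b) • (u * Y) = w • v + (w * a) • (u * v) := by
      have := congrArg (fun z => w • z) hbY
      simpa only [add_mul, one_mul, smul_add, smul_mul_assoc, smul_smul] using this
    have e1 : a * w / g * g = w * a := by field_simp
    have e2 : a * w / g * (g * b / a) = w * b := by field_simp
    simp only [mul_add, mul_one, mul_smul_comm, smul_add, smul_smul, e1, e2]
    calc _ = 1 + (a * w / g) • u + (w • v + (w * a) • (u * v)) := by abel
      _ = _ := by rw [← h5]; abel
  -- The cleared denominators are 1 + a u + (w + gb u) Y and 1 + b u + (w + gb u) v. Since w + gb u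
  -- commutes with every 1 + c u, `hbY` makes them proportional, and the factor is exactly the one
  -- relating Y to v.
  have hD : (1 + b • u) * ((1 + a • X') * (1 + w • Y)) =
      (1 + a • u) * ((1 + b • X) * (1 + w • v)) := by
    have e1 : a * (g * b / a) = g * b := by field_simp
    have hc : ∀ c : F, (1 + c • u) * (w • (1 : D) + (g * b) • u) =
      (w • (1 : D) + (g * b) • u) * (1 + c • u) := by
      intro c
      exact ((Commute.one_right _).smul_right w).add_right
        ((commute_self_one_add_smul c u).symm.smul_right _)
    have hl : (1 + a • X') * (1 + w • Y) = 1 + a • u + ((w • (1 : D) + (g * b) • u)) * Y := by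
      rw [hXY]
      simp only [mul_add, add_mul, mul_one, one_mul, mul_smul_comm, smul_mul_assoc, smul_smul, e1,
        smul_add]
      abel
    have hr : (1 + b • X) * (1 + w • v) = 1 + b • u + ((w • (1 : D) + (g * b) • u)) * v := by
      rw [hXv]
      simp only [mul_add, add_mul, mul_one, one_mul, mul_smul_comm, smul_mul_assoc, smul_smul,
        smul_add, mul_comm b]
      abel
    rw [hl, hr, mul_add, mul_add (1 + a • u), ← mul_assoc, ← mul_assoc, hc, hc, mul_assoc,
      mul_assoc, hbY, (commute_one_add_smul a b u).eq]
  have hD' : (1 + a • X') * (1 + w • Y) =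
      (1 + b • u)⁻¹ * (1 + a • u) * ((1 + b • X) * (1 + w • v)) := by
    rw [mul_assoc, ← hD, inv_mul_cancel_left₀ h2]
  have hR : (1 + b • u)⁻¹ * (1 + a • u) ≠ 0 := mul_ne_zero (inv_ne_zero h2) h3
  have hRY : ((1 + b • u)⁻¹ * (1 + a • u))⁻¹ * Y = v := by
    rw [hY, (commute_one_add_smul_inv a b u).eq, inv_mul_cancel_left₀ hR]
  calc (1 + (a * w / g) • X) * (1 + b • X)⁻¹ * v
      = (1 + (a * w / g) • X') * (1 + w • Y) * ((1 + b • X) * (1 + w • v))⁻¹ * v := by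
        rw [← hN, mul_inv_mul_inv_cancel h1]
    _ = (1 + (a * w / g) • X') * (1 + w • Y) * ((1 + a • X') * (1 + w • Y))⁻¹ * Y := by
        rw [hD', mul_inv_rev (_ * _) (_ * _), mul_assoc _ _ v, mul_assoc _ _ Y, mul_assoc _ _ Y,
          hRY]
    _ = _ := by rw [mul_inv_mul_inv_cancel h4]

/-- The mirror image of `braid_identity`. -/
lemma braid_identity' (a b g w : F) (ha : a ≠ 0) (hg : g ≠ 0)
    {X Y Y' : D} (hX : X = u * (1 + g • v) * (1 + w • v)⁻¹)
    (hY : Y = (1 + a • u) * (1 + b • u)⁻¹ * v)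
    (hY' : Y' = (1 + (a * w / g) • X) * (1 + b • X)⁻¹ * v)
    (h1 : 1 + b • u ≠ 0) (h2 : 1 + w • v ≠ 0) (h3 : 1 + g • v ≠ 0) (h4 : 1 + b • X ≠ 0) :
    u * (1 + (g * b / a) • Y) * (1 + w • Y)⁻¹ = X * (1 + (g * b / a) • Y') * (1 + g • Y')⁻¹ := by
  -- In the opposite ring u and v change places, and with them the pairs (a, b) and (g, w).
  have := congrArg MulOpposite.unop <| braid_identity (D := Dᵐᵒᵖ) (u := MulOpposite.op v)
    (v := MulOpposite.op u) g w a b hg ha (X := MulOpposite.op Y) (X' := MulOpposite.op Y')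
    (Y := MulOpposite.op X) (MulOpposite.unop_injective ?_) (MulOpposite.unop_injective ?_)
    (MulOpposite.unop_injective ?_) ?_ ?_ ?_ ?_
  · simp only [MulOpposite.unop_mul, MulOpposite.unop_inv, MulOpposite.unop_add,
      MulOpposite.unop_one, MulOpposite.unop_smul, MulOpposite.unop_op] at this
    rw [mul_assoc, mul_assoc, (commute_one_add_smul_inv _ _ Y).eq,
      (commute_one_add_smul_inv _ _ Y').eq]
    exact this
  · rw [hX, mul_assoc, (commute_one_add_smul_inv _ _ v).eq]
    rfl
  · rw [hY, (commute_one_add_smul_inv _ _ u).eq, mul_assoc]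
    rfl
  · rw [hY', (commute_one_add_smul_inv _ _ X).eq, mul_assoc]
    rfl
  · exact fun h => h1 (congrArg MulOpposite.unop h)
  · exact fun h => h2 (congrArg MulOpposite.unop h)
  · exact fun h => h3 (congrArg MulOpposite.unop h)
  · exact fun h => h4 (congrArg MulOpposite.unop h)


end Braid

/-! ### The Weyl group action on the skew field -/

namespace QuantumE8

open QField (incl x y)

variable {q : ℂˣ}

lemma K_ringHom_ext {D : Type*} [DivisionRing D] {f g : K q →+* D}
    (hc : ∀ c : ℂ, f (algebraMap ℂ _ c) = g (algebraMap ℂ _ c))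
    (hg : ∀ k, f (algebraMap Params _ (gen k)) = g (algebraMap Params _ (gen k)))
    (hx : f x = g x) (hy : f y = g y) : f = g := by
  refine QField.ringHom_ext (fun c => ?_) hx hy
  have : f.comp (algebraMap Params (K q)) = g.comp (algebraMap Params (K q)) :=
    params_ringHom_ext hc (fun k => hg (Sum.inl k)) fun k => hg (Sum.inr k)
  exact congrArg (fun k => k c) this

lemma paramHom_q (i : Fin 9) : (paramHom i).toRingHom (qP q : Params) = (qP q : Params) :=
  (paramHom i).commutes (q : ℂ)

/-- The action of the simple reflection `s_i` on the skew field, as an endomorphism. -/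
def reflHom (q : ℂˣ) (i : Fin 9) : K q →+* K q :=
  if i = 0 then QField.twist' (paramHom i).toRingHom (paramHom_q i) (h 1 / e 9) (e 10)
  else if i = 3 then QField.twist (paramHom i).toRingHom (paramHom_q i) (e 6 / h 0) (e 0)⁻¹
  else QField.twist (paramHom i).toRingHom (paramHom_q i) 0 0

lemma reflHom_algebraMap (i : Fin 9) (c : Params) :
    reflHom q i (algebraMap Params _ c) = algebraMap Params _ (paramHom i c) := by
  unfold reflHom
  split_ifs
  · exact QField.twist'_algebraMap _ _ _ _ _
  · exact QField.twist_algebraMap _ _ _ _ _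
  · exact QField.twist_algebraMap _ _ _ _ _

lemma reflHom_x (i : Fin 9) : reflHom q i x = sX q i := by
  unfold reflHom sX
  split_ifs
  · exact QField.twist'_x _ _ _ _
  · exact QField.twist_x _ _ _ _
  · exact QField.twist_x _ _ _ _

lemma reflHom_y (i : Fin 9) : reflHom q i y = sY q i := by
  unfold reflHom sY
  split_ifs with h0 h3 h3
  · simp [h0] at h3
  · exact QField.twist'_y _ _ _ _
  · exact QField.twist_y _ _ _ _
  · rw [QField.twist_y]
    simp

lemma reflHom_smul (i : Fin 9) (c : Params) (z : K q) :
    reflHom q i (c • z) = paramHom i c • reflHom q i z := by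
  rw [Algebra.smul_def, map_mul, reflHom_algebraMap, Algebra.smul_def]

lemma reflHom_one_add_smul (i : Fin 9) (c : Params) (z : K q) :
    reflHom q i (1 + c • z) = 1 + paramHom i c • reflHom q i z := by
  rw [RingHom.map_add, RingHom.map_one, reflHom_smul]

lemma reflHom_x_of_ne {i : Fin 9} (hi : i ≠ 0) : reflHom q i x = x := by
  rw [reflHom_x, sX, if_neg hi]

lemma reflHom_y_of_ne {i : Fin 9} (hi : i ≠ 3) : reflHom q i y = y := by
  rw [reflHom_y, sY, if_neg hi]

lemma reflHom_zero_x :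
    reflHom q 0 x = x * (1 + (h 1 / e 9) • y) * (1 + e 10 • y)⁻¹ := by
  rw [reflHom_x, sX, if_pos rfl]

lemma reflHom_three_y :
    reflHom q 3 y = (1 + (e 6 / h 0) • x) * (1 + (e 0)⁻¹ • x)⁻¹ * y := by
  rw [reflHom_y, sY, if_pos rfl]

lemma reflHom_const (i : Fin 9) (c : ℂ) :
    reflHom q i (algebraMap ℂ _ c) = algebraMap ℂ _ c := by
  change reflHom q i (algebraMap Params _ (algebraMap ℂ _ c)) = algebraMap Params _ (algebraMap ℂ _ c)
  rw [reflHom_algebraMap, (paramHom i).commutes]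

section ParamValues

/-- The suffixes stand for a = e_7/h_1, b = 1/e_1, g = h_2/e_10 and w = e_11, the coefficients in
s_3(y) and s_0(x). The reflection s_0 exchanges g and w, fixes b and multiplies a by w/g; s_3
exchanges a and b, fixes w and multiplies g by b/a. -/
lemma paramHom_zero_g : paramHom 0 (h 1 / e 9) = e 10 := by
  have := h_ne_zero 1
  rw [map_div₀, paramHom_h, paramHom_e]
  simp [sH, sE]
  field_simp

lemma paramHom_zero_w : paramHom 0 (e 10) = h 1 / e 9 := by
  rw [paramHom_e]
  simp [sE]

lemma paramHom_zero_a : paramHom 0 (e 6 / h 0) = (e 6 / h 0) * e 10 / (h 1 / e 9) := by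
  have h0 := h_ne_zero 0
  have h1 := h_ne_zero 1
  rw [map_div₀, paramHom_h, paramHom_e]
  simp [sH, sE]
  field_simp

lemma paramHom_zero_b : paramHom 0 (e 0)⁻¹ = (e 0)⁻¹ := by
  rw [map_inv₀, paramHom_e]
  simp [sE]

lemma paramHom_three_a : paramHom 3 (e 6 / h 0) = (e 0)⁻¹ := by
  have h0 := h_ne_zero 0
  rw [map_div₀, paramHom_h, paramHom_e]
  simp [sH, sE]
  field_simp

lemma paramHom_three_b : paramHom 3 (e 0)⁻¹ = e 6 / h 0 := by
  rw [map_inv₀, paramHom_e]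
  simp [sE]

lemma paramHom_three_g : paramHom 3 (h 1 / e 9) = (h 1 / e 9) * (e 0)⁻¹ / (e 6 / h 0) := by
  rw [map_div₀, paramHom_h, paramHom_e]
  simp [sH, sE]
  field_simp

lemma paramHom_three_w : paramHom 3 (e 10) = e 10 := by
  rw [paramHom_e]
  simp [sE]

lemma paramHom_g_of_ne {i : Fin 9} (h0 : i ≠ 0) (h3 : i ≠ 3) :
    paramHom i (h 1 / e 9) = h 1 / e 9 := by
  rw [map_div₀, paramHom_h, paramHom_e]
  fin_cases i <;> simp_all [sH, sE, Equiv.swap_apply_def]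

lemma paramHom_w_of_ne {i : Fin 9} (h0 : i ≠ 0) : paramHom i (e 10) = e 10 := by
  rw [paramHom_e]
  fin_cases i <;> simp_all [sE, Equiv.swap_apply_def]

lemma paramHom_a_of_two {i : Fin 9} (hi : coxeterEntry i 3 = 2) :
    paramHom i (e 6 / h 0) = e 6 / h 0 := by
  rw [map_div₀, paramHom_h, paramHom_e]
  fin_cases i <;> simp [coxeterEntry] at hi <;> simp [sH, sE, Equiv.swap_apply_def]

lemma paramHom_b_of_two {i : Fin 9} (hi : coxeterEntry i 3 = 2) :
    paramHom i (e 0)⁻¹ = (e 0)⁻¹ := by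
  rw [map_inv₀, paramHom_e]
  fin_cases i <;> simp [coxeterEntry] at hi <;> simp [sE, Equiv.swap_apply_def]

end ParamValues

end QuantumE8

namespace QuantumE8

open QField (incl x y)

variable {q : ℂˣ}

lemma mul_mul_inv_mul_mul_inv {a b z : K q} (ha : a ≠ 0) (hb : b ≠ 0) :
    z * a * b⁻¹ * b * a⁻¹ = z := by
  rw [inv_mul_cancel_right₀ hb, mul_inv_cancel_right₀ ha]

/-- On x and y this holds because s_0 exchanges g with w and s_3 exchanges a with b: the second
application contributes the inverse of the first factor. -/
lemma reflHom_reflHom_self (i : Fin 9) : (reflHom q i).comp (reflHom q i) = RingHom.id _ := by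
  refine K_ringHom_ext (fun c => ?_) (fun k => ?_) ?_ ?_ <;>
    simp only [RingHom.comp_apply, RingHom.id_apply]
  · rw [reflHom_const, reflHom_const]
  · rw [reflHom_algebraMap, reflHom_algebraMap, paramHom_paramHom_self]
  · by_cases hi : i = 0
    · subst hi
      rw [reflHom_zero_x, RingHom.map_mul, RingHom.map_mul, map_inv₀, reflHom_one_add_smul,
        reflHom_one_add_smul, paramHom_zero_g, paramHom_zero_w, reflHom_y_of_ne (by decide),
        reflHom_zero_x]
      exact mul_mul_inv_mul_mul_inv (QField.one_add_smul_y_ne_zero _)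
        (QField.one_add_smul_y_ne_zero _)
    · rw [reflHom_x_of_ne hi, reflHom_x_of_ne hi]
  · by_cases hi : i = 3
    · subst hi
      rw [reflHom_three_y, RingHom.map_mul, RingHom.map_mul, map_inv₀, reflHom_one_add_smul,
        reflHom_one_add_smul, paramHom_three_a, paramHom_three_b, reflHom_x_of_ne (by decide),
        reflHom_three_y, mul_assoc, mul_assoc,
        inv_mul_cancel_left₀ (QField.one_add_smul_x_ne_zero _),
        mul_inv_cancel_left₀ (QField.one_add_smul_x_ne_zero _)]
    · rw [reflHom_y_of_ne hi, reflHom_y_of_ne hi]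

lemma reflHom_x_fixed {i : Fin 9} (h0 : i ≠ 0) (h3 : i ≠ 3) :
    reflHom q i (reflHom q 0 x) = reflHom q 0 x := by
  rw [reflHom_zero_x, RingHom.map_mul, RingHom.map_mul, map_inv₀, reflHom_one_add_smul,
    reflHom_one_add_smul, paramHom_g_of_ne h0 h3, paramHom_w_of_ne h0, reflHom_y_of_ne h3,
    reflHom_x_of_ne h0]

lemma reflHom_y_fixed {i : Fin 9} (h0 : i ≠ 0) (h3 : i ≠ 3) (hi : coxeterEntry i 3 = 2) :
    reflHom q i (reflHom q 3 y) = reflHom q 3 y := by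
  rw [reflHom_three_y, RingHom.map_mul, RingHom.map_mul, map_inv₀, reflHom_one_add_smul,
    reflHom_one_add_smul, paramHom_a_of_two hi, paramHom_b_of_two hi, reflHom_y_of_ne h3,
    reflHom_x_of_ne h0]

lemma coxeterEntry_zero : ∀ i : Fin 9, i ≠ 0 → coxeterEntry i 0 = 2 → i ≠ 3 := by decide

lemma coxeterEntry_zero_three : ∀ i : Fin 9, i ≠ 0 → coxeterEntry i 0 = 3 → i = 3 := by decide

/-- On the variables the only content is that s_0(x) and s_3(y) are fixed by the reflections not
adjacent to 0 and to 3 respectively, whose parameters they do not involve. -/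
lemma reflHom_comm {i j : Fin 9} (hij : coxeterEntry i j = 2) :
    (reflHom q i).comp (reflHom q j) = (reflHom q j).comp (reflHom q i) := by
  have hji : coxeterEntry j i = 2 := by rw [coxeterEntry_symm, hij]
  have hne : i ≠ j := by
    rintro rfl
    rw [coxeterEntry_diag] at hij
    omega
  have hx : ∀ {i j : Fin 9}, coxeterEntry i j = 2 → i ≠ j → j = 0 →
      reflHom q i (reflHom q j x) = reflHom q j (reflHom q i x) := by
    rintro i j hij hne rfl
    rw [reflHom_x_fixed hne (coxeterEntry_zero i hne hij), reflHom_x_of_ne hne]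
  have hy : ∀ {i j : Fin 9}, coxeterEntry i j = 2 → i ≠ j → j = 3 →
      reflHom q i (reflHom q j y) = reflHom q j (reflHom q i y) := by
    rintro i j hij hne rfl
    have h0 : i ≠ 0 := by
      rintro rfl
      exact absurd hij (by decide)
    rw [reflHom_y_fixed h0 hne hij, reflHom_y_of_ne hne]
  refine K_ringHom_ext (fun c => ?_) (fun k => ?_) ?_ ?_ <;>
    simp only [RingHom.comp_apply]
  · rw [reflHom_const, reflHom_const, reflHom_const]
  · rw [reflHom_algebraMap, reflHom_algebraMap, reflHom_algebraMap, reflHom_algebraMap,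
      paramHom_comm hij]
  · by_cases hj : j = 0
    · exact hx hij hne hj
    · by_cases hi : i = 0
      · exact (hx hji hne.symm hi).symm
      · rw [reflHom_x_of_ne hj, reflHom_x_of_ne hi, reflHom_x_of_ne hj]
  · by_cases hj : j = 3
    · exact hy hij hne hj
    · by_cases hi : i = 3
      · exact (hy hji hne.symm hi).symm
      · rw [reflHom_y_of_ne hj, reflHom_y_of_ne hi, reflHom_y_of_ne hj]

lemma reflHom_inv_one_add_smul (i : Fin 9) (c : Params) (z : K q) :
    reflHom q i (1 + c • z)⁻¹ = (1 + paramHom i c • reflHom q i z)⁻¹ := by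
  rw [map_inv₀, reflHom_one_add_smul]

lemma reflHom_three_zero_x : reflHom q 3 (reflHom q 0 x) =
    x * (1 + ((h 1 / e 9) * (e 0)⁻¹ / (e 6 / h 0)) • reflHom q 3 y) *
      (1 + e 10 • reflHom q 3 y)⁻¹ := by
  rw [reflHom_zero_x, RingHom.map_mul, RingHom.map_mul, reflHom_inv_one_add_smul,
    reflHom_one_add_smul, paramHom_three_g, paramHom_three_w, reflHom_x_of_ne (by decide)]

lemma reflHom_zero_three_y : reflHom q 0 (reflHom q 3 y) =
    (1 + ((e 6 / h 0) * e 10 / (h 1 / e 9)) • reflHom q 0 x) *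
      (1 + (e 0)⁻¹ • reflHom q 0 x)⁻¹ * y := by
  rw [reflHom_three_y, RingHom.map_mul, RingHom.map_mul, reflHom_inv_one_add_smul,
    reflHom_one_add_smul, paramHom_zero_a, paramHom_zero_b, reflHom_y_of_ne (by decide)]

lemma a_ne_zero : e 6 / h 0 ≠ 0 := div_ne_zero (e_ne_zero 6) (h_ne_zero 0)

lemma g_ne_zero : h 1 / e 9 ≠ 0 := div_ne_zero (h_ne_zero 1) (e_ne_zero 9)

lemma one_add_w_reflHom_y_ne_zero : (1 + e 10 • reflHom q 3 y : K q) ≠ 0 := by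
  rw [← paramHom_three_w, ← reflHom_one_add_smul, _root_.map_ne_zero]
  exact QField.one_add_smul_y_ne_zero _

lemma one_add_b_reflHom_x_ne_zero : (1 + (e 0)⁻¹ • reflHom q 0 x : K q) ≠ 0 := by
  rw [← paramHom_zero_b, ← reflHom_one_add_smul, _root_.map_ne_zero]
  exact QField.one_add_smul_x_ne_zero _

lemma reflHom_braid_zero_three_x :
    reflHom q 0 (reflHom q 3 (reflHom q 0 x)) = reflHom q 3 (reflHom q 0 (reflHom q 3 x)) := by
  have h0 := a_ne_zero
  have h1 := g_ne_zero
  have h2 := e_ne_zero 10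
  -- The coefficient gb/a occurring in s_3 s_0(x) is fixed by s_0, which is the form that
  -- `braid_identity'` requires.
  have h3 : e 10 * (e 0)⁻¹ / ((e 6 / h 0) * e 10 / (h 1 / e 9)) =
      (h 1 / e 9) * (e 0)⁻¹ / (e 6 / h 0) := by
    generalize e 6 / h 0 = a at h0
    generalize h 1 / e 9 = g at h1
    field_simp
  rw [reflHom_x_of_ne (show (3 : Fin 9) ≠ 0 by decide)]
  rw [reflHom_three_zero_x, RingHom.map_mul, RingHom.map_mul, reflHom_inv_one_add_smul,
    reflHom_one_add_smul, paramHom_zero_w, map_div₀, map_mul, paramHom_zero_g, paramHom_zero_b,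
    paramHom_zero_a, h3]
  exact (braid_identity' (D := K q) (u := x) (v := y) (e 6 / h 0) (e 0)⁻¹ (h 1 / e 9) (e 10) h0 h1 reflHom_zero_x
    reflHom_three_y reflHom_zero_three_y (QField.one_add_smul_x_ne_zero _)
    (QField.one_add_smul_y_ne_zero _) (QField.one_add_smul_y_ne_zero _)
    one_add_b_reflHom_x_ne_zero).symm

lemma reflHom_braid_zero_three_y :
    reflHom q 0 (reflHom q 3 (reflHom q 0 y)) = reflHom q 3 (reflHom q 0 (reflHom q 3 y)) := by
  have h0 := a_ne_zero
  have h1 := g_ne_zero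
  have h2 := inv_ne_zero (e_ne_zero 0)
  have h3 : (e 0)⁻¹ * e 10 / ((h 1 / e 9) * (e 0)⁻¹ / (e 6 / h 0)) =
      (e 6 / h 0) * e 10 / (h 1 / e 9) := by
    generalize e 6 / h 0 = a at h0
    generalize h 1 / e 9 = g at h1
    generalize (e 0)⁻¹ = b at h2
    field_simp
  rw [reflHom_y_of_ne (show (0 : Fin 9) ≠ 3 by decide)]
  rw [reflHom_zero_three_y, RingHom.map_mul, RingHom.map_mul, reflHom_inv_one_add_smul,
    reflHom_one_add_smul, paramHom_three_b, map_div₀, map_mul, paramHom_three_g, paramHom_three_w,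
    paramHom_three_a, h3]
  exact braid_identity (D := K q) (u := x) (v := y) (e 6 / h 0) (e 0)⁻¹ (h 1 / e 9) (e 10) h0 h1 reflHom_three_y
    reflHom_zero_x reflHom_three_zero_x (QField.one_add_smul_y_ne_zero _)
    (QField.one_add_smul_x_ne_zero _) (QField.one_add_smul_x_ne_zero _)
    one_add_w_reflHom_y_ne_zero

/-- Here s_i fixes y, so this is the braid relation at y. Applying s_i replaces e_7 by e_8 or e_1 by
e_2, which s_3 does not move; after s_3 the middle linear factor cancels against the one in s_3(y).
-/
lemma reflHom_braid_y_aux {i : Fin 9} (h0 : i ≠ 0) (h3 : coxeterEntry i 3 = 3) :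
    reflHom q 3 (reflHom q i (reflHom q 3 y)) = reflHom q i (reflHom q 3 y) := by
  have hi : i = 2 ∨ i = 4 := by
    revert i
    decide
  have hi3 : i ≠ 3 := by
    rintro rfl
    exact absurd h3 (by decide)
  have key : ∀ a b a' b' : Params, paramHom i (e 6 / h 0) = a → paramHom i (e 0)⁻¹ = b →
      paramHom 3 a = a' → paramHom 3 b = b' →
      (1 + a' • (x : K q)) * (1 + b' • x)⁻¹ * ((1 + (e 6 / h 0) • x) * (1 + (e 0)⁻¹ • x)⁻¹ * y) =
        (1 + a • x) * (1 + b • x)⁻¹ * y →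
      reflHom q 3 (reflHom q i (reflHom q 3 y)) = reflHom q i (reflHom q 3 y) := by
    rintro a b _ _ rfl rfl rfl rfl hk
    have h1 : reflHom q i (reflHom q 3 y) = (1 + paramHom i (e 6 / h 0) • x) *
        (1 + paramHom i (e 0)⁻¹ • x)⁻¹ * y := by
      rw [reflHom_three_y, RingHom.map_mul, RingHom.map_mul, reflHom_inv_one_add_smul,
        reflHom_one_add_smul, reflHom_x_of_ne h0, reflHom_y_of_ne hi3]
    rw [h1, RingHom.map_mul, RingHom.map_mul, reflHom_inv_one_add_smul, reflHom_one_add_smul,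
      reflHom_x_of_ne (show (3 : Fin 9) ≠ 0 by decide), reflHom_three_y, hk]
  rcases hi with rfl | rfl
  · refine key (e 7 / h 0) (e 0)⁻¹ (e 7 / h 0) (e 6 / h 0) ?_ ?_ ?_ paramHom_three_b ?_
    · rw [map_div₀, paramHom_h, paramHom_e]
      simp [sH, sE]
    · rw [map_inv₀, paramHom_e]
      simp [sE, Equiv.swap_apply_def]
    · rw [map_div₀, paramHom_h, paramHom_e]
      simp [sH, sE]
    · rw [mul_assoc, mul_assoc (1 + (e 6 / h 0) • x),
        inv_mul_cancel_left₀ (QField.one_add_smul_x_ne_zero _), mul_assoc]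
  · refine key (e 6 / h 0) (e 1)⁻¹ (e 0)⁻¹ (e 1)⁻¹ ?_ ?_ paramHom_three_a ?_ ?_
    · rw [map_div₀, paramHom_h, paramHom_e]
      simp [sH, sE, Equiv.swap_apply_def]
    · rw [map_inv₀, paramHom_e]
      simp [sE]
    · rw [map_inv₀, paramHom_e]
      simp [sE]
    · have h1 := (commute_one_add_smul_inv (e 0)⁻¹ (e 1)⁻¹ (x : K q)).eq
      have h2 := (commute_one_add_smul_inv (e 6 / h 0) (e 0)⁻¹ (x : K q)).eq
      have h3 := (commute_one_add_smul_inv (e 6 / h 0) (e 1)⁻¹ (x : K q)).eq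
      rw [h1, h2, h3, mul_assoc, mul_assoc (1 + (e 0)⁻¹ • x)⁻¹,
        mul_inv_cancel_left₀ (QField.one_add_smul_x_ne_zero _), ← mul_assoc]

lemma reflHom_braid {i j : Fin 9} (hij : coxeterEntry i j = 3) :
    (reflHom q i).comp ((reflHom q j).comp (reflHom q i)) =
      (reflHom q j).comp ((reflHom q i).comp (reflHom q j)) := by
  have hne : i ≠ j := by
    rintro rfl
    rw [coxeterEntry_diag] at hij
    omega
  have hji : coxeterEntry j i = 3 := by rw [coxeterEntry_symm, hij]
  have hx : ∀ {i j : Fin 9}, coxeterEntry i j = 3 → i ≠ j → j = 0 →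
      reflHom q i (reflHom q j (reflHom q i x)) = reflHom q j (reflHom q i (reflHom q j x)) := by
    rintro i j hij hne rfl
    obtain rfl := coxeterEntry_zero_three i hne hij
    exact reflHom_braid_zero_three_x.symm
  have hy : ∀ {i j : Fin 9}, coxeterEntry i j = 3 → i ≠ j → j = 3 →
      reflHom q i (reflHom q j (reflHom q i y)) = reflHom q j (reflHom q i (reflHom q j y)) := by
    rintro i j hij hne rfl
    by_cases h0 : i = 0
    · subst h0
      exact reflHom_braid_zero_three_y
    · rw [reflHom_braid_y_aux h0 hij, reflHom_y_of_ne hne]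
  refine K_ringHom_ext (fun c => ?_) (fun k => ?_) ?_ ?_ <;>
    simp only [RingHom.comp_apply]
  · simp only [reflHom_const]
  · simp only [reflHom_algebraMap]
    rw [paramHom_braid hij]
  · by_cases hj : j = 0
    · exact hx hij hne hj
    · by_cases hi : i = 0
      · exact (hx hji hne.symm hi).symm
      · simp only [reflHom_x_of_ne hj, reflHom_x_of_ne hi]
  · by_cases hj : j = 3
    · exact hy hij hne hj
    · by_cases hi : i = 3
      · exact (hy hji hne.symm hi).symm
      · simp only [reflHom_y_of_ne hj, reflHom_y_of_ne hi]

/-- The action of the simple reflection `s_i` on the skew field. -/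
def refl (q : ℂˣ) (i : Fin 9) : K q ≃ₐ[ℂ] K q :=
  AlgEquiv.ofRingEquiv (f := RingEquiv.ofRingHom (reflHom q i) (reflHom q i)
    (reflHom_reflHom_self i) (reflHom_reflHom_self i)) (reflHom_const i)

lemma refl_apply (i : Fin 9) (z : K q) : refl q i z = reflHom q i z := rfl

lemma refl_mul_self (i : Fin 9) : refl q i * refl q i = 1 :=
  AlgEquiv.ext fun z => congrArg (fun k => k z) (reflHom_reflHom_self i)

lemma refl_comm {i j : Fin 9} (hij : coxeterEntry i j = 2) :
    refl q i * refl q j = refl q j * refl q i :=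
  AlgEquiv.ext fun z => congrArg (fun k => k z) (reflHom_comm hij)

lemma refl_braid {i j : Fin 9} (hij : coxeterEntry i j = 3) :
    refl q i * (refl q j * refl q i) = refl q j * (refl q i * refl q j) :=
  AlgEquiv.ext fun z => congrArg (fun k => k z) (reflHom_braid hij)

lemma coxeterEntry_cases : ∀ i j : Fin 9,
    i = j ∨ coxeterEntry i j = 2 ∨ coxeterEntry i j = 3 := by decide

lemma refl_isLiftable : coxeterMatrix.IsLiftable (refl q) := by
  intro i j
  change (refl q i * refl q j) ^ coxeterEntry i j = 1
  rcases coxeterEntry_cases i j with rfl | h | h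
  · rw [coxeterEntry_diag, pow_one, refl_mul_self]
  · rw [h, pow_two]
    nth_rw 2 [refl_comm h]
    rw [mul_assoc, ← mul_assoc (refl q j), refl_mul_self, one_mul, refl_mul_self]
  · rw [h, pow_succ, pow_two]
    have := refl_braid (q := q) h
    calc _ = refl q i * (refl q j * refl q i) * (refl q j * (refl q i * refl q j)) := by
          simp only [mul_assoc]
      _ = refl q j * (refl q i * (refl q j * refl q j) * refl q i) * refl q j := by
          rw [this]; simp only [mul_assoc]
      _ = 1 := by rw [refl_mul_self, mul_one, refl_mul_self, mul_one, refl_mul_self]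

/-- The action of the affine Weyl group on the skew field. -/
def weylAction (q : ℂˣ) : W →* (K q ≃ₐ[ℂ] K q) :=
  coxeterMatrix.toCoxeterSystem.lift ⟨refl q, refl_isLiftable⟩

lemma weylAction_simple (i : Fin 9) : weylAction q (coxeterMatrix.simple i) = refl q i :=
  coxeterMatrix.toCoxeterSystem.lift_apply_simple refl_isLiftable i

lemma weylAction_isQuantumAction : IsQuantumAction q (weylAction q) where
  map_h i k := by rw [weylAction_simple, refl_apply, reflHom_algebraMap, paramHom_h]
  map_e i k := by rw [weylAction_simple, refl_apply, reflHom_algebraMap, paramHom_e]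
  map_x i := by rw [weylAction_simple, refl_apply, reflHom_x]
  map_y i := by rw [weylAction_simple, refl_apply, reflHom_y]

/-- A homomorphism from the skew field is determined by complex constants, parameters, x and y. This
gives uniqueness of the action and carries invariance over to an arbitrary ρ. -/
lemma IsQuantumAction.simple_eq {ρ : W →* (K q ≃ₐ[ℂ] K q)} (hρ : IsQuantumAction q ρ) (i : Fin 9) :
    ρ (coxeterMatrix.simple i) = refl q i := by
  have : (ρ (coxeterMatrix.simple i)).toRingEquiv.toRingHom = reflHom q i := by
    refine K_ringHom_ext (fun c => ?_) (fun k => ?_) ?_ ?_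
    · rw [reflHom_const]
      exact (ρ (coxeterMatrix.simple i)).commutes c
    · rw [reflHom_algebraMap, paramHom_gen]
      rcases k with k | k
      · exact hρ.map_h i k
      · exact hρ.map_e i k
    · rw [reflHom_x]
      exact hρ.map_x i
    · rw [reflHom_y]
      exact hρ.map_y i
  exact AlgEquiv.ext fun z => congrArg (fun k => k z) this

lemma existsUnique_isQuantumAction :
    ∃! ρ : W →* (K q ≃ₐ[ℂ] K q), IsQuantumAction q ρ := by
  refine ⟨weylAction q, weylAction_isQuantumAction, fun ρ hρ => ?_⟩
  refine coxeterMatrix.toCoxeterSystem.ext_simple fun i => ?_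
  exact (hρ.simple_eq i).trans (weylAction_simple i).symm

end QuantumE8

/-! ### Polynomials as lists of coefficients -/

section CoeffList

variable {F : Type*} [Field F]

/-- The polynomial with a given list of coefficients. -/
def polyL : List F → F[X]
  | [] => 0
  | a :: l => C a + X * polyL l

/-- The coefficients of `(1 + a X) p + c`, for `p` with a given list of coefficients. -/
def linMul (a : F) : F → List F → List F
  | c, [] => [c]
  | c, b :: l => (b + c) :: linMul a (a * b) l

lemma polyL_coeff (l : List F) (k : ℕ) : (polyL l).coeff k = l.getD k 0 := by
  induction l generalizing k with
  | nil => simp [polyL]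
  | cons a l ih => cases k <;> simp [polyL, coeff_C, ih]

/-- The extra constant acts as a carry: multiplying by 1 + a X passes a times each coefficient on to
the next position, and the induction needs the carry to be arbitrary. -/
lemma one_add_mul_polyL_add (a c : F) (l : List F) :
    (1 + C a * X) * polyL l + C c = polyL (linMul a c l) := by
  induction l generalizing c with
  | nil => simp [polyL, linMul]
  | cons b l ih =>
    rw [polyL, linMul, polyL, ← ih, C_add, C_mul]
    ring

lemma one_add_mul_polyL (a : F) (l : List F) :
    (1 + C a * X) * polyL l = polyL (linMul a 0 l) := by
  rw [← one_add_mul_polyL_add, C_0, add_zero]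

lemma eq_polyL {p : F[X]} {n : ℕ} (h : p.natDegree ≤ n) :
    p = polyL ((List.range (n + 1)).map p.coeff) := by
  ext k
  rw [polyL_coeff]
  by_cases hk : k < n + 1
  · simp [hk]
  · rw [coeff_eq_zero_of_natDegree_lt (by omega)]
    simp [hk]

lemma natDegree_polyL_le {l : List F} {n : ℕ} (h : l.length ≤ n + 1) : (polyL l).natDegree ≤ n :=
  natDegree_le_iff_coeff_eq_zero.mpr fun k hk => by
    rw [polyL_coeff, List.getD_eq_default _ _ (by omega)]

/-- The product of the factors `1 + a X`. -/
def linProd (as : List F) : F[X] := (as.map fun a => 1 + C a * X).prod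

lemma linProd_nil : linProd ([] : List F) = 1 := rfl

lemma linProd_cons (a : F) (as : List F) : linProd (a :: as) = (1 + C a * X) * linProd as :=
  List.prod_cons

lemma linProd_mul_polyL (as l : List F) :
    linProd as * polyL l = polyL (as.foldr (fun a l => linMul a 0 l) l) := by
  induction as with
  | nil => simp [linProd]
  | cons a as ih => rw [linProd_cons, mul_assoc, ih, one_add_mul_polyL, List.foldr_cons]

end CoeffList

/-! ### Coefficients of elements of the quantum plane -/

namespace QPlane

variable {F : Type*} [Field F] {q : Fˣ}

lemma aeval_x (f : F[X]) :
    aeval (x : QPlane F q) f = SkewPolynomial.C ((QBase.toPoly q).symm f) := by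
  induction f using Polynomial.induction_on' with
  | add f g hf hg => rw [map_add, hf, hg, map_add, SkewPolynomial.C_add]
  | monomial n c =>
    rw [aeval_monomial, ← C_mul_X_pow_eq_monomial, map_mul, SkewPolynomial.C_mul, map_pow,
      SkewPolynomial.C_pow]
    rfl

lemma aeval_x_mul_y_pow (f : F[X]) (n : ℕ) : aeval (x : QPlane F q) f * y ^ n =
    SkewPolynomial.monomial n ((QBase.toPoly q).symm f) := by
  rw [monomial_eq, aeval_x]

lemma xyCoeff_add (P Q : QPlane F q) (i j : ℕ) :
    xyCoeff (P + Q) i j = xyCoeff P i j + xyCoeff Q i j := by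
  rw [xyCoeff, SkewPolynomial.coeff_add, map_add, Polynomial.coeff_add]
  rfl

lemma xyCoeff_sub (P Q : QPlane F q) (i j : ℕ) :
    xyCoeff (P - Q) i j = xyCoeff P i j - xyCoeff Q i j := by
  rw [xyCoeff, SkewPolynomial.coeff_sub, map_sub, Polynomial.coeff_sub]
  rfl

lemma xyCoeff_sum {ι : Type*} (s : Finset ι) (f : ι → QPlane F q) (i j : ℕ) :
    xyCoeff (∑ k ∈ s, f k) i j = ∑ k ∈ s, xyCoeff (f k) i j := by
  rw [xyCoeff, coeff_sum, map_sum, Polynomial.finsetSum_coeff]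
  rfl

lemma ext_xyCoeff {P Q : QPlane F q} (h : ∀ i j, xyCoeff P i j = xyCoeff Q i j) : P = Q :=
  SkewPolynomial.ext fun j => (QBase.toPoly q).injective (Polynomial.ext fun i => h i j)

lemma xyCoeff_aeval_x_mul (f : F[X]) (n i j : ℕ) :
    xyCoeff (aeval (x : QPlane F q) f * y ^ n) i j = if n = j then f.coeff i else 0 := by
  rw [aeval_x_mul_y_pow, xyCoeff, SkewPolynomial.coeff_monomial]
  split_ifs
  · rw [RingEquiv.apply_symm_apply]
  · rw [map_zero, Polynomial.coeff_zero]

lemma xyCoeff_mul_aeval_y (f : F[X]) (n i j : ℕ) :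
    xyCoeff (x ^ n * aeval (y : QPlane F q) f) i j = if n = i then f.coeff j else 0 := by
  induction f using Polynomial.induction_on' with
  | add f g hf hg =>
    rw [map_add, mul_add, xyCoeff_add, hf, hg]
    split_ifs <;> simp
  | monomial m c =>
    have : (x ^ n * aeval (y : QPlane F q) (monomial m c)) =
        aeval (x : QPlane F q) (C c * X ^ n) * y ^ m := by
      rw [aeval_monomial, map_mul, map_pow, aeval_X, aeval_C, ← mul_assoc,
        (Algebra.commutes c (x ^ n : QPlane F q)).symm]
    rw [this, xyCoeff_aeval_x_mul, coeff_C_mul, coeff_X_pow, coeff_monomial]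
    by_cases h1 : m = j <;> by_cases h2 : n = i <;> simp [h1, h2, eq_comm]

end QPlane

/-! ### Uniqueness of the polynomial -/

namespace QuantumE8

variable {q : ℂˣ}

/-- The linear factors of the coefficient of `x ^ i` in the `x`-form. -/
def rowRoots (q : ℂˣ) : ℕ → List Params
  | 0 => [e 10, (qP q : Params) * e 10, (qP q : Params) ^ 2 * e 10]
  | 1 => [(qP q : Params) * e 10, (qP q : Params) ^ 2 * e 10]
  | 2 => [(qP q : Params) ^ 2 * e 10]
  | 3 => []
  | 4 => [(qP q : Params) ^ 3 * (h 1 / e 9)]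
  | 5 => [(qP q : Params) ^ 3 * (h 1 / e 9), (qP q : Params) ^ 4 * (h 1 / e 9)]
  | _ => [(qP q : Params) ^ 3 * (h 1 / e 9), (qP q : Params) ^ 4 * (h 1 / e 9),
      (qP q : Params) ^ 5 * (h 1 / e 9)]

/-- The linear factors of the coefficient of `y ^ j` in the `y`-form. -/
def colRoots (q : ℂˣ) : ℕ → List Params
  | 0 => [(qP q : Params)⁻¹ * (e 0)⁻¹, (qP q : Params)⁻¹ * (e 1)⁻¹, (qP q : Params)⁻¹ * (e 2)⁻¹,
      (qP q : Params)⁻¹ * (e 3)⁻¹, (qP q : Params)⁻¹ * (e 4)⁻¹, (qP q : Params)⁻¹ * (e 5)⁻¹]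
  | 1 => []
  | 2 => [e 6 / h 0, e 7 / h 0, e 8 / h 0]
  | _ => [e 6 / h 0, (qP q : Params) * (e 6 / h 0), e 7 / h 0, (qP q : Params) * (e 7 / h 0),
      e 8 / h 0, (qP q : Params) * (e 8 / h 0)]

lemma rowRoots_spec {i : ℕ} (hi : i < 7) :
    (∏ t ∈ Finset.Ico i 3, (1 + C ((qP q : Params) ^ t * e 10) * X)) *
      (∏ t ∈ Finset.Ico 3 i, (1 + C ((qP q : Params) ^ t * (h 1 / e 9)) * X)) =
    linProd (rowRoots q i) := by
  interval_cases i <;>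
    simp only [rowRoots, linProd_cons, linProd_nil, Finset.prod_Ico_eq_prod_range] <;>
    simp [Finset.prod_range_succ, mul_assoc]

lemma colRoots_spec {j : ℕ} (hj : j < 4) :
    (if j = 0 then
        ∏ k ∈ ({0, 1, 2, 3, 4, 5} : Finset (Fin 11)), (1 + C ((qP q : Params)⁻¹ * (e k)⁻¹) * X)
      else 1) *
      (∏ k ∈ ({6, 7, 8} : Finset (Fin 11)), ∏ t ∈ Finset.range (j - 1),
        (1 + C ((qP q : Params) ^ t * (e k / h 0)) * X)) = linProd (colRoots q j) := by
  have h1 : ∀ f : Fin 11 → Params[X], ∏ k ∈ ({0, 1, 2, 3, 4, 5} : Finset (Fin 11)), f k =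
      f 0 * (f 1 * (f 2 * (f 3 * (f 4 * (f 5 * 1))))) := fun f => by
    rw [Finset.prod_insert (by decide), Finset.prod_insert (by decide),
      Finset.prod_insert (by decide), Finset.prod_insert (by decide),
      Finset.prod_insert (by decide), Finset.prod_singleton, mul_one]
  have h2 : ∀ f : Fin 11 → Params[X], ∏ k ∈ ({6, 7, 8} : Finset (Fin 11)), f k =
      f 6 * (f 7 * (f 8 * 1)) := fun f => by
    rw [Finset.prod_insert (by decide), Finset.prod_insert (by decide), Finset.prod_singleton,
      mul_one]
  simp only [h1, h2]
  interval_cases j <;>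
    simp only [colRoots, linProd_cons, linProd_nil] <;>
    simp [Finset.prod_range_succ, mul_assoc]

lemma satisfiesE8Conditions_iff {P : Plane q} : SatisfiesE8Conditions q P ↔
    (∃ U : ℕ → Params[X], (∀ i, (U i).natDegree ≤ 3 - (3 - i) - (i - 3)) ∧
      P = ∑ i ∈ Finset.range 7, QPlane.x ^ i * aeval (QPlane.y : Plane q)
        (linProd (rowRoots q i) * U i)) ∧
    ∃ V : ℕ → Params[X], (∀ i, (V i).natDegree ≤ 6 - 6 * (1 - i) - 3 * (i - 1)) ∧
      P = ∑ j ∈ Finset.range 4, aeval (QPlane.x : Plane q)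
        (linProd (colRoots q j) * V j) * QPlane.y ^ j := by
  have h1 : ∀ U : ℕ → Params[X], ∑ i ∈ Finset.range 7, QPlane.x ^ i * aeval (QPlane.y : Plane q)
        (linProd (rowRoots q i) * U i) = ∑ i ∈ Finset.range 7, QPlane.x ^ i *
        aeval (QPlane.y : Plane q)
      ((∏ t ∈ Finset.Ico i 3, (1 + C ((qP q : Params) ^ t * e 10) * X)) *
        (∏ t ∈ Finset.Ico 3 i, (1 + C ((qP q : Params) ^ t * (h 1 / e 9)) * X)) * U i) :=
    fun U => Finset.sum_congr rfl fun i hi => by rw [rowRoots_spec (Finset.mem_range.mp hi)]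
  have h2 : ∀ V : ℕ → Params[X], ∑ j ∈ Finset.range 4, aeval (QPlane.x : Plane q)
        (linProd (colRoots q j) * V j) * QPlane.y ^ j =
      ∑ i ∈ Finset.range 4, aeval (QPlane.x : Plane q)
      ((if i = 0 then
          ∏ k ∈ ({0, 1, 2, 3, 4, 5} : Finset (Fin 11)), (1 + C ((qP q : Params)⁻¹ * (e k)⁻¹) * X)
        else 1) *
        (∏ k ∈ ({6, 7, 8} : Finset (Fin 11)), ∏ t ∈ Finset.range (i - 1),
          (1 + C ((qP q : Params) ^ t * (e k / h 0)) * X)) * V i) * QPlane.y ^ i :=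
    fun V => Finset.sum_congr rfl fun i hi => by rw [colRoots_spec (Finset.mem_range.mp hi)]
  simp only [h1, h2]
  exact ⟨fun h => ⟨h.x_form, h.y_form⟩, fun h => ⟨h.1, h.2⟩⟩

lemma SatisfiesE8Conditions.sub {P Q : Plane q} (hP : SatisfiesE8Conditions q P)
    (hQ : SatisfiesE8Conditions q Q) : SatisfiesE8Conditions q (P - Q) := by
  rw [satisfiesE8Conditions_iff] at *
  obtain ⟨⟨U, hU, hU'⟩, V, hV, hV'⟩ := hP
  obtain ⟨⟨U₂, hU₂, hU₂'⟩, V₂, hV₂, hV₂'⟩ := hQ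
  refine ⟨⟨fun i => U i - U₂ i, fun i => (natDegree_sub_le _ _).trans (max_le (hU i) (hU₂ i)), ?_⟩,
    fun i => V i - V₂ i, fun i => (natDegree_sub_le _ _).trans (max_le (hV i) (hV₂ i)), ?_⟩
  · rw [hU', hU₂', ← Finset.sum_sub_distrib]
    exact Finset.sum_congr rfl fun i _ => by rw [← mul_sub, ← map_sub, ← mul_sub]
  · rw [hV', hV₂', ← Finset.sum_sub_distrib]
    exact Finset.sum_congr rfl fun i _ => by rw [← sub_mul, ← map_sub, ← mul_sub]

lemma xyCoeff_x_form (f : ℕ → Params[X]) (n i j : ℕ) :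
    QPlane.xyCoeff (∑ i ∈ Finset.range n, QPlane.x ^ i * aeval (QPlane.y : Plane q) (f i)) i j =
      if i < n then (f i).coeff j else 0 := by
  rw [QPlane.xyCoeff_sum]
  simp only [QPlane.xyCoeff_mul_aeval_y, Finset.sum_ite_eq', Finset.mem_range]

lemma xyCoeff_y_form (f : ℕ → Params[X]) (n i j : ℕ) :
    QPlane.xyCoeff (∑ j ∈ Finset.range n, aeval (QPlane.x : Plane q) (f j) * QPlane.y ^ j) i j =
      if j < n then (f j).coeff i else 0 := by
  rw [QPlane.xyCoeff_sum]
  simp only [QPlane.xyCoeff_aeval_x_mul, Finset.sum_ite_eq', Finset.mem_range]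

-- Elimination from the boundary of the grid. Column 0, row 0, column 3 and row 6 have constant
-- cofactors, each killed by one known zero. Rows 1 and 5 then meet the two zero columns 0 and 3,
-- column 2 meets the four zero rows 0, 1, 5, 6, and rows 2 and 4 meet the three zero columns 0, 2,
-- 3. These numbers match the free coefficients, and only x³y is left. Each system is triangular
-- with pivots 1 or monomials in q and the parameters, so no condition on q appears.
set_option linter.unusedSimpArgs false in
lemma SatisfiesE8Conditions.eq_zero {P : Plane q} (hP : SatisfiesE8Conditions q P)
    (h00 : QPlane.xyCoeff P 0 0 = 0) (h31 : QPlane.xyCoeff P 3 1 = 0) : P = 0 := by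
  obtain ⟨⟨U, hU, hUP⟩, V, hV, hVP⟩ := satisfiesE8Conditions_iff.mp hP
  have hrow : ∀ i j, i < 7 → QPlane.xyCoeff P i j = (linProd (rowRoots q i) * U i).coeff j := by
    intro i j hi
    rw [hUP, xyCoeff_x_form, if_pos hi]
  have hcol : ∀ i j, j < 4 → QPlane.xyCoeff P i j = (linProd (colRoots q j) * V j).coeff i := by
    intro i j hj
    rw [hVP, xyCoeff_y_form, if_pos hj]
  have hcol' : ∀ j, j < 4 → V j = 0 → ∀ i, QPlane.xyCoeff P i j = 0 := fun j hj h i => by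
    rw [hcol i j hj, h, mul_zero, Polynomial.coeff_zero]
  have hrow' : ∀ i, i < 7 → U i = 0 → ∀ j, QPlane.xyCoeff P i j = 0 := fun i hi h j => by
    rw [hrow i j hi, h, mul_zero, Polynomial.coeff_zero]
  have hq : (qP q : Params) ≠ 0 := (qP q).ne_zero
  have hw := e_ne_zero 10
  have hg := g_ne_zero
  have hf : ∀ k, e k / h 0 ≠ 0 := fun k => div_ne_zero (e_ne_zero k) (h_ne_zero 0)
  have uL := fun i => eq_polyL (hU i)
  have vL := fun i => eq_polyL (hV i)
  have v0 : V 0 = 0 := by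
    have h1 := vL 0
    have k0 : (V 0).coeff 0 = 0 := by
      have k := hcol 0 0 (by omega)
      rw [h1, linProd_mul_polyL, polyL_coeff, h00] at k
      simpa [colRoots, linMul, List.range_succ, hf] using k.symm
    rw [h1]
    simp [List.range_succ, polyL, k0]
  have c0 := hcol' 0 (by omega) v0
  have u0 : U 0 = 0 := by
    have h1 := uL 0
    have k0 : (U 0).coeff 0 = 0 := by
      have k := hrow 0 0 (by omega)
      rw [h1, linProd_mul_polyL, polyL_coeff, c0 0] at k
      simpa [rowRoots, linMul, List.range_succ, hq, hw, hg] using k.symm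
    rw [h1]
    simp [List.range_succ, polyL, k0]
  have r0 := hrow' 0 (by omega) u0
  have v3 : V 3 = 0 := by
    have h1 := vL 3
    have k0 : (V 3).coeff 0 = 0 := by
      have k := hcol 0 3 (by omega)
      rw [h1, linProd_mul_polyL, polyL_coeff, r0 3] at k
      simpa [colRoots, linMul, List.range_succ, hf] using k.symm
    rw [h1]
    simp [List.range_succ, polyL, k0]
  have c3 := hcol' 3 (by omega) v3
  have u6 : U 6 = 0 := by
    have h1 := uL 6
    have k0 : (U 6).coeff 0 = 0 := by
      have k := hrow 6 0 (by omega)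
      rw [h1, linProd_mul_polyL, polyL_coeff, c0 6] at k
      simpa [rowRoots, linMul, List.range_succ, hq, hw, hg] using k.symm
    rw [h1]
    simp [List.range_succ, polyL, k0]
  have r6 := hrow' 6 (by omega) u6
  have u1 : U 1 = 0 := by
    have h1 := uL 1
    have k0 : (U 1).coeff 0 = 0 := by
      have k := hrow 1 0 (by omega)
      rw [h1, linProd_mul_polyL, polyL_coeff, c0 1] at k
      simpa [rowRoots, linMul, List.range_succ, hq, hw, hg] using k.symm
    have k1 : (U 1).coeff 1 = 0 := by
      have k := hrow 1 3 (by omega)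
      rw [h1, linProd_mul_polyL, polyL_coeff, c3 1] at k
      simpa [rowRoots, linMul, List.range_succ, hq, hw, hg, k0] using k.symm
    rw [h1]
    simp [List.range_succ, polyL, k0, k1]
  have r1 := hrow' 1 (by omega) u1
  have u5 : U 5 = 0 := by
    have h1 := uL 5
    have k0 : (U 5).coeff 0 = 0 := by
      have k := hrow 5 0 (by omega)
      rw [h1, linProd_mul_polyL, polyL_coeff, c0 5] at k
      simpa [rowRoots, linMul, List.range_succ, hq, hw, hg] using k.symm
    have k1 : (U 5).coeff 1 = 0 := by
      have k := hrow 5 3 (by omega)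
      rw [h1, linProd_mul_polyL, polyL_coeff, c3 5] at k
      simpa [rowRoots, linMul, List.range_succ, hq, hw, hg, k0] using k.symm
    rw [h1]
    simp [List.range_succ, polyL, k0, k1]
  have r5 := hrow' 5 (by omega) u5
  have v2 : V 2 = 0 := by
    have h1 := vL 2
    have k0 : (V 2).coeff 0 = 0 := by
      have k := hcol 0 2 (by omega)
      rw [h1, linProd_mul_polyL, polyL_coeff, r0 2] at k
      simpa [colRoots, linMul, List.range_succ, hf] using k.symm
    have k1 : (V 2).coeff 1 = 0 := by
      have k := hcol 1 2 (by omega)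
      rw [h1, linProd_mul_polyL, polyL_coeff, r1 2] at k
      simpa [colRoots, linMul, List.range_succ, hf, k0] using k.symm
    -- Coefficients 0 and 1 come from the low rows; the other two are taken from the top downwards,
    -- which keeps the system triangular.
    have k2 : (V 2).coeff 3 = 0 := by
      have k := hcol 6 2 (by omega)
      rw [h1, linProd_mul_polyL, polyL_coeff, r6 2] at k
      simpa [colRoots, linMul, List.range_succ, hf, k0, k1] using k.symm
    have k3 : (V 2).coeff 2 = 0 := by
      have k := hcol 5 2 (by omega)
      rw [h1, linProd_mul_polyL, polyL_coeff, r5 2] at k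
      simpa [colRoots, linMul, List.range_succ, hf, k0, k1, k2] using k.symm
    rw [h1]
    simp [List.range_succ, polyL, k0, k1, k2, k3]
  have c2 := hcol' 2 (by omega) v2
  have u2 : U 2 = 0 := by
    have h1 := uL 2
    have k0 : (U 2).coeff 0 = 0 := by
      have k := hrow 2 0 (by omega)
      rw [h1, linProd_mul_polyL, polyL_coeff, c0 2] at k
      simpa [rowRoots, linMul, List.range_succ, hq, hw, hg] using k.symm
    have k1 : (U 2).coeff 2 = 0 := by
      have k := hrow 2 3 (by omega)
      rw [h1, linProd_mul_polyL, polyL_coeff, c3 2] at k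
      simpa [rowRoots, linMul, List.range_succ, hq, hw, hg, k0] using k.symm
    have k2 : (U 2).coeff 1 = 0 := by
      have k := hrow 2 2 (by omega)
      rw [h1, linProd_mul_polyL, polyL_coeff, c2 2] at k
      simpa [rowRoots, linMul, List.range_succ, hq, hw, hg, k0, k1] using k.symm
    rw [h1]
    simp [List.range_succ, polyL, k0, k1, k2]
  have r2 := hrow' 2 (by omega) u2
  have u4 : U 4 = 0 := by
    have h1 := uL 4
    have k0 : (U 4).coeff 0 = 0 := by
      have k := hrow 4 0 (by omega)
      rw [h1, linProd_mul_polyL, polyL_coeff, c0 4] at k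
      simpa [rowRoots, linMul, List.range_succ, hq, hw, hg] using k.symm
    have k1 : (U 4).coeff 2 = 0 := by
      have k := hrow 4 3 (by omega)
      rw [h1, linProd_mul_polyL, polyL_coeff, c3 4] at k
      simpa [rowRoots, linMul, List.range_succ, hq, hw, hg, k0] using k.symm
    have k2 : (U 4).coeff 1 = 0 := by
      have k := hrow 4 2 (by omega)
      rw [h1, linProd_mul_polyL, polyL_coeff, c2 4] at k
      simpa [rowRoots, linMul, List.range_succ, hq, hw, hg, k0, k1] using k.symm
    rw [h1]
    simp [List.range_succ, polyL, k0, k1, k2]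
  have r4 := hrow' 4 (by omega) u4
  refine QPlane.ext_xyCoeff fun i j => ?_
  have hz : QPlane.xyCoeff (0 : Plane q) i j = 0 := rfl
  rw [hz]
  by_cases hi : i < 7
  · by_cases hj : j < 4
    · interval_cases i
      · exact r0 j
      · exact r1 j
      · exact r2 j
      · interval_cases j
        · exact c0 3
        · exact h31
        · exact c2 3
        · exact c3 3
      · exact r4 j
      · exact r5 j
      · exact r6 j
    · rw [hVP, xyCoeff_y_form, if_neg hj]
  · rw [hUP, xyCoeff_x_form, if_neg hi]

end QuantumE8

/-! ### The explicit solution and its compatibility -/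

section Grid

variable {F : Type*} [Field F]

/-- The coefficients of `(∏ (1 + a X)) p`, for `p` with a given list of coefficients. -/
def linProdMul (as l : List F) : List F := as.foldr (fun a l => linMul a 0 l) l

/-- The linear factors of the rows. -/
def gridRowRoots (q w g : F) : ℕ → List F
  | 0 => [w, q * w, q ^ 2 * w]
  | 1 => [q * w, q ^ 2 * w]
  | 2 => [q ^ 2 * w]
  | 3 => []
  | 4 => [q ^ 3 * g]
  | 5 => [q ^ 3 * g, q ^ 4 * g]
  | _ => [q ^ 3 * g, q ^ 4 * g, q ^ 5 * g]

/-- The linear factors of the columns, except for the first one. -/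
def gridColRoots (q f₁ f₂ f₃ : F) : ℕ → List F
  | 0 => []
  | 1 => [f₁, f₂, f₃]
  | _ => [f₁, q * f₁, f₂, q * f₂, f₃, q * f₃]

/-- The coefficients of the remaining factors of the rows. -/
def gridRow (q w g f₁ f₂ f₃ ε₁ s₁ : F) (c : ℕ → F) : ℕ → List F
  | 0 => [c 0]
  | 1 => [c 1, w * (1 + q) * (f₁ + f₂ + f₃)]
  | 2 => [c 2, w * (f₁ * f₂ * f₃ * w / g * s₁ + ε₁ * (f₁ + f₂ + f₃) +
        (f₁ * f₂ + f₁ * f₃ + f₂ * f₃)) + (f₁ * f₂ + f₁ * f₃ + f₂ * f₃) * w ^ 2 / g,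
      q * w ^ 2 * ((1 + q ^ 2) * (f₁ * f₂ + f₁ * f₃ + f₂ * f₃) + q * (f₁ + f₂ + f₃) ^ 2)]
  | 3 => [c 3, 0, q * w ^ 2 * ((1 + q + q ^ 2) * (f₁ * f₂ * f₃) * (1 + w / g) +
        q * (ε₁ + (f₁ + f₂ + f₃)) * (f₁ * f₂ + f₁ * f₃ + f₂ * f₃) +
        q * (w / g) * (f₁ * f₂ * f₃ * s₁ + (f₁ * f₂ + f₁ * f₃ + f₂ * f₃)) * (f₁ + f₂ + f₃)),
      q ^ 3 * w ^ 3 * ((1 + q ^ 3) * (f₁ * f₂ * f₃) +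
        q * (1 + q) * (f₁ + f₂ + f₃) * (f₁ * f₂ + f₁ * f₃ + f₂ * f₃))]
  | 4 => [c 4, (f₁ * f₂ * f₃ * w ^ 3 / g ^ 2 * (s₁ * (f₁ * f₂ + f₁ * f₃ + f₂ * f₃) +
        (f₁ + f₂ + f₃)) + f₁ * f₂ * f₃ * w ^ 2 / g * (ε₁ + (f₁ + f₂ + f₃))) / q,
      w ^ 3 / g * (q * (1 + q ^ 2) * (f₁ + f₂ + f₃) * (f₁ * f₂ * f₃) +
        q ^ 2 * (f₁ * f₂ + f₁ * f₃ + f₂ * f₃) ^ 2)]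
  | 5 => [c 5, (1 + q) * w ^ 3 * (f₁ * f₂ + f₁ * f₃ + f₂ * f₃) * (f₁ * f₂ * f₃) / (q ^ 2 * g ^ 2)]
  | _ => [c 6]

/-- The coefficients of the remaining factors of the columns, except for the first one. -/
def gridCol (q w κ A₁ A₂ B₁ B₂ : F) : ℕ → List F
  | 0 => [w * (1 + q + q ^ 2), w * (1 + q) * B₁, w * (κ * A₁ + B₂), 0,
      w * κ * (κ * A₂ + B₁) / q, w * (1 + q) * κ ^ 2 * A₁ / q ^ 2,
      w * (1 + q + q ^ 2) * κ ^ 2 / q ^ 3]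
  | 1 => [q * w ^ 2 * (1 + q + q ^ 2), q ^ 2 * w ^ 2 * B₁, q ^ 2 * w ^ 2 * κ * A₁,
      q * w ^ 2 * (1 + q + q ^ 2) * κ]
  | _ => [q ^ 3 * w ^ 3]

/-- The row and column descriptions agree. -/
lemma grid_eq {q w g f₁ f₂ f₃ ε₁ ε₂ ε₄ ε₅ ε₆ s₁ s₂ κ A₁ A₂ B₁ B₂ : F} {c : ℕ → F}
    (hq : q ≠ 0) (hw : w ≠ 0) (hg : g ≠ 0) (hf₁ : f₁ ≠ 0) (hf₂ : f₂ ≠ 0) (hf₃ : f₃ ≠ 0)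
    (hc₀ : c 0 = 1) (hc₁ : c 1 = ε₁ / q) (hc₂ : c 2 = ε₂ / q ^ 2) (hc₄ : c 4 = ε₄ / q ^ 4)
    (hc₅ : c 5 = ε₅ / q ^ 5) (hc₆ : c 6 = ε₆ / q ^ 6)
    (hκ : κ = f₁ * f₂ * f₃ * w / g) (hA₁ : A₁ = s₁ + (f₁⁻¹ + f₂⁻¹ + f₃⁻¹))
    (hA₂ : A₂ = s₂ + s₁ * (f₁⁻¹ + f₂⁻¹ + f₃⁻¹) + (f₁⁻¹ * f₂⁻¹ + f₁⁻¹ * f₃⁻¹ + f₂⁻¹ * f₃⁻¹))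
    (hB₁ : B₁ = ε₁ + (f₁ + f₂ + f₃))
    (hB₂ : B₂ = ε₂ + ε₁ * (f₁ + f₂ + f₃) + (f₁ * f₂ + f₁ * f₃ + f₂ * f₃))
    (hs₁ : s₁ = ε₅ / ε₆) (hs₂ : s₂ = ε₄ / ε₆) (hε : ε₆ = (f₁ * f₂ * f₃) ^ 2 * w ^ 3 / g ^ 3)
    {i j : ℕ} (hi : i < 7) (hj : j < 3) :
    (linProdMul (gridRowRoots q w g i) (gridRow q w g f₁ f₂ f₃ ε₁ s₁ c i)).getD (j + 1) 0 =
      (linProdMul (gridColRoots q f₁ f₂ f₃ j) (gridCol q w κ A₁ A₂ B₁ B₂ j)).getD i 0 := by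
  -- Replacing ε₆ by its value brings in the constraint on the parameters; what remains are explicit
  -- rational identities, one for each entry of the last three columns. The value `c 3` is not
  -- needed, because row 3 has no linear factors to spread it.
  subst hε hs₁ hs₂ hκ hA₁ hA₂ hB₁ hB₂
  interval_cases j <;> interval_cases i <;>
    simp [linProdMul, linMul, gridRowRoots, gridRow, gridColRoots, gridCol, hc₀, hc₁, hc₂, hc₄,
      hc₅, hc₆] <;> field_simp <;> ring

end Grid

section Symmetric

variable {F : Type*} [Field F]

/-- The first column carries the elementary symmetric functions of the inverses of e_1, …, e_6, up
to powers of q. Those of degree 4 and 5 are written as multiples of ε₆, so that ε₄/ε₆ and ε₅/ε₆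
become symmetric functions of the e_k themselves. -/
lemma linProd_inv_coeff {q e₀ e₁ e₂ e₃ e₄ e₅ ε₁ ε₂ ε₄ ε₅ ε₆ : F} (hq : q ≠ 0)
    (h₀ : e₀ ≠ 0) (h₁ : e₁ ≠ 0) (h₂ : e₂ ≠ 0) (h₃ : e₃ ≠ 0) (h₄ : e₄ ≠ 0) (h₅ : e₅ ≠ 0)
    (hε₆ : ε₆ = (e₀ * e₁ * e₂ * e₃ * e₄ * e₅)⁻¹)
    (hε₅ : ε₅ = (e₀ + e₁ + e₂ + e₃ + e₄ + e₅) * ε₆)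
    (hε₄ : ε₄ = (e₀ * e₁ + e₀ * e₂ + e₀ * e₃ + e₀ * e₄ + e₀ * e₅ + e₁ * e₂ + e₁ * e₃ + e₁ * e₄ +
      e₁ * e₅ + e₂ * e₃ + e₂ * e₄ + e₂ * e₅ + e₃ * e₄ + e₃ * e₅ + e₄ * e₅) * ε₆)
    (hε₂ : ε₂ = e₀⁻¹ * e₁⁻¹ + e₀⁻¹ * e₂⁻¹ + e₀⁻¹ * e₃⁻¹ + e₀⁻¹ * e₄⁻¹ + e₀⁻¹ * e₅⁻¹ +
      e₁⁻¹ * e₂⁻¹ + e₁⁻¹ * e₃⁻¹ + e₁⁻¹ * e₄⁻¹ + e₁⁻¹ * e₅⁻¹ + e₂⁻¹ * e₃⁻¹ + e₂⁻¹ * e₄⁻¹ +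
      e₂⁻¹ * e₅⁻¹ + e₃⁻¹ * e₄⁻¹ + e₃⁻¹ * e₅⁻¹ + e₄⁻¹ * e₅⁻¹)
    (hε₁ : ε₁ = e₀⁻¹ + e₁⁻¹ + e₂⁻¹ + e₃⁻¹ + e₄⁻¹ + e₅⁻¹) {c : ℕ → F}
    (hc : c = fun k => (linProdMul [q⁻¹ * e₀⁻¹, q⁻¹ * e₁⁻¹, q⁻¹ * e₂⁻¹, q⁻¹ * e₃⁻¹, q⁻¹ * e₄⁻¹,
      q⁻¹ * e₅⁻¹] [1]).getD k 0) :
    c 0 = 1 ∧ c 1 = ε₁ / q ∧ c 2 = ε₂ / q ^ 2 ∧ c 4 = ε₄ / q ^ 4 ∧ c 5 = ε₅ / q ^ 5 ∧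
      c 6 = ε₆ / q ^ 6 := by
  subst hε₆ hε₅ hε₄ hε₂ hε₁ hc
  refine ⟨?_, ?_, ?_, ?_, ?_, ?_⟩ <;> simp [linProdMul, linMul] <;> field_simp <;> ring

end Symmetric

/-! ### Existence of the polynomial -/

namespace QuantumE8

variable {q : ℂˣ}

/-- The nine quantities permuted by `s_1, …, s_8`. -/
def nine : Fin 9 → Params := ![e 0, e 1, e 2, e 3, e 4, e 5, h 0 / e 6, h 0 / e 7, h 0 / e 8]

/-- The first elementary symmetric function of the nine quantities. -/
def symA₁ : Params := ∑ k, nine k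

/-- The second elementary symmetric function of the nine quantities. -/
def symA₂ : Params := ((∑ k, nine k) ^ 2 - ∑ k, nine k ^ 2) / 2

/-- The first elementary symmetric function of the inverses of the nine quantities. -/
def symB₁ : Params := ∑ k, (nine k)⁻¹

/-- The second elementary symmetric function of the inverses of the nine quantities. -/
def symB₂ : Params := ((∑ k, (nine k)⁻¹) ^ 2 - ∑ k, (nine k)⁻¹ ^ 2) / 2

/-- The parameter `κ = f_1 f_2 f_3 g_2 / g_1`. -/
def kappa : Params := e 6 / h 0 * (e 7 / h 0) * (e 8 / h 0) * e 10 / (h 1 / e 9)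

/-- The coefficients of the factors `V_j`. -/
def colCoeff (q : ℂˣ) : ℕ → List Params
  | 0 => [1]
  | j + 1 => gridCol (qP q : Params) (e 10) kappa symA₁ symA₂ symB₁ symB₂ j

/-- The coefficients of the factors `U_i`. -/
def rowCoeff (q : ℂˣ) (i : ℕ) : List Params :=
  gridRow (qP q : Params) (e 10) (h 1 / e 9) (e 6 / h 0) (e 7 / h 0) (e 8 / h 0)
    ((e 0)⁻¹ + (e 1)⁻¹ + (e 2)⁻¹ + (e 3)⁻¹ + (e 4)⁻¹ + (e 5)⁻¹)
    (e 0 + e 1 + e 2 + e 3 + e 4 + e 5) (fun k => (linProdMul (colRoots q 0) [1]).getD k 0) i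

/-- The coefficient of `y ^ j`. -/
def colPoly (q : ℂˣ) (j : ℕ) : Params[X] := linProd (colRoots q j) * polyL (colCoeff q j)

/-- The coefficient of `x ^ i`. -/
def rowPoly (q : ℂˣ) (i : ℕ) : Params[X] := linProd (rowRoots q i) * polyL (rowCoeff q i)

lemma colRoots_succ (j : ℕ) :
    colRoots q (j + 1) = gridColRoots (qP q : Params) (e 6 / h 0) (e 7 / h 0) (e 8 / h 0) j := by
  match j with
  | 0 => rfl
  | 1 => rfl
  | j + 2 => rfl

lemma rowRoots_eq (i : ℕ) : rowRoots q i = gridRowRoots (qP q : Params) (e 10) (h 1 / e 9) i := by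
  match i with
  | 0 => rfl
  | 1 => rfl
  | 2 => rfl
  | 3 => rfl
  | 4 => rfl
  | 5 => rfl
  | i + 6 => rfl

lemma two_ne_zero_params : (2 : Params) ≠ 0 := by
  have : (2 : Params) = algebraMap ℂ Params 2 := (map_ofNat _ 2).symm
  rw [this]
  exact (map_ne_zero_iff _ (algebraMap ℂ Params).injective).mpr two_ne_zero

lemma symA₁_eq : symA₁ = e 0 + e 1 + e 2 + e 3 + e 4 + e 5 +
    ((e 6 / h 0)⁻¹ + (e 7 / h 0)⁻¹ + (e 8 / h 0)⁻¹) := by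
  simp [symA₁, nine, Fin.sum_univ_succ]
  ring

lemma symB₁_eq : symB₁ = (e 0)⁻¹ + (e 1)⁻¹ + (e 2)⁻¹ + (e 3)⁻¹ + (e 4)⁻¹ + (e 5)⁻¹ +
    (e 6 / h 0 + e 7 / h 0 + e 8 / h 0) := by
  simp [symB₁, nine, Fin.sum_univ_succ]
  ring

lemma symA₂_eq : symA₂ = (e 0 * e 1 + e 0 * e 2 + e 0 * e 3 + e 0 * e 4 + e 0 * e 5 + e 1 * e 2 +
      e 1 * e 3 + e 1 * e 4 + e 1 * e 5 + e 2 * e 3 + e 2 * e 4 + e 2 * e 5 + e 3 * e 4 +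
      e 3 * e 5 + e 4 * e 5) + (e 0 + e 1 + e 2 + e 3 + e 4 + e 5) *
      ((e 6 / h 0)⁻¹ + (e 7 / h 0)⁻¹ + (e 8 / h 0)⁻¹) + ((e 6 / h 0)⁻¹ * (e 7 / h 0)⁻¹ +
      (e 6 / h 0)⁻¹ * (e 8 / h 0)⁻¹ + (e 7 / h 0)⁻¹ * (e 8 / h 0)⁻¹) := by
  have h2 := two_ne_zero_params
  rw [symA₂, div_eq_iff h2]
  simp only [nine, Fin.sum_univ_succ, Matrix.cons_val_zero, Matrix.cons_val_succ, Fin.sum_univ_zero,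
    inv_div]
  ring

lemma symB₂_eq : symB₂ = ((e 0)⁻¹ * (e 1)⁻¹ + (e 0)⁻¹ * (e 2)⁻¹ + (e 0)⁻¹ * (e 3)⁻¹ +
      (e 0)⁻¹ * (e 4)⁻¹ + (e 0)⁻¹ * (e 5)⁻¹ + (e 1)⁻¹ * (e 2)⁻¹ + (e 1)⁻¹ * (e 3)⁻¹ +
      (e 1)⁻¹ * (e 4)⁻¹ + (e 1)⁻¹ * (e 5)⁻¹ + (e 2)⁻¹ * (e 3)⁻¹ + (e 2)⁻¹ * (e 4)⁻¹ +
      (e 2)⁻¹ * (e 5)⁻¹ + (e 3)⁻¹ * (e 4)⁻¹ + (e 3)⁻¹ * (e 5)⁻¹ + (e 4)⁻¹ * (e 5)⁻¹) +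
    ((e 0)⁻¹ + (e 1)⁻¹ + (e 2)⁻¹ + (e 3)⁻¹ + (e 4)⁻¹ + (e 5)⁻¹) *
      (e 6 / h 0 + e 7 / h 0 + e 8 / h 0) +
    (e 6 / h 0 * (e 7 / h 0) + e 6 / h 0 * (e 8 / h 0) + e 7 / h 0 * (e 8 / h 0)) := by
  have h2 := two_ne_zero_params
  rw [symB₂, div_eq_iff h2]
  simp only [nine, Fin.sum_univ_succ, Matrix.cons_val_zero, Matrix.cons_val_succ, Fin.sum_univ_zero,
    inv_div]
  ring

lemma rowPoly_coeff_succ {i j : ℕ} (hi : i < 7) (hj : j < 3) :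
    (rowPoly q i).coeff (j + 1) = (colPoly q (j + 1)).coeff i := by
  have he := e_ne_zero
  have hf : ∀ k, e k / h 0 ≠ 0 := fun k => div_ne_zero (he k) (h_ne_zero 0)
  have hq : (qP q : Params) ≠ 0 := (qP q).ne_zero
  obtain ⟨c0, c1, c2, c4, c5, c6⟩ := linProd_inv_coeff hq (he 0) (he 1) (he 2) (he 3) (he 4) (he 5)
    rfl rfl rfl rfl rfl (c := fun k => (linProdMul (colRoots q 0) [1]).getD k 0) rfl
  have hprod : (e 0 * e 1 * e 2 * e 3 * e 4 * e 5)⁻¹ ≠ 0 := by simp [he]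
  rw [rowPoly, colPoly, linProd_mul_polyL, linProd_mul_polyL, polyL_coeff, polyL_coeff,
    rowRoots_eq, colRoots_succ]
  refine grid_eq hq (he 10) g_ne_zero (hf 6) (hf 7) (hf 8) c0 c1 c2 c4 c5 c6 rfl symA₁_eq symA₂_eq
    symB₁_eq symB₂_eq ?_ ?_ ?_ hi hj
  · rw [mul_div_cancel_right₀ _ hprod]
  · rw [mul_div_cancel_right₀ _ hprod]
  -- With f_k = e_{6+k}/h_1, w = e_11 and g = h_2/e_10, the constraint says that the inverse product
  -- of e_1, …, e_6 is (f_1 f_2 f_3)² w³/g³.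
  · have hc := parameter_constraint
    have h0 := h_ne_zero 0
    have h1 := h_ne_zero 1
    have e0 := he 0
    have e1 := he 1
    have e2 := he 2
    have e3 := he 3
    have e4 := he 4
    have e5 := he 5
    have e9 := he 9
    field_simp
    linear_combination hc

lemma rowPoly_coeff_zero {i : ℕ} (hi : i < 7) : (rowPoly q i).coeff 0 = (colPoly q 0).coeff i := by
  rw [rowPoly, colPoly, linProd_mul_polyL, linProd_mul_polyL, polyL_coeff, polyL_coeff]
  interval_cases i <;> simp [rowRoots, rowCoeff, gridRow, linMul] <;> rfl

lemma rowPoly_coeff {i j : ℕ} (hi : i < 7) (hj : j < 4) :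
    (rowPoly q i).coeff j = (colPoly q j).coeff i := by
  cases j with
  | zero => exact rowPoly_coeff_zero hi
  | succ j => exact rowPoly_coeff_succ hi (by omega)

lemma natDegree_linProd_le {F : Type*} [Field F] (as : List F) :
    (linProd as).natDegree ≤ as.length := by
  induction as with
  | nil => simp [linProd]
  | cons a as ih =>
    rw [linProd_cons, List.length_cons]
    refine (natDegree_mul_le_of_le (m := 1) ?_ ih).trans (by omega)
    compute_degree

lemma natDegree_rowCoeff_le (i : ℕ) (hi : i < 7) :
    (polyL (rowCoeff q i)).natDegree ≤ 3 - (3 - i) - (i - 3) := by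
  refine natDegree_polyL_le ?_
  interval_cases i <;> simp [rowCoeff, gridRow]

lemma natDegree_colCoeff_le (j : ℕ) (hj : j < 4) :
    (polyL (colCoeff q j)).natDegree ≤ 6 - 6 * (1 - j) - 3 * (j - 1) := by
  refine natDegree_polyL_le ?_
  interval_cases j <;> simp [colCoeff, gridCol]

lemma rowPoly_coeff_of_le {i j : ℕ} (hi : i < 7) (hj : 4 ≤ j) : (rowPoly q i).coeff j = 0 := by
  refine coeff_eq_zero_of_natDegree_lt (lt_of_le_of_lt (natDegree_mul_le_of_le
    (natDegree_linProd_le _) (natDegree_rowCoeff_le i hi)) ?_)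
  interval_cases i <;> simp [rowRoots] <;> omega

lemma colPoly_coeff_of_le {i j : ℕ} (hj : j < 4) (hi : 7 ≤ i) : (colPoly q j).coeff i = 0 := by
  refine coeff_eq_zero_of_natDegree_lt (lt_of_le_of_lt (natDegree_mul_le_of_le
    (natDegree_linProd_le _) (natDegree_colCoeff_le j hj)) ?_)
  interval_cases j <;> simp [colRoots] <;> omega

/-- The normalized polynomial with vanishing free constant. -/
def basePoly (q : ℂˣ) : Plane q :=
  ∑ j ∈ Finset.range 4, aeval (QPlane.x : Plane q) (colPoly q j) * QPlane.y ^ j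

/-- The polynomial is defined by its columns. Agreement of the two grids gives the row form, and the
degree bounds exclude anything outside the 7 × 4 rectangle. -/
lemma basePoly_eq_rows : basePoly q =
    ∑ i ∈ Finset.range 7, QPlane.x ^ i * aeval (QPlane.y : Plane q) (rowPoly q i) := by
  refine QPlane.ext_xyCoeff fun i j => ?_
  rw [basePoly, xyCoeff_y_form, xyCoeff_x_form]
  split_ifs with hj hi hi
  · exact (rowPoly_coeff hi hj).symm
  · exact colPoly_coeff_of_le hj (by omega)
  · exact (rowPoly_coeff_of_le hi (by omega)).symm
  · rfl

lemma basePoly_conditions : SatisfiesE8Conditions q (basePoly q) := by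
  refine satisfiesE8Conditions_iff.mpr
    ⟨⟨fun i => if i < 7 then polyL (rowCoeff q i) else 0, fun i => ?_, ?_⟩,
    fun j => if j < 4 then polyL (colCoeff q j) else 0, fun j => ?_, ?_⟩
  · dsimp only
    split_ifs with hi
    · exact natDegree_rowCoeff_le i hi
    · simp
  · rw [basePoly_eq_rows]
    refine Finset.sum_congr rfl fun i hi => ?_
    dsimp only
    rw [if_pos (Finset.mem_range.mp hi)]
    rfl
  · dsimp only
    split_ifs with hj
    · exact natDegree_colCoeff_le j hj
    · simp
  · refine Finset.sum_congr rfl fun j hj => ?_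
    dsimp only
    rw [if_pos (Finset.mem_range.mp hj)]
    rfl

lemma xyCoeff_basePoly {i j : ℕ} (hj : j < 4) :
    QPlane.xyCoeff (basePoly q) i j = (colPoly q j).coeff i := by
  rw [basePoly, xyCoeff_y_form, if_pos hj]

lemma basePoly_isE8Polynomial : IsE8Polynomial q 0 (basePoly q) where
  conditions := basePoly_conditions
  normalized := by
    rw [xyCoeff_basePoly (by omega), colPoly, linProd_mul_polyL, polyL_coeff]
    simp [colRoots, colCoeff, linMul]
  coeff_x3_y := by
    rw [xyCoeff_basePoly (by omega), colPoly, linProd_mul_polyL, polyL_coeff, map_zero]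
    simp [colRoots, colCoeff, gridCol]

lemma smul_x_pow_mul_y_eq (c : Params) : c • (QPlane.x ^ 3 * QPlane.y : Plane q) =
    aeval (QPlane.x : Plane q) (C c * X ^ 3) * QPlane.y ^ 1 := by
  rw [map_mul, map_pow, aeval_X, aeval_C, pow_one, Algebra.smul_def, mul_assoc]

/-- Row 3 and column 1 have no prescribed linear factors, so the monomial in that position satisfies
both forms. -/
lemma smul_x_pow_mul_y_conditions (c : Params) :
    SatisfiesE8Conditions q (c • (QPlane.x ^ 3 * QPlane.y : Plane q)) := by
  refine satisfiesE8Conditions_iff.mpr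
    ⟨⟨fun i => if i = 3 then C c * X else 0, fun i => ?_, ?_⟩,
    fun j => if j = 1 then C c * X ^ 3 else 0, fun j => ?_, ?_⟩
  · dsimp only
    split_ifs with hi
    · subst hi
      exact (natDegree_C_mul_le c X).trans (natDegree_X_le.trans (by omega))
    · simp
  · rw [Finset.sum_eq_single 3 (fun i _ hi => by beta_reduce; rw [if_neg hi, mul_zero, map_zero, mul_zero])
      (by simp)]
    beta_reduce
    rw [if_pos rfl, show linProd (rowRoots q 3) = 1 from rfl, one_mul, map_mul, aeval_C,
      aeval_X, Algebra.smul_def, ← mul_assoc, ← mul_assoc, Algebra.commutes]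
  · dsimp only
    split_ifs with hj
    · subst hj
      exact (natDegree_C_mul_X_pow_le c 3).trans (by omega)
    · simp
  · rw [Finset.sum_eq_single 1 (fun i _ hi => by beta_reduce; rw [if_neg hi, mul_zero, map_zero, zero_mul])
      (by simp)]
    beta_reduce
    rw [if_pos rfl, show linProd (colRoots q 1) = 1 from rfl, one_mul, smul_x_pow_mul_y_eq]

lemma xyCoeff_smul_x_pow_mul_y (c : Params) (i j : ℕ) :
    QPlane.xyCoeff (c • (QPlane.x ^ 3 * QPlane.y : Plane q)) i j =
      if 1 = j then (if i = 3 then c else 0) else 0 := by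
  rw [smul_x_pow_mul_y_eq, QPlane.xyCoeff_aeval_x_mul, coeff_C_mul, coeff_X_pow]
  simp

lemma SatisfiesE8Conditions.add {P Q : Plane q} (hP : SatisfiesE8Conditions q P)
    (hQ : SatisfiesE8Conditions q Q) : SatisfiesE8Conditions q (P + Q) := by
  have h0 : SatisfiesE8Conditions q (0 : Plane q) := by
    have := hP.sub hP
    rwa [sub_self] at this
  have := hP.sub (h0.sub hQ)
  rwa [zero_sub, sub_neg_eq_add] at this

lemma IsE8Polynomial.eq {c : ℂ} {P Q : Plane q} (hP : IsE8Polynomial q c P)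
    (hQ : IsE8Polynomial q c Q) : P = Q := by
  refine sub_eq_zero.mp ((hP.conditions.sub hQ.conditions).eq_zero ?_ ?_)
  · rw [QPlane.xyCoeff_sub, hP.normalized, hQ.normalized, sub_self]
  · rw [QPlane.xyCoeff_sub, hP.coeff_x3_y, hQ.coeff_x3_y, sub_self]

lemma IsE8Polynomial.add_smul {P₀ : Plane q} (hP : IsE8Polynomial q 0 P₀) (c : ℂ) :
    IsE8Polynomial q c (P₀ + algebraMap ℂ Params c • (QPlane.x ^ 3 * QPlane.y)) where
  conditions := hP.conditions.add (smul_x_pow_mul_y_conditions _)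
  normalized := by
    rw [QPlane.xyCoeff_add, hP.normalized, xyCoeff_smul_x_pow_mul_y]
    simp
  coeff_x3_y := by
    rw [QPlane.xyCoeff_add, hP.coeff_x3_y, xyCoeff_smul_x_pow_mul_y]
    simp

lemma existsUnique_isE8Polynomial (c : ℂ) : ∃! P : Plane q, IsE8Polynomial q c P :=
  ⟨_, basePoly_isE8Polynomial.add_smul c, fun _ hP => hP.eq (basePoly_isE8Polynomial.add_smul c)⟩

end QuantumE8

/-! ### Coefficient lists under maps of the parameters -/

section Map

variable {F : Type*} [Field F] (σ : F →+* F)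

lemma polyL_map (l : List F) : (polyL l).map σ = polyL (l.map σ) := by
  induction l with
  | nil => simp [polyL]
  | cons a l ih => simp [polyL, ih]

lemma linProd_map (as : List F) : (linProd as).map σ = linProd (as.map σ) := by
  induction as with
  | nil => simp [linProd]
  | cons a as ih => simp [linProd_cons, ih]

lemma linMul_map (a c : F) (l : List F) :
    (linMul a c l).map σ = linMul (σ a) (σ c) (l.map σ) := by
  induction l generalizing c with
  | nil => simp [linMul]
  | cons b l ih => simp [linMul, ih]

lemma linProdMul_map (as l : List F) :
    (linProdMul as l).map σ = linProdMul (as.map σ) (l.map σ) := by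
  induction as with
  | nil => simp [linProdMul]
  | cons a as ih =>
    rw [linProdMul, List.foldr_cons, linMul_map, map_zero]
    exact congrArg _ ih

lemma gridRow_map (q w g f₁ f₂ f₃ ε s : F) (c : ℕ → F) (i : ℕ) :
    (gridRow q w g f₁ f₂ f₃ ε s c i).map σ =
      gridRow (σ q) (σ w) (σ g) (σ f₁) (σ f₂) (σ f₃) (σ ε) (σ s) (fun k => σ (c k)) i := by
  unfold gridRow
  split <;> simp

lemma gridCol_map (q w κ A₁ A₂ B₁ B₂ : F) (j : ℕ) :
    (gridCol q w κ A₁ A₂ B₁ B₂ j).map σ =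
      gridCol (σ q) (σ w) (σ κ) (σ A₁) (σ A₂) (σ B₁) (σ B₂) j := by
  unfold gridCol
  split <;> simp

/-- The substitution on the left is the effect of s_0: it exchanges w and g and multiplies every f_k
by w/g. -/
lemma gridRow_exchange {q w g : F} (hw : w ≠ 0) (hg : g ≠ 0) (f₁ f₂ f₃ ε s : F) (c : ℕ → F)
    (i : ℕ) : gridRow q g w (f₁ * w / g) (f₂ * w / g) (f₃ * w / g) ε s c i =
      gridRow q w g f₁ f₂ f₃ ε s c i := by
  unfold gridRow
  split <;> simp only [List.cons.injEq, and_true, true_and] <;>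
    first
    | trivial
    | (refine ⟨?_, ?_⟩ <;> field_simp <;> ring)
    | field_simp

end Map

/-! ### Row terms under a twist of the first variable -/

section Conjugation

variable {F D : Type*} [Field F] [DivisionRing D] [Algebra F D]

/-- The polynomial `∏_{t < n} (1 + q ^ t c X)`. -/
def shiftProd (q c : F) (n : ℕ) : F[X] := ∏ t ∈ Finset.range n, (1 + C (q ^ t * c) * X)

lemma aeval_mul_of_qcomm {q : F} {u v : D} (h : v * u = q • (u * v)) (f : F[X]) :
    aeval v f * u = u * aeval v (f.comp (C q * X)) := by
  have hv : v * u = u * (q • v) := by rw [h, mul_smul_comm]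
  induction f using Polynomial.induction_on' with
  | add f g hf hg => rw [add_comp, map_add, map_add, add_mul, mul_add, hf, hg]
  | monomial n c =>
    have hn : v ^ n * u = u * (q • v) ^ n := by
      induction n with
      | zero => simp
      | succ n ih => rw [pow_succ, mul_assoc, hv, ← mul_assoc, ih, mul_assoc, ← pow_succ]
    rw [monomial_comp, map_mul, map_pow, map_mul, aeval_C, aeval_C, aeval_X, aeval_monomial,
      mul_assoc, hn, ← Algebra.smul_def q v, ← mul_assoc, ← mul_assoc, Algebra.commutes]

lemma shiftProd_comp (q a c : F) (n : ℕ) :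
    (shiftProd q c n).comp (C a * X) = shiftProd q (a * c) n := by
  simp only [shiftProd, prod_comp]
  refine Finset.prod_congr rfl fun t _ => ?_
  simp only [add_comp, one_comp, mul_comp, C_comp, X_comp, C_mul]
  ring

lemma aeval_mul_pow_of_qcomm {q : F} {u v : D} (h : v * u = q • (u * v)) (f : F[X]) (k : ℕ) :
    aeval v f * u ^ k = u ^ k * aeval v (f.comp (C (q ^ k) * X)) := by
  induction k generalizing f with
  | zero => simp
  | succ k ih =>
    rw [pow_succ, ← mul_assoc, ih, mul_assoc, aeval_mul_of_qcomm h, ← mul_assoc, comp_assoc]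
    congr 4
    simp [pow_succ, mul_assoc]

lemma aeval_shiftProd_mul_pow {q : F} {u v : D} (h : v * u = q • (u * v)) (c : F) (n k : ℕ) :
    aeval v (shiftProd q c n) * u ^ k = u ^ k * aeval v (shiftProd q (q ^ k * c) n) := by
  rw [aeval_mul_pow_of_qcomm h, shiftProd_comp]

variable {q g w : F} {u U v : D}

/-- Formally U = u R(v) with R(v) = (1 + g v)/(1 + w v). Moving all u to the left gives Uⁿ = uⁿ
R(qⁿ⁻¹ v) ⋯ R(v), and this is the same statement without denominators. -/
lemma pow_mul_aeval_shiftProd (hu : v * u = q • (u * v))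
    (hU : U * (1 + w • v) = u * (1 + g • v)) (n : ℕ) :
    U ^ n * aeval v (shiftProd q w n) = u ^ n * aeval v (shiftProd q g n) := by
  have h1 : ∀ c : F, aeval v (1 + C c * X : F[X]) = 1 + c • v := fun c => by
    simp [Algebra.smul_def]
  have hs : ∀ (n : ℕ) (c : F), shiftProd q c (n + 1) = (1 + C (q ^ n * c) * X) * shiftProd q c n :=
    fun n c => by rw [shiftProd, Finset.prod_range_succ, mul_comm]; rfl
  have hp : ∀ (n : ℕ) (c : F), u ^ n * aeval v (1 + C (q ^ n * c) * X : F[X]) = (1 + c • v) * u ^ n :=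
    fun n c => by
      rw [← h1 c, aeval_mul_pow_of_qcomm hu]
      congr 2
      simp only [add_comp, one_comp, mul_comp, C_comp, X_comp, C_mul]
      ring
  induction n with
  | zero => simp [shiftProd]
  | succ n ih =>
    have hc : aeval v (shiftProd q w n) * aeval v (1 + C (q ^ n * w) * X : F[X]) =
        aeval v (1 + C (q ^ n * w) * X : F[X]) * aeval v (shiftProd q w n) := by
      rw [← map_mul, mul_comm, map_mul]
    have hc' : aeval v (shiftProd q g n) * aeval v (1 + C (q ^ n * w) * X : F[X]) =
        aeval v (1 + C (q ^ n * w) * X : F[X]) * aeval v (shiftProd q g n) := by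
      rw [← map_mul, mul_comm, map_mul]
    rw [hs, hs, map_mul (aeval v), map_mul (aeval v), ← hc, pow_succ', pow_succ']
    calc _ = U * (U ^ n * aeval v (shiftProd q w n)) * aeval v (1 + C (q ^ n * w) * X : F[X]) := by
          simp only [mul_assoc]
      _ = U * (u ^ n * aeval v (1 + C (q ^ n * w) * X : F[X])) * aeval v (shiftProd q g n) := by
          rw [ih, mul_assoc, mul_assoc (u ^ n), hc']
          simp only [mul_assoc]
      _ = u * (u ^ n * aeval v (1 + C (q ^ n * g) * X : F[X])) * aeval v (shiftProd q g n) := by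
          rw [hp, hp, ← mul_assoc, hU, ← mul_assoc]
      _ = _ := by simp only [mul_assoc]

lemma aeval_shiftProd_mul_inv_pow (hu : v * u = q • (u * v)) (hu0 : u ≠ 0) (hU0 : U ≠ 0)
    (hU : U * (1 + w • v) = u * (1 + g • v)) (n : ℕ) :
    aeval v (shiftProd q g n) * (U ^ n)⁻¹ = aeval v (shiftProd q w n) * (u ^ n)⁻¹ := by
  have h := pow_mul_aeval_shiftProd hu hU n
  -- Cancelling this product requires it to be nonzero; if it vanishes, so does the one with g, and
  -- both sides are zero.
  by_cases hw : aeval v (shiftProd q w n) = 0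
  · rw [hw, mul_zero, eq_comm, mul_eq_zero] at h
    rw [h.resolve_left (pow_ne_zero n hu0), hw, zero_mul, zero_mul]
  have hc : aeval v (shiftProd q w n) * aeval v (shiftProd q g n) =
      aeval v (shiftProd q g n) * aeval v (shiftProd q w n) := by
    rw [← map_mul, mul_comm, map_mul]
  rw [← div_eq_mul_inv, ← div_eq_mul_inv, div_eq_iff (pow_ne_zero n hU0)]
  refine mul_right_cancel₀ hw ?_
  rw [← hc, mul_assoc, h, ← mul_assoc, div_mul_cancel₀ _ (pow_ne_zero n hu0)]

/-- Rows below the middle one leave a negative power of u. Carrying uⁱ across the product removes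
the shift qⁱ, which is why the factors of row i start at t = i. -/
lemma pow_mul_aeval_shiftProd_mul_inv (hu : v * u = q • (u * v)) (hu0 : u ≠ 0) {i n : ℕ}
    (c : F) (hin : i + n = 3) : u ^ i * aeval v (shiftProd q (q ^ i * c) n) * (u ^ 3)⁻¹ =
      aeval v (shiftProd q c n) * (u ^ n)⁻¹ := by
  rw [← aeval_shiftProd_mul_pow hu, ← hin, add_comm i n, pow_add, mul_inv_rev, mul_assoc,
    mul_inv_cancel_left₀ (pow_ne_zero i hu0)]

lemma pow_add_three_mul_aeval_shiftProd (hu : v * u = q • (u * v)) (hu0 : u ≠ 0) (n : ℕ) (c : F) :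
    u ^ (n + 3) * aeval v (shiftProd q (q ^ 3 * c) n) * (u ^ 3)⁻¹ =
      u ^ n * aeval v (shiftProd q c n) := by
  rw [pow_add, mul_assoc (u ^ n), ← aeval_shiftProd_mul_pow hu, mul_assoc, mul_assoc,
    mul_inv_cancel₀ (pow_ne_zero 3 hu0), mul_one]

/-- A cofactor B(v) can be moved past u⁻³ and past U⁻³ with the same shift v ↦ q⁻³ v, since both
elements q-commute with v. Thus only the linear factors have to be compared. -/
lemma mul_aeval_mul_inv_congr {i : ℕ} (hq : q ≠ 0) (hu : v * u = q • (u * v))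
    (hU : v * U = q • (U * v)) (hu0 : u ≠ 0) (hU0 : U ≠ 0) {p p' : F[X]} (B : F[X])
    (h : U ^ i * aeval v p * (U ^ 3)⁻¹ = u ^ i * aeval v p' * (u ^ 3)⁻¹) :
    U ^ i * aeval v (p * B) * (U ^ 3)⁻¹ = u ^ i * aeval v (p' * B) * (u ^ 3)⁻¹ := by
  have hB : ∀ z : D, z ≠ 0 → v * z = q • (z * v) → aeval v B * (z ^ 3)⁻¹ =
      (z ^ 3)⁻¹ * aeval v (B.comp (C (q ^ 3)⁻¹ * X)) := fun z hz hvz => by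
    have hz3 := pow_ne_zero 3 hz
    rw [eq_inv_mul_iff_mul_eq₀ hz3, ← mul_assoc, mul_inv_eq_iff_eq_mul₀ hz3,
      aeval_mul_pow_of_qcomm hvz, comp_assoc]
    congr 2
    rw [mul_comp, C_comp, X_comp, ← mul_assoc, ← C_mul, inv_mul_cancel₀ (pow_ne_zero 3 hq), C_1,
      one_mul, comp_X]
  rw [map_mul, map_mul, ← mul_assoc, ← mul_assoc, mul_assoc, hB U hU0 hU, ← mul_assoc, h,
    mul_assoc _ (aeval v B), hB u hu0 hu, ← mul_assoc]

lemma low_row_congr (hq : q ≠ 0) (hu : v * u = q • (u * v)) (hU : v * U = q • (U * v))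
    (hu0 : u ≠ 0) (hU0 : U ≠ 0) (h : U * (1 + w • v) = u * (1 + g • v)) {i n : ℕ}
    (hin : i + n = 3) (B : F[X]) :
    U ^ i * aeval v (shiftProd q (q ^ i * g) n * B) * (U ^ 3)⁻¹ =
      u ^ i * aeval v (shiftProd q (q ^ i * w) n * B) * (u ^ 3)⁻¹ := by
  refine mul_aeval_mul_inv_congr hq hu hU hu0 hU0 _ ?_
  rw [pow_mul_aeval_shiftProd_mul_inv hu hu0 w hin, pow_mul_aeval_shiftProd_mul_inv hU hU0 g hin,
    aeval_shiftProd_mul_inv_pow hu hu0 hU0 h]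

lemma high_row_congr (hq : q ≠ 0) (hu : v * u = q • (u * v)) (hU : v * U = q • (U * v))
    (hu0 : u ≠ 0) (hU0 : U ≠ 0) (h : U * (1 + w • v) = u * (1 + g • v)) (n : ℕ) (B : F[X]) :
    U ^ (n + 3) * aeval v (shiftProd q (q ^ 3 * w) n * B) * (U ^ 3)⁻¹ =
      u ^ (n + 3) * aeval v (shiftProd q (q ^ 3 * g) n * B) * (u ^ 3)⁻¹ := by
  refine mul_aeval_mul_inv_congr hq hu hU hu0 hU0 _ ?_
  rw [pow_add_three_mul_aeval_shiftProd hu hu0, pow_add_three_mul_aeval_shiftProd hU hU0,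
    pow_mul_aeval_shiftProd hu h]

end Conjugation

namespace QField

variable {F : Type*} [Field F] {q : Fˣ}

lemma incl_aeval (z : QPlane F q) (f : F[X]) : incl (aeval z f) = aeval (incl z) f := by
  rw [aeval_def, aeval_def, hom_eval₂]
  rfl

lemma map_aeval (φ : QField F q →+* QField F q) (σ : F →+* F)
    (h : ∀ c, φ (algebraMap F _ c) = algebraMap F _ (σ c)) (z : QField F q) (f : F[X]) :
    φ (aeval z f) = aeval (φ z) (f.map σ) := by
  rw [aeval_def, aeval_def, hom_eval₂, eval₂_map]
  congr 1
  exact RingHom.ext h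

lemma x_pow_ne_zero (n : ℕ) : (x ^ n : QField F q) ≠ 0 := pow_ne_zero n x_ne_zero

lemma y_pow_mul_inv_x_pow (j : ℕ) : (y ^ j * (x ^ 3)⁻¹ : QField F q) =
    (((q : F) ^ 3)⁻¹ ^ j) • ((x ^ 3)⁻¹ * y ^ j) := by
  have hx := x_pow_ne_zero (F := F) (q := q) 3
  have h1 : (y * x ^ 3 : QField F q) = (q : F) ^ 3 • (x ^ 3 * y) := by
    have : ∀ n : ℕ, (y * x ^ n : QField F q) = (q : F) ^ n • (x ^ n * y) := fun n => by
      induction n with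
      | zero => simp
      | succ n ih =>
        rw [pow_succ, ← mul_assoc, ih, smul_mul_assoc, mul_assoc, y_mul_x, mul_smul_comm, smul_smul,
          ← mul_assoc, ← pow_succ]
    exact this 3
  have h2 : (y * (x ^ 3)⁻¹ : QField F q) = ((q : F) ^ 3)⁻¹ • ((x ^ 3)⁻¹ * y) := by
    rw [mul_inv_eq_iff_eq_mul₀ hx, smul_mul_assoc, mul_assoc, h1, mul_smul_comm, smul_smul,
      inv_mul_cancel₀ (pow_ne_zero 3 q.ne_zero), one_smul, inv_mul_cancel_left₀ hx]
  induction j with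
  | zero => simp
  | succ j ih =>
    rw [pow_succ' y, mul_assoc, ih, mul_smul_comm, ← mul_assoc, h2, smul_mul_assoc, smul_smul,
      mul_assoc, ← pow_succ' y, ← pow_succ]

end QField

/-! ### Expansions of the quotient by rows and by columns -/

namespace QuantumE8

open QField (incl x y)

variable {q : ℂˣ}

lemma curve_sum {ι : Type*} (s : Finset ι) (f : ι → Plane q) :
    curve q (∑ i ∈ s, f i) = ∑ i ∈ s, curve q (f i) := by
  simp only [curve]
  rw [map_sum (incl : Plane q →+* K q), Finset.sum_mul, Finset.sum_mul]

lemma curve_add (P Q : Plane q) : curve q (P + Q) = curve q P + curve q Q := by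
  simp only [curve]
  rw [RingHom.map_add, add_mul, add_mul]

/-- With x⁻³ moved to the far left, a column becomes a polynomial in x times yʲ⁻¹. This form suits
the reflections that fix x and also the rectangular form. -/
lemma curve_aeval_x_mul (f : Params[X]) (j : ℕ) :
    curve q (aeval (QPlane.x : Plane q) f * QPlane.y ^ j) =
      (((qP q : Params) ^ 3)⁻¹ ^ j) • ((x ^ 3)⁻¹ * (aeval (x : K q) f * (y ^ j * y⁻¹))) := by
  have hc : aeval (x : K q) f * (x ^ 3)⁻¹ = (x ^ 3)⁻¹ * aeval (x : K q) f := by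
    have : Commute (aeval (x : K q) f) (x ^ 3) := by
      have := (Commute.all f (X ^ 3)).map (aeval (x : K q))
      rwa [map_pow, aeval_X] at this
    exact this.inv_right₀
  have hy : (incl QPlane.y : K q) = y := rfl
  have hx : (incl QPlane.x : K q) = x := rfl
  rw [curve, RingHom.map_mul, RingHom.map_pow, QField.incl_aeval, hy, hx, mul_assoc (aeval (x : K q) f),
    QField.y_pow_mul_inv_x_pow, mul_smul_comm, smul_mul_assoc, ← mul_assoc, hc]
  simp only [mul_assoc]

lemma curve_x_pow_mul (f : Params[X]) (i : ℕ) :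
    curve q (QPlane.x ^ i * aeval (QPlane.y : Plane q) f) =
      x ^ i * aeval (y : K q) f * (x ^ 3)⁻¹ * y⁻¹ := by
  rw [curve, RingHom.map_mul, RingHom.map_pow, QField.incl_aeval]
  rfl

lemma curve_smul_x_pow_mul_y (c : ℂ) :
    curve q (algebraMap ℂ Params c • (QPlane.x ^ 3 * QPlane.y)) =
      algebraMap ℂ (K q) (c * ((q : ℂ) ^ 3)⁻¹) := by
  rw [smul_x_pow_mul_y_eq, curve_aeval_x_mul, pow_one, pow_one,
    mul_inv_cancel₀ QField.y_ne_zero, mul_one, map_mul (aeval (x : K q)), map_pow, aeval_X,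
    aeval_C, Algebra.commutes, inv_mul_cancel_left₀ (QField.x_pow_ne_zero 3),
    Algebra.smul_def, ← RingHom.map_mul,
    show ((qP q : Params) ^ 3)⁻¹ = algebraMap ℂ Params ((q : ℂ) ^ 3)⁻¹ by simp,
    ← RingHom.map_mul, mul_comm]
  rfl

lemma reflHom_aeval (i : Fin 9) (z : K q) (f : Params[X]) :
    reflHom q i (aeval z f) = aeval (reflHom q i z) (f.map (paramHom i).toRingHom) :=
  QField.map_aeval (reflHom q i) (paramHom i).toRingHom (reflHom_algebraMap i) z f

end QuantumE8

/-! ### Invariance under the reflections that fix x -/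

namespace QuantumE8

open QField (incl x y)

variable {q : ℂˣ}

/-- The chain s_1, …, s_8 is a Weyl group of type A_8, acting on e_1, …, e_6, h_1/e_7, h_1/e_8,
h_1/e_9 by transpositions. -/
lemma paramHom_nine {i : Fin 9} (hi : i ≠ 0) :
    ∃ π : Equiv.Perm (Fin 9), ∀ k, paramHom i (nine k) = nine (π k) := by
  have h0 := h_ne_zero 0
  refine ⟨![1, Equiv.swap 7 8, Equiv.swap 6 7, Equiv.swap 0 6, Equiv.swap 0 1, Equiv.swap 1 2,
    Equiv.swap 2 3, Equiv.swap 3 4, Equiv.swap 4 5] i, fun k => ?_⟩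
  fin_cases i
  · exact absurd rfl hi
  all_goals
    fin_cases k <;>
      simp [nine, paramHom_h, paramHom_e, sH, sE, Equiv.swap_apply_def, div_div_cancel₀ h0]

lemma paramHom_symA₁ {i : Fin 9} (hi : i ≠ 0) : paramHom i symA₁ = symA₁ := by
  obtain ⟨π, hπ⟩ := paramHom_nine hi
  simp only [symA₁, map_sum, hπ]
  exact Equiv.sum_comp π nine

lemma paramHom_symB₁ {i : Fin 9} (hi : i ≠ 0) : paramHom i symB₁ = symB₁ := by
  obtain ⟨π, hπ⟩ := paramHom_nine hi
  simp only [symB₁, map_sum, map_inv₀, hπ]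
  exact Equiv.sum_comp π fun k => (nine k)⁻¹

/-- Written through power sums, the second symmetric function is invariant by mere reindexing, with
no ordering of pairs to follow. -/
lemma paramHom_symA₂ {i : Fin 9} (hi : i ≠ 0) : paramHom i symA₂ = symA₂ := by
  obtain ⟨π, hπ⟩ := paramHom_nine hi
  simp only [symA₂, map_div₀, map_sub, map_pow, map_sum, map_ofNat, hπ]
  rw [Equiv.sum_comp π nine, Equiv.sum_comp π fun k => nine k ^ 2]

lemma paramHom_symB₂ {i : Fin 9} (hi : i ≠ 0) : paramHom i symB₂ = symB₂ := by
  obtain ⟨π, hπ⟩ := paramHom_nine hi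
  simp only [symB₂, map_div₀, map_sub, map_pow, map_sum, map_ofNat, map_inv₀, hπ]
  rw [Equiv.sum_comp π fun k => (nine k)⁻¹, Equiv.sum_comp π fun k => (nine k)⁻¹ ^ 2]

lemma paramHom_kappa {i : Fin 9} (hi : i ≠ 0) : paramHom i kappa = kappa := by
  have h0 := h_ne_zero 0
  have h1 := h_ne_zero 1
  have he := e_ne_zero
  have e0 := he 0
  have e6 := he 6
  have e9 := he 9
  simp only [kappa, map_div₀, map_mul, paramHom_h, paramHom_e]
  fin_cases i
  · exact absurd rfl hi
  all_goals simp [sH, sE, Equiv.swap_apply_def]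
  all_goals field_simp

lemma paramHom_qP (i : Fin 9) : paramHom i (qP q : Params) = (qP q : Params) := paramHom_q i

lemma map_colCoeff {i : Fin 9} (hi : i ≠ 0) (j : ℕ) :
    (colCoeff q j).map (paramHom i).toRingHom = colCoeff q j := by
  cases j with
  | zero => simp [colCoeff]
  | succ j =>
    rw [colCoeff, gridCol_map]
    change gridCol (paramHom i (qP q : Params)) (paramHom i (e 10)) (paramHom i kappa)
      (paramHom i symA₁) (paramHom i symA₂) (paramHom i symB₁) (paramHom i symB₂) j = _
    rw [paramHom_qP, paramHom_w_of_ne hi, paramHom_kappa hi, paramHom_symA₁ hi, paramHom_symA₂ hi,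
      paramHom_symB₁ hi, paramHom_symB₂ hi]

lemma linProd_map_colRoots {i : Fin 9} (h0 : i ≠ 0) (h3 : i ≠ 3) (j : ℕ) :
    linProd ((colRoots q j).map (paramHom i).toRingHom) = linProd (colRoots q j) := by
  unfold colRoots
  split <;>
  simp only [List.map_cons, List.map_nil, linProd_cons, AlgHom.toRingHom_eq_coe, RingHom.coe_coe,
    map_mul, map_inv₀, map_div₀, paramHom_qP, paramHom_e, paramHom_h]
  all_goals
    fin_cases i <;> first
      | exact absurd rfl h0
      | exact absurd rfl h3
      | (simp [sE, sH, Equiv.swap_apply_def]; done)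
      | (simp [sE, sH, Equiv.swap_apply_def, -mul_eq_mul_left_iff, -mul_eq_mul_right_iff, -map_mul]; ac_rfl)

lemma map_colPoly {i : Fin 9} (h0 : i ≠ 0) (h3 : i ≠ 3) (j : ℕ) :
    (colPoly q j).map (paramHom i).toRingHom = colPoly q j := by
  rw [colPoly, Polynomial.map_mul, linProd_map, polyL_map, linProd_map_colRoots h0 h3,
    map_colCoeff h0]

lemma reflHom_curve_sum {ι : Type*} (k : Fin 9) (s : Finset ι) (f : ι → Plane q)
    (hf : ∀ i ∈ s, reflHom q k (curve q (f i)) = curve q (f i)) :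
    reflHom q k (curve q (∑ i ∈ s, f i)) = curve q (∑ i ∈ s, f i) := by
  classical
  induction s using Finset.induction_on with
  | empty =>
    have : curve q (0 : Plane q) = 0 := by
      rw [curve, RingHom.map_zero, zero_mul, zero_mul]
    rw [Finset.sum_empty, this, RingHom.map_zero]
  | insert a s ha ih =>
    rw [Finset.sum_insert ha, curve_add, RingHom.map_add, hf a (Finset.mem_insert_self a s),
      ih fun i hi => hf i (Finset.mem_insert_of_mem hi)]

/-- The term with `y ^ j` is fixed if its image under the reflection agrees with it after removing
the common factor. -/
lemma reflHom_curve_aeval_x_mul {i : Fin 9} (hi : i ≠ 0) (f : Params[X]) (j : ℕ)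
    (h : aeval (x : K q) (f.map (paramHom i).toRingHom) * (reflHom q i y ^ j * (reflHom q i y)⁻¹) =
      aeval (x : K q) f * (y ^ j * y⁻¹)) :
    reflHom q i (curve q (aeval (QPlane.x : Plane q) f * QPlane.y ^ j)) =
      curve q (aeval (QPlane.x : Plane q) f * QPlane.y ^ j) := by
  rw [curve_aeval_x_mul, reflHom_smul, RingHom.map_mul, RingHom.map_mul, map_inv₀, RingHom.map_pow,
    RingHom.map_mul, RingHom.map_pow, map_inv₀, reflHom_aeval, reflHom_x_of_ne hi, h, map_pow,
    map_inv₀, map_pow, paramHom_qP]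

lemma reflHom_curve_basePoly_of_ne {i : Fin 9} (h0 : i ≠ 0) (h3 : i ≠ 3) :
    reflHom q i (curve q (basePoly q)) = curve q (basePoly q) :=
  reflHom_curve_sum i _ _ fun j _ => reflHom_curve_aeval_x_mul h0 _ j <| by
    rw [map_colPoly h0 h3, reflHom_y_of_ne h3]

section Three

variable {F : Type*} [Field F] {q : Fˣ} (a b : F)

open QField

lemma inv_twistY : (twistY q a b : QField F q)⁻¹ = y⁻¹ * ((1 + b • x) * (1 + a • x)⁻¹) := by
  rw [twistY, mul_inv_rev, mul_inv_rev, inv_inv]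

lemma one_add_mul_inv_y (c : F) :
    (1 + (c / q) • x) * (y : QField F q)⁻¹ = y⁻¹ * (1 + c • x) := by
  rw [mul_inv_eq_iff_eq_mul₀ y_ne_zero, mul_assoc, eq_inv_mul_iff_mul_eq₀ y_ne_zero,
    mul_one_add_smul y_mul_x, mul_div_cancel₀ _ q.ne_zero]

/-- This is the column with y⁻¹. The q⁻¹ in its linear factors is what moving a factor 1 + c x
across y⁻¹ produces. -/
lemma one_add_mul_inv_twistY :
    (1 + (a / q) • x) * (twistY q a b : QField F q)⁻¹ = (1 + (b / q) • x) * y⁻¹ := by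
  rw [inv_twistY, ← mul_assoc, one_add_mul_inv_y, one_add_mul_inv_y, mul_assoc,
    ← mul_assoc (1 + a • x), (commute_one_add_smul a b (x : QField F q)).eq, mul_assoc,
    mul_inv_cancel₀ (one_add_smul_x_ne_zero a), mul_one]

lemma one_add_mul_twistY :
    (1 + b • x) * (twistY q a b : QField F q) = (1 + a • x) * y := by
  rw [twistY, ← mul_assoc, ← mul_assoc, (commute_one_add_smul b a (x : QField F q)).eq, mul_assoc _ (1 + b • x),
    mul_inv_cancel₀ (one_add_smul_x_ne_zero b), mul_one]

/-- For column 3 the remaining power is y². Moving the second copy of 1 + b x past y produces the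
factor with q b, which explains the pairs of factors in that column. -/
lemma one_add_mul_twistY_sq :
    (1 + b • x) * ((1 + ((q : F) * b) • x) * (twistY q a b : QField F q) ^ 2) =
      (1 + a • x) * ((1 + ((q : F) * a) • x) * y ^ 2) := by
  have hy : ∀ c : F, (y : QField F q) * (1 + c • x) = (1 + ((q : F) * c) • x) * y :=
    mul_one_add_smul y_mul_x
  have hc : ∀ c d : F, (1 + c • x : QField F q) * (1 + d • x) = (1 + d • x) * (1 + c • x) :=
    fun c d => (commute_one_add_smul c d _).eq
  calc _ = (1 + ((q : F) * b) • x) * ((1 + b • x) * (twistY q a b : QField F q)) *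
        twistY q a b := by
        rw [pow_two, ← mul_assoc, ← mul_assoc, hc b, mul_assoc (1 + ((q : F) * b) • x)]
    _ = (1 + a • x) * ((1 + ((q : F) * b) • x) * y) * twistY q a b := by
        rw [one_add_mul_twistY, ← mul_assoc, hc _ a, mul_assoc (1 + a • x)]
    _ = (1 + a • x) * (y * ((1 + b • x) * twistY q a b)) := by
        rw [← hy, mul_assoc, mul_assoc y]
    _ = _ := by
        rw [one_add_mul_twistY, ← mul_assoc y, hy, mul_assoc _ y, pow_two]

end Three

lemma reflHom_three_y_eq : reflHom q 3 y = QField.twistY (qP q) (e 6 / h 0) (e 0)⁻¹ :=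
  reflHom_three_y

lemma aeval_mul_congr {p p' : Params[X]} (A : Params[X]) {z z' : K q}
    (h : aeval (x : K q) p * z = aeval (x : K q) p' * z') :
    aeval (x : K q) (p * A) * z = aeval (x : K q) (p' * A) * z' := by
  rw [mul_comm p, mul_comm p', map_mul (aeval (x : K q)), map_mul (aeval (x : K q)), mul_assoc, h,
    mul_assoc]

/-- The exchange of e_7/h_1 and 1/e_1 alters one linear factor in columns 0 and 2 and a pair of them
in column 3. The new y⁻¹, y and y² compensate for exactly these; column 1 contains neither linear
factors nor y. -/
lemma reflHom_three_curve_basePoly : reflHom q 3 (curve q (basePoly q)) = curve q (basePoly q) := by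
  have ha : (paramHom 3).toRingHom (e 6 / h 0) = (e 0)⁻¹ := paramHom_three_a
  have hb : (paramHom 3).toRingHom (e 0)⁻¹ = e 6 / h 0 := paramHom_three_b
  have hq : (paramHom 3).toRingHom (qP q : Params) = (qP q : Params) := paramHom_q 3
  have hb' : (paramHom 3).toRingHom ((qP q : Params)⁻¹ * (e 0)⁻¹) =
      (qP q : Params)⁻¹ * (e 6 / h 0) := by rw [map_mul, map_inv₀, hq, hb]
  have ha' : (paramHom 3).toRingHom ((qP q : Params) * (e 6 / h 0)) =
      (qP q : Params) * (e 0)⁻¹ := by rw [map_mul, hq, ha]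
  have he : ∀ k : Fin 11, k ≠ 0 → k ≠ 6 → (paramHom 3).toRingHom (e k) = e k := fun k h0 h6 => by
    refine (paramHom_e 3 k).trans ?_
    simp [sE, h0, h6]
  have hh : (paramHom 3).toRingHom (h 0) = h 0 := by
    refine (paramHom_h 3 0).trans ?_
    simp [sH]
  have hc := map_colCoeff (q := q) (i := 3) (by decide)
  have he' : ∀ k : Fin 11, k ≠ 0 → k ≠ 6 → (paramHom 3).toRingHom ((qP q : Params)⁻¹ * (e k)⁻¹) =
      (qP q : Params)⁻¹ * (e k)⁻¹ := fun k h0 h6 => by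
    rw [map_mul, map_inv₀, map_inv₀, he k h0 h6, hq]
  have hf : ∀ k : Fin 11, k ≠ 0 → k ≠ 6 → (paramHom 3).toRingHom (e k / h 0) = e k / h 0 :=
    fun k h0 h6 => by rw [map_div₀, he k h0 h6, hh]
  have hf' : ∀ k : Fin 11, k ≠ 0 → k ≠ 6 → (paramHom 3).toRingHom ((qP q : Params) * (e k / h 0)) =
      (qP q : Params) * (e k / h 0) := fun k h0 h6 => by rw [map_mul, hf k h0 h6, hq]
  have hY0 : (QField.twistY (qP q) (e 6 / h 0) (e 0)⁻¹ : K q) ≠ 0 := by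
    rw [← reflHom_three_y_eq, _root_.map_ne_zero]
    exact QField.y_ne_zero
  have hpow : ∀ z : K q, z ≠ 0 → z ^ 2 * z⁻¹ = z ∧ z ^ 3 * z⁻¹ = z ^ 2 := fun z hz =>
    ⟨by rw [pow_two, mul_assoc, mul_inv_cancel₀ hz, mul_one],
      by rw [pow_succ, mul_assoc, mul_inv_cancel₀ hz, mul_one]⟩
  refine reflHom_curve_sum 3 _ _ fun j hj => reflHom_curve_aeval_x_mul (by decide) _ j ?_
  rw [reflHom_three_y_eq, colPoly, Polynomial.map_mul, linProd_map, polyL_map, hc]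
  have hj4 := Finset.mem_range.mp hj
  interval_cases j
  · simp only [colRoots, List.map_cons, List.map_nil, linProd_cons, linProd_nil, hb', mul_assoc]
    rw [he' 1 (by decide) (by decide), he' 2 (by decide) (by decide), he' 3 (by decide) (by decide),
      he' 4 (by decide) (by decide), he' 5 (by decide) (by decide)]
    refine aeval_mul_congr _ ?_
    rw [QField.aeval_one_add, QField.aeval_one_add, pow_zero, pow_zero, one_mul, one_mul,
      inv_mul_eq_div, inv_mul_eq_div]
    exact one_add_mul_inv_twistY _ _
  · simp only [colRoots, List.map_nil]
    rw [pow_one, pow_one, mul_inv_cancel₀ hY0, mul_inv_cancel₀ QField.y_ne_zero]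
  · simp only [colRoots, List.map_cons, List.map_nil, linProd_cons, linProd_nil, ha, mul_assoc]
    rw [hf 7 (by decide) (by decide), hf 8 (by decide) (by decide), (hpow _ hY0).1,
      (hpow _ QField.y_ne_zero).1]
    refine aeval_mul_congr _ ?_
    rw [QField.aeval_one_add, QField.aeval_one_add]
    exact one_add_mul_twistY _ _
  · simp only [colRoots, List.map_cons, List.map_nil, linProd_cons, linProd_nil, ha, ha']
    rw [hf 7 (by decide) (by decide), hf 8 (by decide) (by decide), hf' 7 (by decide) (by decide),
      hf' 8 (by decide) (by decide), (hpow _ hY0).2, (hpow _ QField.y_ne_zero).2]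
    -- Groups the two factors that change, so that the rest can be split off as a common polynomial
    -- in x.
    simp only [← mul_assoc (1 + C (e 6 / h 0) * X), ← mul_assoc (1 + C (e 0)⁻¹ * X)]
    simp only [mul_assoc _ _ (polyL _)]
    refine aeval_mul_congr _ ?_
    rw [map_mul (aeval (x : K q)), map_mul (aeval (x : K q)), QField.aeval_one_add,
      QField.aeval_one_add, QField.aeval_one_add, QField.aeval_one_add, mul_assoc, mul_assoc]
    exact one_add_mul_twistY_sq _ _

end QuantumE8

/-! ### Invariance under s_0, and under the whole group -/

namespace QuantumE8

open QField (incl x y)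

variable {q : ℂˣ}

lemma shiftProd_map {F : Type*} [Field F] (σ : F →+* F) {q : F} (hq : σ q = q) (c : F) (n : ℕ) :
    (shiftProd q c n).map σ = shiftProd q (σ c) n := by
  simp only [shiftProd, Polynomial.map_prod]
  refine Finset.prod_congr rfl fun t _ => ?_
  simp [hq]

lemma linProd_rowRoots_of_le {i : ℕ} (hi : i ≤ 3) :
    linProd (rowRoots q i) =
      shiftProd (qP q : Params) ((qP q : Params) ^ i * e 10) (3 - i) := by
  interval_cases i <;>
    simp only [rowRoots, linProd_cons, linProd_nil, shiftProd] <;>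
    simp only [Finset.prod_range_succ, Finset.prod_range_zero, Nat.reduceSub, pow_zero, pow_one, one_mul,
      mul_one, pow_two, mul_assoc]

lemma linProd_rowRoots_of_ge {n : ℕ} (hn : n ≤ 3) :
    linProd (rowRoots q (n + 3)) =
      shiftProd (qP q : Params) ((qP q : Params) ^ 3 * (h 1 / e 9)) n := by
  interval_cases n <;>
    simp only [rowRoots, linProd_cons, linProd_nil, shiftProd] <;>
    simp only [Finset.prod_range_succ, Finset.prod_range_zero, pow_zero, one_mul, mul_one, pow_succ,
      mul_assoc]

lemma paramHom_zero_e {k : Fin 11} (h9 : k ≠ 9) (h10 : k ≠ 10) : paramHom 0 (e k) = e k := by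
  rw [paramHom_e]
  simp [sE, h9, h10]

lemma paramHom_zero_f {k : Fin 11} (h9 : k ≠ 9) (h10 : k ≠ 10) :
    paramHom 0 (e k / h 0) = e k / h 0 * e 10 / (h 1 / e 9) := by
  have h0 := h_ne_zero 0
  have h1 := h_ne_zero 1
  rw [map_div₀, paramHom_zero_e h9 h10, paramHom_h]
  simp [sH]
  field_simp

/-- The first column depends only on q and e_1, …, e_6, which s_0 fixes; the other parameters change
as in `gridRow_exchange`. -/
lemma map_rowCoeff (i : ℕ) :
    (rowCoeff q i).map (paramHom 0).toRingHom = rowCoeff q i := by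
  have hc : (colRoots q 0).map (paramHom 0).toRingHom = colRoots q 0 := by
    simp only [colRoots, List.map_cons, List.map_nil, AlgHom.toRingHom_eq_coe, RingHom.coe_coe,
      map_mul, map_inv₀, paramHom_qP]
    rw [paramHom_zero_e (by decide) (by decide), paramHom_zero_e (by decide) (by decide),
      paramHom_zero_e (by decide) (by decide), paramHom_zero_e (by decide) (by decide),
      paramHom_zero_e (by decide) (by decide), paramHom_zero_e (by decide) (by decide)]
  have hc' : ∀ k, (paramHom 0).toRingHom ((linProdMul (colRoots q 0) [1]).getD k 0) =
      (linProdMul (colRoots q 0) [1]).getD k 0 := fun k => by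
    have h1 := linProdMul_map (paramHom 0).toRingHom (colRoots q 0) [1]
    rw [hc, List.map_cons, map_one, List.map_nil] at h1
    conv_rhs => rw [← h1]
    rw [← map_zero (paramHom 0).toRingHom, List.getD_map, map_zero]
  rw [rowCoeff, gridRow_map]
  simp only [hc']
  have he := fun k => paramHom_zero_e (k := k)
  change gridRow (paramHom 0 (qP q : Params)) (paramHom 0 (e 10)) (paramHom 0 (h 1 / e 9))
    (paramHom 0 (e 6 / h 0)) (paramHom 0 (e 7 / h 0)) (paramHom 0 (e 8 / h 0))
    (paramHom 0 _) (paramHom 0 _) _ i = _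
  rw [paramHom_qP, paramHom_zero_w, paramHom_zero_g, paramHom_zero_f (by decide) (by decide),
    paramHom_zero_f (by decide) (by decide), paramHom_zero_f (by decide) (by decide),
    gridRow_exchange (e_ne_zero 10) g_ne_zero]
  simp only [map_add, map_inv₀]
  rw [he 0 (by decide) (by decide), he 1 (by decide) (by decide), he 2 (by decide) (by decide),
    he 3 (by decide) (by decide), he 4 (by decide) (by decide), he 5 (by decide) (by decide)]

/-- Since s_0 fixes y and q, the image of x still q-commutes with y. Each row is then invariant
separately: up to the middle row e_11 is replaced by h_2/e_10 in the linear factors, above it the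
reverse. -/
lemma reflHom_zero_curve_basePoly : reflHom q 0 (curve q (basePoly q)) = curve q (basePoly q) := by
  have hq : (qP q : Params) ≠ 0 := (qP q).ne_zero
  have hσq : (paramHom 0).toRingHom (qP q : Params) = (qP q : Params) := paramHom_q 0
  have hσg : (paramHom 0).toRingHom (h 1 / e 9) = e 10 := paramHom_zero_g
  have hσw : (paramHom 0).toRingHom (e 10) = h 1 / e 9 := paramHom_zero_w
  have hx : (y * x : K q) = (qP q : Params) • (x * y) := QField.y_mul_x
  have hx0 : (x : K q) ≠ 0 := QField.x_ne_zero
  have hX0 : reflHom q 0 x ≠ 0 := (_root_.map_ne_zero _).mpr hx0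
  have hy := reflHom_y_of_ne (q := q) (i := 0) (by decide)
  have hX : y * reflHom q 0 x = (qP q : Params) • (reflHom q 0 x * y) := by
    have := congrArg (reflHom q 0) hx
    rwa [RingHom.map_mul, reflHom_smul, RingHom.map_mul, hy, paramHom_qP] at this
  have hXx : reflHom q 0 x * (1 + e 10 • y) = x * (1 + (h 1 / e 9) • y) := by
    rw [reflHom_zero_x, mul_assoc, inv_mul_cancel₀ (QField.one_add_smul_y_ne_zero _), mul_one]
  rw [basePoly_eq_rows]
  refine reflHom_curve_sum 0 _ _ fun i hi => ?_
  rw [curve_x_pow_mul, RingHom.map_mul, RingHom.map_mul, RingHom.map_mul, map_inv₀, map_inv₀,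
    RingHom.map_pow, RingHom.map_pow, reflHom_aeval, hy, rowPoly, Polynomial.map_mul, polyL_map,
    map_rowCoeff]
  congr 1
  have hi7 := Finset.mem_range.mp hi
  by_cases hi3 : i ≤ 3
  · rw [linProd_rowRoots_of_le hi3, shiftProd_map _ hσq, RingHom.map_mul, RingHom.map_pow, hσq, hσw]
    exact low_row_congr (F := Params) (D := K q) hq hx hX hx0 hX0 hXx (by omega) _
  · obtain ⟨n, rfl⟩ : ∃ n, i = n + 3 := ⟨i - 3, by omega⟩
    rw [linProd_rowRoots_of_ge (by omega), shiftProd_map _ hσq, RingHom.map_mul, RingHom.map_pow, hσq, hσg]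
    exact high_row_congr (F := Params) (D := K q) hq hx hX hx0 hX0 hXx n _

lemma reflHom_curve_basePoly (i : Fin 9) :
    reflHom q i (curve q (basePoly q)) = curve q (basePoly q) := by
  by_cases h0 : i = 0
  · rw [h0, reflHom_zero_curve_basePoly]
  by_cases h3 : i = 3
  · rw [h3, reflHom_three_curve_basePoly]
  exact reflHom_curve_basePoly_of_ne h0 h3

lemma IsE8Polynomial.eq_add {c : ℂ} {P P₀ : Plane q} (h₀ : IsE8Polynomial q 0 P₀)
    (hP : IsE8Polynomial q c P) :
    P = P₀ + algebraMap ℂ Params c • (QPlane.x ^ 3 * QPlane.y) := hP.eq (h₀.add_smul c)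

lemma IsE8Polynomial.curve_eq_add {c : ℂ} {P P₀ : Plane q} (h₀ : IsE8Polynomial q 0 P₀)
    (hP : IsE8Polynomial q c P) :
    curve q P = curve q P₀ + algebraMap ℂ (K q) (c * ((q : ℂ) ^ 3)⁻¹) := by
  rw [h₀.eq_add hP, curve_add, curve_smul_x_pow_mul_y]

lemma IsE8Polynomial.reflHom_curve {c : ℂ} {P : Plane q} (hP : IsE8Polynomial q c P)
    (i : Fin 9) : reflHom q i (curve q P) = curve q P := by
  rw [basePoly_isE8Polynomial.curve_eq_add hP, RingHom.map_add, reflHom_curve_basePoly,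
    reflHom_const]

lemma IsQuantumAction.apply_curve {ρ : W →* (K q ≃ₐ[ℂ] K q)} (hρ : IsQuantumAction q ρ) {c : ℂ}
    {P : Plane q} (hP : IsE8Polynomial q c P) (w : W) : ρ w (curve q P) = curve q P := by
  induction w using coxeterMatrix.toCoxeterSystem.simple_induction with
  | simple i => exact (congrArg (fun φ => φ (curve q P)) (hρ.simple_eq i)).trans (hP.reflHom_curve i)
  | one => rw [map_one, AlgEquiv.one_apply]
  | mul w w' hw hw' => rw [map_mul, AlgEquiv.mul_apply, hw', hw]

end QuantumE8

/-! ### The rectangular form -/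

lemma sq_sum_eq_add_two_mul {F : Type*} [CommRing F] {n : ℕ} (a : Fin n → F) :
    (∑ i, a i) ^ 2 = ∑ i, a i ^ 2 + 2 * ∑ i, ∑ j ∈ Finset.Ioi i, a i * a j := by
  induction n with
  | zero => simp
  | succ n ih =>
    rw [Fin.sum_univ_succ, Fin.sum_univ_succ, Fin.sum_univ_succ, Fin.sum_Ioi_zero]
    simp only [Fin.sum_Ioi_succ]
    rw [add_sq, ih fun i => a i.succ, ← Finset.mul_sum]
    ring

section Reverse

variable {F D : Type*} [Field F] [DivisionRing D] [Algebra F D]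

/-- `T(r / u) = c u⁻ⁿ f(u)`. -/
def IsReverse (r : F) (u : D) (n : ℕ) (c : F) (f T : F[X]) : Prop :=
  aeval (r • u⁻¹) T = c • ((u ^ n)⁻¹ * aeval u f)

variable {r : F} {u : D}

lemma IsReverse.mul {m n : ℕ} {c d : F} {f g S T : F[X]} (hf : IsReverse r u m c f S)
    (hg : IsReverse r u n d g T) : IsReverse r u (m + n) (c * d) (f * g) (S * T) := by
  have hc : Commute (aeval u f) (u ^ n)⁻¹ := by
    have := (Commute.all f (X ^ n)).map (aeval u)
    rw [map_pow, aeval_X] at this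
    exact this.inv_right₀
  unfold IsReverse at *
  rw [map_mul, map_mul, hf, hg, smul_mul_smul_comm, mul_assoc, ← mul_assoc (aeval u f), hc.eq,
    add_comm m n, pow_add, mul_inv_rev]
  simp only [mul_assoc]

lemma isReverse_of_coeff (hu : u ≠ 0) {n : ℕ} {c : F} {f T : F[X]} (hf : f.natDegree ≤ n)
    (hT : T.natDegree ≤ n) (h : ∀ k ≤ n, T.coeff k * r ^ k = c * f.coeff (n - k)) :
    IsReverse r u n c f T := by
  rw [IsReverse, aeval_eq_sum_range' (Nat.lt_succ_of_le hT),
    aeval_eq_sum_range' (Nat.lt_succ_of_le hf), Finset.mul_sum, Finset.smul_sum,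
    ← Finset.sum_range_reflect]
  refine Finset.sum_congr rfl fun k hk => ?_
  have hk' := Nat.lt_succ_iff.mp (Finset.mem_range.mp hk)
  rw [Nat.succ_eq_add_one, Nat.add_sub_cancel, _root_.smul_pow, smul_smul, h _ (Nat.sub_le n k),
    Nat.sub_sub_self hk', mul_smul_comm, smul_smul]
  congr 1
  have : u ^ n = u ^ k * u ^ (n - k) := by rw [← pow_add, Nat.add_sub_cancel' hk']
  rw [this, mul_inv_rev, mul_assoc, inv_mul_cancel₀ (pow_ne_zero k hu), mul_one, inv_pow]

lemma isReverse_add_C (hu : u ≠ 0) (b : F) :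
    IsReverse r u 1 r (1 + C b * X) (X + C (r * b)) := by
  refine isReverse_of_coeff hu (by compute_degree) (by compute_degree) fun k hk => ?_
  interval_cases k
  · rw [coeff_add, coeff_add, coeff_X_zero, coeff_C_zero, coeff_C_mul, coeff_one]
    simp
  · rw [coeff_add, coeff_add, coeff_X_one, coeff_C_mul, coeff_one, coeff_C]
    simp

/-- Each factor evaluates as r/u + r b = (r/u)(1 + b u), contributing one r and one u⁻¹. -/
lemma isReverse_linProd (hu : u ≠ 0) (bs : List F) :
    IsReverse r u bs.length (r ^ bs.length) (linProd bs)
      (bs.map fun b => X + C (r * b)).prod := by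
  induction bs with
  | nil => simp [IsReverse, linProd_nil]
  | cons b bs ih =>
    have := (isReverse_add_C (r := r) hu b).mul ih
    rw [add_comm 1] at this
    rwa [List.length_cons, pow_succ', linProd_cons, List.map_cons, List.prod_cons]

/-- The scale r⁻¹ is forced by the top coefficient: r⁶ against the prefactor 1/(r⁷ g), with w = 1/g.
-/
lemma isReverse_T₁ (hu : u ≠ 0) (hr : r ≠ 0) {g : F} (hg : g ≠ 0) (κ A₁ A₂ B₁ B₂ : F) :
    IsReverse r u 6 r⁻¹ (polyL (gridCol (r ^ 2) g⁻¹ κ A₁ A₂ B₁ B₂ 0))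
      (C (r ^ 7 * g)⁻¹ *
        (C (1 + r ^ 2 + (r ^ 2) ^ 2) * X ^ 6 + C (r * (1 + r ^ 2) * B₁) * X ^ 5 +
          C (r ^ 2 * (κ * A₁ + B₂)) * X ^ 4 + C (r ^ 2 * κ * (κ * A₂ + B₁)) * X ^ 2 +
          C (r * (1 + r ^ 2) * κ ^ 2 * A₁) * X + C ((1 + r ^ 2 + (r ^ 2) ^ 2) * κ ^ 2))) := by
  refine isReverse_of_coeff hu (natDegree_polyL_le (by simp [gridCol])) (by compute_degree)
    fun k hk => ?_
  rw [polyL_coeff]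
  simp only [coeff_C_mul, coeff_add, coeff_X_pow, coeff_X, coeff_C]
  interval_cases k <;> simp [gridCol] <;> field_simp

lemma isReverse_T₂ (hu : u ≠ 0) (hr : r ≠ 0) {g : F} (hg : g ≠ 0) (κ A₁ A₂ B₁ B₂ : F) :
    IsReverse r u 3 (r ^ 11)⁻¹ (polyL (gridCol (r ^ 2) g⁻¹ κ A₁ A₂ B₁ B₂ 1))
      (C (r ^ 12 * g ^ 2)⁻¹ *
        (C (1 + r ^ 2 + (r ^ 2) ^ 2) * X ^ 3 + C (r ^ 3 * B₁) * X ^ 2 + C (r ^ 4 * κ * A₁) * X +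
          C (r ^ 3 * (1 + r ^ 2 + (r ^ 2) ^ 2) * κ))) := by
  refine isReverse_of_coeff hu (natDegree_polyL_le (by simp [gridCol])) (by compute_degree)
    fun k hk => ?_
  rw [polyL_coeff]
  simp only [coeff_C_mul, coeff_add, coeff_X_pow, coeff_X, coeff_C]
  interval_cases k <;> simp [gridCol] <;> field_simp

lemma isReverse_T₃ (hu : u ≠ 0) (hr : r ≠ 0) {g : F} (hg : g ≠ 0) (κ A₁ A₂ B₁ B₂ : F) :
    IsReverse r u 0 (r ^ 21)⁻¹ (polyL (gridCol (r ^ 2) g⁻¹ κ A₁ A₂ B₁ B₂ 2))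
      (C (r ^ 15 * g ^ 3)⁻¹) := by
  refine isReverse_of_coeff hu (natDegree_polyL_le (by simp [gridCol])) (by compute_degree)
    fun k hk => ?_
  rw [polyL_coeff]
  interval_cases k
  simp [gridCol]
  field_simp

/-- The hypothesis `h` collects all scalars: r⁻³ from Q⁻³, the reversal scale c, and rʲ⁻¹ from the
power of P. Also Q⁻³ supplies u³, turning u⁻⁶ into u⁻³. -/
lemma reverse_term (hu : u ≠ 0) {v A : D} {c d : F} {j : ℕ}
    (h : (r ^ 3)⁻¹ * c * (r ^ j * r⁻¹) = d) :
    ((r • u⁻¹) ^ 3)⁻¹ * (c • ((u ^ 6)⁻¹ * A) * ((r • v) ^ j * (r • v)⁻¹)) =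
      d • ((u ^ 3)⁻¹ * (A * (v ^ j * v⁻¹))) := by
  have h6 : u ^ 3 * (u ^ 6)⁻¹ = (u ^ 3)⁻¹ := by
    rw [show u ^ 6 = u ^ 3 * u ^ 3 by rw [← pow_add], mul_inv_rev,
      mul_inv_cancel_left₀ (pow_ne_zero 3 hu)]
  rw [_root_.smul_pow, _root_.smul_pow, smul_inv₀, smul_inv₀, inv_pow, inv_inv, smul_mul_smul_comm,
    smul_mul_smul_comm, smul_mul_smul_comm, ← mul_assoc (r ^ 3)⁻¹, h, ← h6]
  simp only [mul_assoc]

end Reverse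

namespace QPlane

variable {F : Type*} [Field F] {q : Fˣ}

lemma evalAt_eq_sum {K : Type*} [Ring K] [Algebra F K] {P : QPlane F q} {n : ℕ} (h : DegLT P n)
    (u v : K) : evalAt P u v = ∑ j ∈ Finset.range n,
      aeval u (QBase.toPoly q (SkewPolynomial.coeff P j)) * v ^ j := by
  rw [evalAt]
  refine SkewPolynomial.sum_eq_of_subset _ (fun i => by rw [map_zero, map_zero, zero_mul]) ?_
  intro j hj
  rw [Finset.mem_range]
  by_contra hn
  exact SkewPolynomial.mem_support_iff.mp hj (h j (not_lt.mp hn))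

lemma eq_sum_aeval_x {P : QPlane F q} {n : ℕ} (h : DegLT P n) : P = ∑ j ∈ Finset.range n,
      aeval x (QBase.toPoly q (SkewPolynomial.coeff P j)) * y ^ j := by
  conv_lhs => rw [eq_sum_of_degLT h]
  refine Finset.sum_congr rfl fun j _ => ?_
  rw [aeval_x_mul_y_pow, RingEquiv.symm_apply_apply]

end QPlane

namespace QuantumE8

open QField (incl x y)

variable {q : ℂˣ}

lemma curve_eq_rescaledCurve (P : Plane q) : curve q P = rescaledCurve q P := by
  obtain ⟨n, hn⟩ := QPlane.exists_degLT P
  rw [rescaledCurve, QPlane.evalAt_eq_sum hn, Finset.mul_sum, Finset.sum_mul]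
  conv_lhs => rw [QPlane.eq_sum_aeval_x hn]
  rw [curve_sum]
  refine Finset.sum_congr rfl fun j _ => ?_
  rw [curve_aeval_x_mul, _root_.smul_pow, mul_smul_comm, mul_smul_comm, smul_mul_assoc]
  simp only [mul_assoc]

lemma rectQ_mul_rectP (r : ℂ) :
    rectQ q r * rectP q r = (qP q : Params) • (rectP q r * rectQ q r) := by
  have h : (x⁻¹ * y : K q) = (qP q : Params) • (y * x⁻¹) := by
    rw [inv_mul_eq_iff_eq_mul₀ QField.x_ne_zero, mul_smul_comm, ← mul_assoc, ← smul_mul_assoc,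
      ← QField.y_mul_x, mul_assoc, mul_inv_cancel₀ QField.x_ne_zero, mul_one]
  rw [rectQ, rectP, smul_mul_smul_comm, smul_mul_smul_comm, h, smul_comm]

lemma append_eq_nine :
    (Fin.append (fun i : Fin 6 => rectG 0 * rectH i) (fun k : Fin 3 => (rectF k)⁻¹) : Fin 9 → Params) =
      nine := by
  have h10 := e_ne_zero 10
  funext k
  fin_cases k <;> simp [Fin.append, Fin.addCases, rectG, rectH, rectF, nine, h10]

lemma sum_Ioi_eq_symA₂ : ∑ i, ∑ j ∈ Finset.Ioi i, nine i * nine j = symA₂ := by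
  rw [symA₂, sq_sum_eq_add_two_mul, add_sub_cancel_left, mul_div_cancel_left₀ _ two_ne_zero_params]

lemma sum_Ioi_eq_symB₂ : ∑ i, ∑ j ∈ Finset.Ioi i, (nine i * nine j)⁻¹ = symB₂ := by
  simp only [mul_inv]
  rw [symB₂, sq_sum_eq_add_two_mul, add_sub_cancel_left, mul_div_cancel_left₀ _ two_ne_zero_params]

lemma kappa_eq : rectF 0 * rectF 1 * rectF 2 * rectG 1 / rectG 0 = kappa := by
  have h0 := h_ne_zero 0
  have h1 := h_ne_zero 1
  have e9 := e_ne_zero 9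
  have e10 := e_ne_zero 10
  simp only [rectF, rectG, kappa]
  simp
  field_simp

lemma rectangularCurve_basePoly {r : ℂ} (hr : r ^ 2 = (q : ℂ)) :
    rectangularCurve (algebraMap ℂ Params r) rectF rectG rectH (rectQ q r) (rectP q r) =
      (qP q : Params) • curve q (basePoly q) := by
  set R : Params := algebraMap ℂ Params r with hR
  have hRq : R ^ 2 = (qP q : Params) := by
    rw [hR, ← map_pow, hr]
    rfl
  have hR0 : R ≠ 0 := fun h0 => (qP q).ne_zero (by rw [← hRq, h0, zero_pow two_ne_zero])
  have hx : (x : K q) ≠ 0 := QField.x_ne_zero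
  have hg : rectG 0 ≠ 0 := by simp [rectG, e_ne_zero 10]
  have hw : (rectG 0)⁻¹ = e 10 := by simp [rectG]
  have hcol : ∀ j, colCoeff q (j + 1) =
      gridCol (R ^ 2) (rectG 0)⁻¹ kappa symA₁ symA₂ symB₁ symB₂ j := fun j => by
    rw [colCoeff, hw, hRq]
  have h0 : IsReverse R (x : K q) 6 (R ^ 6) (colPoly q 0)
      (∏ i, (X + C (R * rectG 0 * rectH i)⁻¹)) := by
    have he : ∀ k : Fin 11, R * ((qP q : Params)⁻¹ * (e k)⁻¹) = (R * rectG 0 * (e 10 * e k))⁻¹ :=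
      fun k => by
        have := e_ne_zero k
        have := e_ne_zero 10
        rw [← hRq, ← hw]
        field_simp
    have hT : ((colRoots q 0).map fun b => X + C (R * b)).prod =
        ∏ i, (X + C (R * rectG 0 * rectH i)⁻¹) := by
      rw [Fin.prod_univ_def]
      simp only [colRoots, List.map_cons, List.map_nil, he]
      rfl
    rw [colPoly, show polyL (colCoeff q 0) = 1 by simp [colCoeff, polyL], mul_one, ← hT]
    exact isReverse_linProd hx (colRoots q 0)
  have h1 := isReverse_T₁ hx hR0 hg kappa symA₁ symA₂ symB₁ symB₂
  rw [← hcol, show polyL (colCoeff q (0 + 1)) = colPoly q 1 from (one_mul _).symm] at h1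
  have h2 := (isReverse_linProd (r := R) hx (colRoots q 2)).mul
    (isReverse_T₂ hx hR0 hg kappa symA₁ symA₂ symB₁ symB₂)
  rw [← hcol] at h2
  change IsReverse R (x : K q) 6 (R ^ 3 * (R ^ 11)⁻¹) (colPoly q 2) _ at h2
  have h3 := (isReverse_linProd (r := R) hx (colRoots q 3)).mul
    (isReverse_T₃ hx hR0 hg kappa symA₁ symA₂ symB₁ symB₂)
  rw [← hcol] at h3
  change IsReverse R (x : K q) 6 (R ^ 6 * (R ^ 21)⁻¹) (colPoly q 3) _ at h3
  have hT2 : ((colRoots q 2).map fun b => X + C (R * b)).prod = ∏ k, (X + C (R * rectF k)) := by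
    rw [Fin.prod_univ_def]
    rfl
  have hT3 : ((colRoots q 3).map fun b => X + C (R * b)).prod =
      ∏ k, ((X + C (R * rectF k)) * (X + C (R ^ 3 * rectF k))) := by
    simp only [colRoots, List.map_cons, List.map_nil, List.prod_cons, List.prod_nil,
      Fin.prod_univ_three, ← hRq, ← mul_assoc, ← pow_succ', mul_one]
    rfl
  rw [hT2, ← mul_assoc, mul_comm (∏ k, _) (C _)] at h2
  rw [hT3, mul_comm (∏ k, _) (C _)] at h3
  have hP : rectP q r ≠ 0 := smul_ne_zero hR0 QField.y_ne_zero
  have p1 : rectP q r ^ 1 * (rectP q r)⁻¹ = 1 := by rw [pow_one, mul_inv_cancel₀ hP]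
  have p2 : rectP q r ^ 2 * (rectP q r)⁻¹ = rectP q r := by
    rw [pow_two, mul_assoc, mul_inv_cancel₀ hP, mul_one]
  have p3 : rectP q r ^ 3 * (rectP q r)⁻¹ = rectP q r ^ 2 := by
    rw [pow_succ, mul_assoc, mul_inv_cancel₀ hP, mul_one]
  -- The required scalar is q · q⁻³ʲ = R^(2-6j). The four scales R⁶, R⁻¹, R⁻⁸ and R⁻¹⁵ found above
  -- are those satisfying it for j = 0, 1, 2, 3.
  have t : ∀ (j : ℕ) (c : Params) (A : K q),
      (R ^ 3)⁻¹ * c * (R ^ j * R⁻¹) = R ^ 2 * ((R ^ 2) ^ 3)⁻¹ ^ j →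
      (qP q : Params) • (((qP q : Params) ^ 3)⁻¹ ^ j) • ((x ^ 3)⁻¹ * (A * (y ^ j * y⁻¹))) =
        (rectQ q r ^ 3)⁻¹ * (c • ((x ^ 6)⁻¹ * A) * (rectP q r ^ j * (rectP q r)⁻¹)) :=
    fun j c A hc => by
      rw [smul_smul, ← hRq]
      exact (reverse_term hx hc).symm
  change aeval (rectQ q r) _ = _ at h0
  change aeval (rectQ q r) _ = _ at h1
  change aeval (rectQ q r) _ = _ at h2
  change aeval (rectQ q r) _ = _ at h3
  unfold symA₁ symB₁ at h1 h2
  simp only [rectangularCurve, append_eq_nine, kappa_eq, sum_Ioi_eq_symA₂, sum_Ioi_eq_symB₂]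
  rw [h0, h1, h2, h3, basePoly, curve_sum]
  simp only [curve_aeval_x_mul, Finset.sum_range_succ, Finset.sum_range_zero, zero_add, smul_add]
  rw [t 0 (R ^ 6) _ (by field_simp), t 1 R⁻¹ _ (by field_simp),
    t 2 (R ^ 3 * (R ^ 11)⁻¹) _ (by field_simp), t 3 (R ^ 6 * (R ^ 21)⁻¹) _ (by field_simp),
    p1, p2, p3, pow_zero, one_mul, mul_one, mul_add, mul_add, mul_add]

lemma IsE8Polynomial.rectangularCurve_eq {P₀ : Plane q} (h₀ : IsE8Polynomial q 0 P₀) {r : ℂ}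
    (hr : r ^ 2 = (q : ℂ)) :
    rectangularCurve (algebraMap ℂ Params r) rectF rectG rectH (rectQ q r) (rectP q r) =
      (qP q : Params) • rescaledCurve q P₀ := by
  rw [← curve_eq_rescaledCurve, h₀.eq basePoly_isE8Polynomial, rectangularCurve_basePoly hr]

end QuantumE8

end

theorem mainTheorem6 (q : ℂˣ) :
    -- the quantum action of the affine Weyl group on the skew field exists and is unique
    (∃! ρ : QuantumE8.W →* (QuantumE8.K q ≃ₐ[ℂ] QuantumE8.K q), QuantumE8.IsQuantumAction q ρ) ∧
    -- for each value of the free constant there is exactly one normalized polynomial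
    (∀ c : ℂ, ∃! P : QuantumE8.Plane q, QuantumE8.IsE8Polynomial q c P) ∧
    -- the quotient is invariant under the whole affine Weyl group
    (∀ ρ : QuantumE8.W →* (QuantumE8.K q ≃ₐ[ℂ] QuantumE8.K q), QuantumE8.IsQuantumAction q ρ →
      ∀ (c : ℂ) (P : QuantumE8.Plane q), QuantumE8.IsE8Polynomial q c P →
        ∀ w : QuantumE8.W, ρ w (QuantumE8.curve q P) = QuantumE8.curve q P) ∧
    -- a change of the free constant only adds a scalar to the quotient
    (∀ (P₀ : QuantumE8.Plane q), QuantumE8.IsE8Polynomial q 0 P₀ →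
      ∀ (c : ℂ) (P : QuantumE8.Plane q), QuantumE8.IsE8Polynomial q c P →
        P = P₀ + algebraMap ℂ QuantumE8.Params c • (QPlane.x ^ 3 * QPlane.y) ∧
        QuantumE8.curve q P =
          QuantumE8.curve q P₀ + algebraMap ℂ (QuantumE8.K q) (c * ((q : ℂ) ^ 3)⁻¹)) ∧
    -- the change of variables and parameters to the rectangular form of the quantum curve
    (∀ r : ℂ, r ^ 2 = (q : ℂ) →
      QuantumE8.rectQ q r * QuantumE8.rectP q r =
        (QuantumE8.qP q : QuantumE8.Params) • (QuantumE8.rectP q r * QuantumE8.rectQ q r) ∧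
      ∀ P₀ : QuantumE8.Plane q, QuantumE8.IsE8Polynomial q 0 P₀ →
        QuantumE8.curve q P₀ = QuantumE8.rescaledCurve q P₀ ∧
        QuantumE8.rectangularCurve (algebraMap ℂ QuantumE8.Params r) QuantumE8.rectF
            QuantumE8.rectG QuantumE8.rectH (QuantumE8.rectQ q r) (QuantumE8.rectP q r) =
          (QuantumE8.qP q : QuantumE8.Params) • QuantumE8.rescaledCurve q P₀) :=
  ⟨QuantumE8.existsUnique_isQuantumAction, QuantumE8.existsUnique_isE8Polynomial,
    fun _ hρ _ _ hP w => hρ.apply_curve hP w,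
    fun _ h₀ _ _ hP => ⟨h₀.eq_add hP, h₀.curve_eq_add hP⟩,
    fun r hr => ⟨QuantumE8.rectQ_mul_rectP r,
      fun P₀ h₀ => ⟨QuantumE8.curve_eq_rescaledCurve P₀, h₀.rectangularCurve_eq hr⟩⟩⟩
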